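/- **Setting.** Fix $p\in\mathbb N$. Let $t\to\infty$ index a sequence of designs: at stage $t$ there are $m=m_t$ clusters, cluster $i\le m$ has $n_i=n_{t,i}$ measurements with covariates $x_{ij}=x_{t,ij}\in\mathbb R^p$, used for both the fixed and the random effects. Put $X_i=[x_{i1},\dots,x_{in_i}]^\top$, $N=\sum_{i\le m}n_i$, $n=N/m$, $n_L=\min_{i\le m} n_i$. Assume $m\to\infty$, $n_L\to\infty$, $m/n_L\to0$ and $n_i=O(n_L)$ uniformly in $i\le m$. Let $a$ be a function on an open interval $D\subseteq\mathbb R$, $\dot\phi>0$, and let $f(y\mid\eta,\phi)=\exp[\phi^{-1}\{y\eta-a(\eta)\}+c(y,\phi)]$, where $f(\cdot\mid\eta,\dot\phi)$ is a probability density with respect to a fixed measure $\nu$ for every $\eta\in D$. Let $\dot\beta\in\mathbb R^p$, and let $\dot b_1,\dot b_2,\dots\in\mathbb R^p$ be the (realised, given) true random effects. Conditionally on them the responses $y_{ij}$ of stage $t$ are independent, $y_{ij}$ having density $f(\cdot\mid\dot\eta_{ij},\dot\phi)$ with $\dot\eta_{ij}=x_{ij}^\top\dot\beta+x_{ij}^\top\dot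 b_i$; all probabilities below are conditional on $(\dot b_i)$. Let $\dot\mu_{ij}=a'(\dot\eta_{ij})$ and $\dot\theta=(\dot\beta^\top,\dot b_1^\top,\dots,\dot b_m^\top)^\top$. Given a working matrix $\hat G$ and working dispersion $\hat\phi$ (random, possibly depending on the data), the PQL estimator $\hat\theta=(\hat\beta^\top,\hat b_1^\top,\dots,\hat b_m^\top)^\top$ is a random vector which, with probability tending to one, maximises $$Q(\theta)=\sum_{i=1}^m\sum_{j=1}^{n_i}\ln f(y_{ij}\mid x_{ij}^\top\beta+x_{ij}^\top b_i,\hat\phi)-\tfrac12\sum_{i=1}^m b_i^\top\hat G^{-1}b_i$$ over all $\theta=(\beta,b_1,\dots,b_m)$ whose linear predictors lie in $D$ (all $\theta$, if $D=\mathbb R$). Write $\dot W_i(\phi)=\phi^{-1}\mathrm{diag}\{a''(\dot\eta_{i1}),\dots,a''(\dot\eta_{in_i})\}$ and $\dot H_i=\{n_i^{-1}X_i^\top\dot W_i(\dot\phi)X_i\}^{-1}$. **Conditions.** * (C1) $a$ is three times continuously differentiable on $D$, and for some $c_0>0$: $c_0\le a''\le c_0^{-1}$ and $|a'''|\le c_0^{-1}$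 on $D$. * (C2) The $\|x_{ij}\|_\infty$ are bounded by a constant. As $t\to\infty$, $\dot H_i\to\dot K_i$ for each $i$ and $m^{-1}\sum_{i=1}^m n n_i^{-1}\dot H_i\to\dot K$. For some $c_1>0$ the eigenvalues of $\dot K$, of all $\dot K_i$ and, for all large $t$, of all $\dot H_i$, $i\le m$, lie in $[c_1,c_1^{-1}]$. * (C3) For some $\varepsilon>0$, $(\dot\eta_{ij}-\varepsilon,\dot\eta_{ij}+\varepsilon)\subseteq D$ for all $t$, $i\le m$, $j\le n_i$; and $\sup_{M\ge1}M^{-1}\sum_{i=1}^M\|\dot b_i\|<\infty$. * (C4) $\hat G$ is positive definite with $\hat G^{-1}=O_p(1)$; $\hat\phi>0$ and $\hat\phi=O_p(1)$. * (C5) For all $t$ and $i\le m$, each component of $n_i^{1/2}\{X_i^\top\dot W_i(\hat\phi)X_i+\hat G^{-1}\}^{-1}\{\hat\phi^{-1}X_i^\top(y_i-\dot\mu_i)-\hat G^{-1}\dot b_i\}$ has a finite fourth moment. **Finite selection.** $A=A_t$ is a $q\times(m+1)p$ matrix ($q$ fixed), written $[A^{(0)},A^{(1)},\dots,A^{(m)}]$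 with $q\times p$ blocks, such that for each row there is $m_0$ with that row of $A^{(i)}$ zero for all $i>m_0$ whenever $m>m_0$, and such that $A^{(i)}\to L_i$ componentwise for each $i\ge0$, with some $L_i\ne0$. **Theorem.** Let the growth assumptions and (C1) hold. If $D=\mathbb R$ and $\dot b_1,\dot b_2,\dots$ are i.i.d. $N(0,\dot G)$ with $\dot G$ positive semidefinite, then almost every realisation $(\dot b_i)$ satisfies (C3). For every sequence $(\dot b_i)$ for which (C2)–(C5) hold, put $\dot\theta^*=\dot\theta-(-1,1,\dots,1)^\top\otimes m^{-1}\sum_{i=1}^m\dot b_i$, i.e. $\dot\theta^*$ has fixed effects $\dot\beta+m^{-1}\sum_{i}\dot b_i$ and random effects $\dot b_i-m^{-1}\sum_{i'}\dot b_{i'}$. Then, conditionally on $(\dot b_i)$ and as $t\to\infty$: (a) $\|\hat\theta-\dot\theta^*\|_\infty=o_p(1)$. (b) For every $A$ with the finite selection property, with $\mathcal D=\mathrm{bdiag}(N^{1/2}I_p,n_1^{1/2}I_p,\dots,n_m^{1/2}I_p)$, the limit $$\Omega=\lim_{t\to\infty}A\,\mathrm{bdiag}\Big\{\tfrac1m\sum_{i=1}^m\tfrac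 n{n_i}\dot H_i,\ \dot H_1,\dots,\dot H_m\Big\}A^\top$$ exists, is positive semidefinite, and equals $L_0\dot KL_0^\top+\sum_{i\ge1}L_i\dot K_iL_i^\top$ (so fixed effects and the different clusters are asymptotically independent), and $$A\,\mathcal D\,(\hat\theta-\dot\theta^*)\ \xrightarrow{D}\ N(0,\Omega).$$ -/

import Mathlib

open MeasureTheory ProbabilityTheory Filter Topology Matrix

noncomputable section

namespace PQL

/-- A one-parameter exponential dispersion family at its true dispersion parameter `φ`: for every
canonical parameter `η` in the open interval `dom`, the function
`y ↦ exp (φ⁻¹ (y η - a η) + c y φ)` is a probability density with respect to `ν`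
(for instance Lebesgue or counting measure). Values of `a` outside `dom` are irrelevant. -/
structure ExpFamily where
  dom : Set ℝ
  a : ℝ → ℝ
  c : ℝ → ℝ → ℝ
  ν : Measure ℝ
  φ : ℝ
  isOpen_dom : IsOpen dom
  convex_dom : Convex ℝ dom
  φ_pos : 0 < φ
  measurable_c : Measurable fun y => c y φ
  normalized : ∀ η ∈ dom, ∫⁻ y, ENNReal.ofReal (Real.exp (φ⁻¹ * (y * η - a η) + c y φ)) ∂ν = 1

/-- The log-density `ln f(y | η, φ)`, with the dispersion parameter left free. -/
def ExpFamily.logDensity (F : ExpFamily) (φ η y : ℝ) : ℝ :=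
  φ⁻¹ * (y * η - F.a η) + F.c y φ

/-- The distribution of a response with canonical parameter `η` and the true dispersion. -/
def ExpFamily.law (F : ExpFamily) (η : ℝ) : Measure ℝ :=
  F.ν.withDensity fun y => ENNReal.ofReal (Real.exp (F.logDensity F.φ η y))

/-- Mean function `a'`. -/
def ExpFamily.mean (F : ExpFamily) (η : ℝ) : ℝ := deriv F.a η

/-- An asymptotic sequence of designs, indexed by `t`: at stage `t` there are `m t` clusters, cluster
`i < m t` has `n t i` measurements, and `x t i j`, `j < n t i`, are the covariate vectors, used both
for the fixed and for the random effects. -/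
structure Design (p : ℕ) where
  m : ℕ → ℕ
  n : ℕ → ℕ → ℕ
  x : ℕ → ℕ → ℕ → Fin p → ℝ

/-- Parameter vectors `θ = (β, b₁, …, b_m)` of length `(m + 1) p`: the coordinate `(k, none)` is the
`k`-th fixed effect, the coordinate `(k, some i)` is the `k`-th random effect of cluster `i`. The
norm of this type is the maximum norm. -/
abbrev Param (p m : ℕ) : Type := Fin p × Option (Fin m) → ℝ

def Param.fixed {p m : ℕ} (θ : Param p m) : Fin p → ℝ := fun k => θ (k, none)

def Param.random {p m : ℕ} (θ : Param p m) (i : Fin m) : Fin p → ℝ := fun k => θ (k, some i)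

section Setup

variable {p : ℕ} (d : Design p) (F : ExpFamily) (β : Fin p → ℝ)
  (b : ℕ → EuclideanSpace ℝ (Fin p))

/-- Smallest cluster size `n_L`. -/
def Design.nL (t : ℕ) : ℕ := ⨅ i : Fin (d.m t), d.n t i

/-- Total sample size `N`. -/
def Design.N (t : ℕ) : ℕ := ∑ i : Fin (d.m t), d.n t i

/-- Average cluster size `N / m`. -/
def Design.nbar (t : ℕ) : ℝ := (d.N t : ℝ) / (d.m t : ℝ)

/-- The design matrix of cluster `i`. -/
def Design.X (t i : ℕ) : Matrix (Fin (d.n t i)) (Fin p) ℝ := Matrix.of fun j => d.x t i j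

/-- The growth regime `m → ∞`, `n_L → ∞`, `m / n_L → 0`, `n_i = O(n_L)` uniformly in `i`. -/
structure Design.Regime : Prop where
  m_tendsto : Tendsto d.m atTop atTop
  nL_tendsto : Tendsto d.nL atTop atTop
  ratio : Tendsto (fun t => (d.m t : ℝ) / (d.nL t : ℝ)) atTop (𝓝 0)
  balanced : ∃ C : ℝ, ∀ᶠ t in atTop, ∀ i < d.m t, (d.n t i : ℝ) ≤ C * d.nL t

/-- True linear predictor of measurement `j` in cluster `i`. -/
def etaTrue (t i j : ℕ) : ℝ := d.x t i j ⬝ᵥ β + d.x t i j ⬝ᵥ (b i).ofLp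

/-- Linear predictor at an arbitrary parameter vector. -/
def eta {t : ℕ} (θ : Param p (d.m t)) (i : Fin (d.m t)) (j : ℕ) : ℝ :=
  d.x t i j ⬝ᵥ θ.fixed + d.x t i j ⬝ᵥ θ.random i

/-- The weight matrix `ψ⁻¹ diag (a''(η_{i1}), …, a''(η_{i n_i}))` at the true linear predictors. -/
def weight (ψ : ℝ) (t i : ℕ) : Matrix (Fin (d.n t i)) (Fin (d.n t i)) ℝ :=
  ψ⁻¹ • Matrix.diagonal fun j : Fin (d.n t i) => iteratedDeriv 2 F.a (etaTrue d β b t i j)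

/-- `H_i = (n_i⁻¹ X_iᵀ W_i X_i)⁻¹` with `W_i` the weight matrix at the true dispersion. -/
def H (t i : ℕ) : Matrix (Fin p) (Fin p) ℝ :=
  ((d.n t i : ℝ)⁻¹ • ((d.X t i)ᵀ * weight d F β b F.φ t i * d.X t i))⁻¹

/-- `m⁻¹ ∑ i, (n / n_i) H_i`, with `n` the average cluster size. -/
def Hbar (t : ℕ) : Matrix (Fin p) (Fin p) ℝ :=
  (d.m t : ℝ)⁻¹ • ∑ i : Fin (d.m t), (d.nbar t / (d.n t i : ℝ)) • H d F β b t i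

/-- The eigenvalues of the symmetric matrix `M` lie in `[c, c⁻¹]`. -/
def EigenvaluesWithin (c : ℝ) (M : Matrix (Fin p) (Fin p) ℝ) : Prop :=
  (M - c • (1 : Matrix (Fin p) (Fin p) ℝ)).PosSemidef ∧
    (c⁻¹ • (1 : Matrix (Fin p) (Fin p) ℝ) - M).PosSemidef

/-- Smoothness of `a`: three times continuously differentiable, `a''` bounded and bounded away from
zero, `a'''` bounded. -/
structure Cond1 : Prop where
  contDiff : ContDiffOn ℝ 3 F.a F.dom
  bounds : ∃ c₀ > 0, ∀ η ∈ F.dom, c₀ ≤ iteratedDeriv 2 F.a η ∧ iteratedDeriv 2 F.a η ≤ c₀⁻¹ ∧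
    |iteratedDeriv 3 F.a η| ≤ c₀⁻¹

/-- Bounded covariates, and convergence of `H_i` to `K i` and of `Hbar` to `K₀`, with eigenvalues in
`[c₁, c₁⁻¹]`, uniformly over the clusters present. -/
structure Cond2 (K₀ : Matrix (Fin p) (Fin p) ℝ) (K : ℕ → Matrix (Fin p) (Fin p) ℝ) : Prop where
  bounded : ∃ C₁ : ℝ, ∀ t, ∀ i < d.m t, ∀ j < d.n t i, ‖d.x t i j‖ < C₁
  tendsto : ∀ i, Tendsto (fun t => H d F β b t i) atTop (𝓝 (K i))
  tendsto_bar : Tendsto (fun t => Hbar d F β b t) atTop (𝓝 K₀)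
  eigenvalues : ∃ c₁ > 0, (∀ᶠ t in atTop, ∀ i < d.m t, EigenvaluesWithin c₁ (H d F β b t i)) ∧
    (∀ i, EigenvaluesWithin c₁ (K i)) ∧ EigenvaluesWithin c₁ K₀

/-- The true linear predictors stay uniformly inside the domain, and the averages
`M⁻¹ ∑ i < M, ‖b_i‖` of the true random effects are bounded (as they are when all `b_i` lie in one
compact set, and for almost every realisation of i.i.d. normal random effects). -/
structure Cond3 : Prop where
  interior : ∃ ε > 0, ∀ t, ∀ i < d.m t, ∀ j < d.n t i, Metric.ball (etaTrue d β b t i j) ε ⊆ F.dom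
  effects : ∃ C : ℝ, ∀ M : ℕ, ∑ i ∈ Finset.range M, ‖b i‖ ≤ C * M

variable {Ω : Type*} [MeasurableSpace Ω] (P : Measure Ω)

/-- `Z_t = O_p(1)` as `t → ∞`. -/
def BoundedInProb (Z : ℕ → Ω → ℝ) : Prop :=
  ∀ ε > 0, ∃ M : ℝ, ∀ᶠ t in atTop, P {ω | M < |Z t ω|} ≤ ENNReal.ofReal ε

/-- The model given the random effects: at each stage the responses are independent, and `y t i j`
follows the exponential family with canonical parameter the true linear predictor. -/
structure ResponseModel (y : ℕ → ℕ → ℕ → Ω → ℝ) : Prop where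
  law : ∀ t, ∀ i < d.m t, ∀ j < d.n t i, HasLaw (y t i j) (F.law (etaTrue d β b t i j)) P
  indep : ∀ t, iIndepFun
    (fun s : (Σ i : Fin (d.m t), Fin (d.n t i)) => y t s.1 s.2) P

/-- The working matrix `G` is positive definite with `G⁻¹ = O_p(1)`, and the working dispersion `ψ` is
positive and `O_p(1)`. -/
structure Cond4 (G : ℕ → Ω → Matrix (Fin p) (Fin p) ℝ) (ψ : ℕ → Ω → ℝ) : Prop where
  measurable_G : ∀ t k l, Measurable fun ω => G t ω k l
  measurable_ψ : ∀ t, Measurable (ψ t)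
  posDef : ∀ t ω, (G t ω).PosDef
  inv_bounded : ∀ k l, BoundedInProb P fun t ω => (G t ω)⁻¹ k l
  pos : ∀ t ω, 0 < ψ t ω
  bounded : BoundedInProb P ψ

/-- The vector
`n_i^{1/2} (X_iᵀ W_i X_i + G⁻¹)⁻¹ (ψ⁻¹ X_iᵀ (y_i - μ_i) - G⁻¹ b_i)` with `W_i` the
weight matrix at the working dispersion `ψ`. -/
def scoreRatio (t i : ℕ) (yi : ℕ → ℝ) (G : Matrix (Fin p) (Fin p) ℝ) (ψ : ℝ) : Fin p → ℝ :=
  Real.sqrt (d.n t i) • (((d.X t i)ᵀ * weight d F β b ψ t i * d.X t i + G⁻¹)⁻¹ *ᵥ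
    (ψ⁻¹ • ((d.X t i)ᵀ *ᵥ fun j => yi j - F.mean (etaTrue d β b t i j)) - G⁻¹ *ᵥ (b i).ofLp))

/-- Componentwise finite fourth moments of `scoreRatio`. -/
def Cond5 (y : ℕ → ℕ → ℕ → Ω → ℝ) (G : ℕ → Ω → Matrix (Fin p) (Fin p) ℝ)
    (ψ : ℕ → Ω → ℝ) : Prop :=
  ∀ t, ∀ i < d.m t, ∀ k,
    Integrable (fun ω => scoreRatio d F β b t i (fun j => y t i j ω) (G t ω) (ψ t ω) k ^ 4) P

/-- The PQL objective function for responses `y`, working matrix `G`, working dispersion `ψ`. -/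
def objective {t : ℕ} (y : ℕ → ℕ → ℝ) (G : Matrix (Fin p) (Fin p) ℝ) (ψ : ℝ)
    (θ : Param p (d.m t)) : ℝ :=
  (∑ i : Fin (d.m t), ∑ j : Fin (d.n t i), F.logDensity ψ (eta d θ i j) (y i j)) -
    (1 / 2) * ∑ i : Fin (d.m t), θ.random i ⬝ᵥ (G⁻¹ *ᵥ θ.random i)

/-- Parameter vectors whose linear predictors all lie in the domain of `a`
(every vector, if that domain is the real line). -/
def feasible (t : ℕ) : Set (Param p (d.m t)) :=
  {θ | ∀ (i : Fin (d.m t)) (j : Fin (d.n t i)), eta d θ i j ∈ F.dom}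

/-- `θ` maximises the PQL objective function. -/
def IsPQLEstimate {t : ℕ} (y : ℕ → ℕ → ℝ) (G : Matrix (Fin p) (Fin p) ℝ) (ψ : ℝ)
    (θ : Param p (d.m t)) : Prop :=
  θ ∈ feasible d F t ∧ IsMaxOn (objective d F y G ψ) (feasible d F t) θ

/-- The true parameter vector at stage `t`. -/
def thetaTrue (t : ℕ) : Param p (d.m t)
  | (k, none) => β k
  | (k, some i) => b i k

/-- The vector `(-1, 1, …, 1)` of length `m + 1`. -/
def oneStar {m : ℕ} : Option (Fin m) → ℝ
  | none => -1
  | some _ => 1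

/-- `m⁻¹ ∑ i, b_i`. -/
def bbar (t : ℕ) : EuclideanSpace ℝ (Fin p) := (d.m t : ℝ)⁻¹ • ∑ i : Fin (d.m t), b i

/-- The sum-to-zero reparametrised truth: the true vector minus `(-1, 1, …, 1) ⊗ m⁻¹ ∑ i, b_i`. -/
def target (t : ℕ) : Param p (d.m t) :=
  thetaTrue d β b t - fun s => oneStar s.2 * bbar d b t s.1

/-- The scaling matrix: `N^{1/2}` for the fixed effects, `n_i^{1/2}` for cluster `i`. -/
def scaling (t : ℕ) : Matrix (Fin p × Option (Fin (d.m t))) (Fin p × Option (Fin (d.m t))) ℝ :=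
  Matrix.diagonal fun s => match s.2 with
    | none => Real.sqrt (d.N t)
    | some i => Real.sqrt (d.n t i)

/-- The block-diagonal matrix with blocks `Hbar, H_1, …, H_m`. -/
def blockMatrix (t : ℕ) :
    Matrix (Fin p × Option (Fin (d.m t))) (Fin p × Option (Fin (d.m t))) ℝ :=
  Matrix.blockDiagonal fun s : Option (Fin (d.m t)) => match s with
    | none => Hbar d F β b t
    | some i => H d F β b t i

/-- The entry of a `q × (m + 1) p` matrix in row `r`, block `s` and place `k` of the block, where
`none` is the block of the fixed effects and `some i` that of cluster `i`; zero if there is no such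
cluster. -/
def entry {q m : ℕ} (A : Matrix (Fin q) (Fin p × Option (Fin m)) ℝ) (r : Fin q) (k : Fin p) :
    Option ℕ → ℝ
  | none => A r (k, none)
  | some i => if h : i < m then A r (k, some ⟨i, h⟩) else 0

/-- The finite selection property of a sequence of `q × (m + 1) p` matrices, with componentwise
limits `L none` (fixed effects) and `L (some i)` (cluster `i`), not all of them zero. -/
structure FiniteSelection {q : ℕ}
    (A : ∀ t, Matrix (Fin q) (Fin p × Option (Fin (d.m t))) ℝ)
    (L : Option ℕ → Matrix (Fin q) (Fin p) ℝ) : Prop where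
  finite : ∀ r, ∃ m₀ : ℕ, ∀ t, m₀ < d.m t → ∀ i : Fin (d.m t), m₀ ≤ i → ∀ k,
    A t r (k, some i) = 0
  tendsto : ∀ r k s, Tendsto (fun t => entry (A t) r k s) atTop (𝓝 (L s r k))
  nonzero : ∃ r k s, L s r k ≠ 0

end Setup

end PQL

end

/-! Write γ_i = β + b_i for the coefficients of cluster i. Moving a parameter vector along (-1, 1,
…, 1) ⊗ e_k changes no linear predictor, so stationarity in that direction involves only the penalty
and forces ∑ b̂_i = 0 (`IsPQLEstimate.sum_random`). Hence β̂ is the average of the γ̂_i = β̂ + b̂_i,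
and the recentred truth is built from the γ_i in the same way. With u_i = γ̂_i − γ_i (`dev`) and
average ū (`devMean`), the error θ̂ − θ* is exactly ū in the fixed block and u_i − ū in block i.
What remains is m problems of dimension p, coupled only through the penalty.

Stationarity in block i is the score equation X_iᵀ(y_i − μ̂_i) = φ̂ Ĝ⁻¹ b̂_i. Strong monotonicity of
a' bounds n_i‖u_i‖ by the score at the truth plus the penalty term. Since b̂_i = u_i − ū + (b_i −
b̄), the parts of the penalty that contain errors are absorbed once n_L is large. A second-order
expansion then gives u_i = lead_i + remainder, where `lead` is linear in the residuals.
`exists_cluster_error_const` solves this system of inequalities: the remainders add up to O(m/n_L)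
over all clusters, and the remainder of a fixed cluster is O(1/n_L). The bounds are deterministic on
an event on which finitely many quantities that are O_p(1) stay below a constant; dependence of Ĝ
and φ̂ on the data is therefore harmless.

For (a), every single score is at most the root of the sum of all squared scores, which is O_p(√(m
n_L)); after division by n_L this is √(m/n_L) → 0.

For (b), √N times the remainder of ū is O(√(m/n_L)), and at the scale √n_i of a fixed cluster ū
itself is negligible, being of order (m n_L)^(-1/2) + n_L⁻¹. A selection is thus asymptotically a
weighted sum of independent residuals with weights of order n_L^(-1/2). Exponential tilting supplies
exponential moments uniform over all observations, so the characteristic functions converge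
(`tendsto_prod_charFun`). The variance is that of the block-diagonal matrix plus cross terms of
order m^(-1/2) (`variance_scoreCoeff`, `StageBounds.abs_cross_le`). Cramér–Wold, Lévy continuity and
Slutsky finish the argument.

The statement on Gaussian random effects is the strong law of large numbers for ‖b_i‖. -/

noncomputable section

namespace PQL

/-! ### Smoothness of the cumulant function -/

section Smooth

variable {F : ExpFamily} {c₀ : ℝ}

/-- The curvature bounds of `Cond1` with a named constant. -/
structure CurvatureBounds (F : ExpFamily) (c₀ : ℝ) : Prop where
  contDiff : ContDiffOn ℝ 3 F.a F.dom
  pos : 0 < c₀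
  lower : ∀ η ∈ F.dom, c₀ ≤ iteratedDeriv 2 F.a η
  upper : ∀ η ∈ F.dom, iteratedDeriv 2 F.a η ≤ c₀⁻¹
  third : ∀ η ∈ F.dom, |iteratedDeriv 3 F.a η| ≤ c₀⁻¹

theorem Cond1.exists_curvatureBounds (h : Cond1 F) : ∃ c₀, CurvatureBounds F c₀ := by
  obtain ⟨c₀, hc, hb⟩ := h.bounds
  exact ⟨c₀, h.contDiff, hc, fun η hη => (hb η hη).1, fun η hη => (hb η hη).2.1,
    fun η hη => (hb η hη).2.2⟩

theorem abs_sub_le_of_mem_segment {x y z : ℝ} (hz : z ∈ segment ℝ y x) : |z - y| ≤ |x - y| := by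
  obtain ⟨a, b, ha, hb, hab, rfl⟩ := hz
  have : a • y + b • x - y = b * (x - y) := by
    simp only [smul_eq_mul]; linear_combination y * hab
  rw [this, abs_mul, abs_of_nonneg hb]
  exact mul_le_of_le_one_left (abs_nonneg _) (by linarith)

namespace CurvatureBounds

/-- Nothing is known of `a` outside the open domain. On it derivatives within the domain agree with
ordinary ones, so smoothness on the set transfers. -/
theorem hasDerivAt_iteratedDeriv (h : CurvatureBounds F c₀) {n : ℕ} (hn : n < 3) {η : ℝ} (hη : η ∈ F.dom) :
    HasDerivAt (iteratedDeriv n F.a) (iteratedDeriv (n + 1) F.a η) η := by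
  have h1 : DifferentiableAt ℝ (iteratedDerivWithin n F.a F.dom) η :=
    (h.contDiff.differentiableOn_iteratedDerivWithin (m := n) (by exact_mod_cast hn)
      F.isOpen_dom.uniqueDiffOn η hη).differentiableAt (F.isOpen_dom.mem_nhds hη)
  have this : DifferentiableAt ℝ (iteratedDeriv n F.a) η :=
    h1.congr_of_eventuallyEq ((iteratedDerivWithin_of_isOpen F.isOpen_dom).symm.eventuallyEq_of_mem
      (F.isOpen_dom.mem_nhds hη))
  rw [iteratedDeriv_succ]
  exact this.hasDerivAt

theorem hasDerivAt (h : CurvatureBounds F c₀) {η : ℝ} (hη : η ∈ F.dom) : HasDerivAt F.a (F.mean η) η := by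
  simpa [ExpFamily.mean] using h.hasDerivAt_iteratedDeriv (n := 0) (by norm_num) hη

theorem hasDerivAt_mean (h : CurvatureBounds F c₀) {η : ℝ} (hη : η ∈ F.dom) :
    HasDerivAt F.mean (iteratedDeriv 2 F.a η) η := by
  have := h.hasDerivAt_iteratedDeriv (n := 1) (by norm_num) hη
  rwa [iteratedDeriv_one] at this

theorem abs_mean_sub_le (h : CurvatureBounds F c₀) {x y : ℝ} (hx : x ∈ F.dom) (hy : y ∈ F.dom) :
    |F.mean x - F.mean y| ≤ c₀⁻¹ * |x - y| := by
  refine F.convex_dom.norm_image_sub_le_of_norm_hasDerivWithin_le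
    (fun z hz => (h.hasDerivAt_mean hz).hasDerivWithinAt) (fun z hz => ?_) hy hx
  rw [Real.norm_eq_abs, abs_of_nonneg (h.pos.le.trans (h.lower z hz))]
  exact h.upper z hz

theorem abs_curvature_sub_le (h : CurvatureBounds F c₀) {x y : ℝ} (hx : x ∈ F.dom) (hy : y ∈ F.dom) :
    |iteratedDeriv 2 F.a x - iteratedDeriv 2 F.a y| ≤ c₀⁻¹ * |x - y| :=
  F.convex_dom.norm_image_sub_le_of_norm_hasDerivWithin_le
    (fun _ hz => (h.hasDerivAt_iteratedDeriv (n := 2) (by norm_num) hz).hasDerivWithinAt)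
    (fun z hz => h.third z hz) hy hx

/-- Mean value inequality on the segment from `y` to `x`, after subtraction of the linear part:
there the derivative is at most c₀⁻¹|x - y|. The factor 1/2 of Taylor's formula is not needed. -/
theorem abs_mean_taylor_le (h : CurvatureBounds F c₀) {x y : ℝ} (hx : x ∈ F.dom) (hy : y ∈ F.dom) :
    |F.mean x - F.mean y - iteratedDeriv 2 F.a y * (x - y)| ≤ c₀⁻¹ * (x - y) ^ 2 := by
  have key := (convex_segment y x).norm_image_sub_le_of_norm_hasDerivWithin_le
    (f := fun z => F.mean z - iteratedDeriv 2 F.a y * z)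
    (f' := fun z => iteratedDeriv 2 F.a z - iteratedDeriv 2 F.a y) (C := c₀⁻¹ * |x - y|)
    (fun z hz => ?_) (fun z hz => ?_) (left_mem_segment ℝ y x) (right_mem_segment ℝ y x)
  · rw [Real.norm_eq_abs, Real.norm_eq_abs, mul_assoc, ← sq, sq_abs] at key
    convert key using 2
    ring
  · have := (h.hasDerivAt_mean (F.convex_dom.segment_subset hy hx hz)).sub
      ((hasDerivAt_id z).const_mul (iteratedDeriv 2 F.a y))
    rw [mul_one] at this
    exact this.hasDerivWithinAt
  · refine (h.abs_curvature_sub_le (F.convex_dom.segment_subset hy hx hz) hy).trans ?_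
    exact mul_le_mul_of_nonneg_left (abs_sub_le_of_mem_segment hz) (inv_nonneg.2 h.pos.le)

theorem cumulant_taylor_le (h : CurvatureBounds F c₀) {x y : ℝ} (hx : x ∈ F.dom) (hy : y ∈ F.dom) :
    F.a x - F.a y - F.mean y * (x - y) ≤ c₀⁻¹ * (x - y) ^ 2 := by
  have key := (convex_segment y x).norm_image_sub_le_of_norm_hasDerivWithin_le
    (f := fun z => F.a z - F.mean y * z)
    (f' := fun z => F.mean z - F.mean y) (C := c₀⁻¹ * |x - y|)
    (fun z hz => ?_) (fun z hz => ?_) (left_mem_segment ℝ y x) (right_mem_segment ℝ y x)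
  · rw [Real.norm_eq_abs, Real.norm_eq_abs, mul_assoc, ← sq, sq_abs] at key
    refine (le_abs_self _).trans (le_trans (le_of_eq ?_) key)
    congr 1
    ring
  · have := (h.hasDerivAt (F.convex_dom.segment_subset hy hx hz)).sub
      ((hasDerivAt_id z).const_mul (F.mean y))
    rw [mul_one] at this
    exact this.hasDerivWithinAt
  · refine (h.abs_mean_sub_le (F.convex_dom.segment_subset hy hx hz) hy).trans ?_
    exact mul_le_mul_of_nonneg_left (abs_sub_le_of_mem_segment hz) (inv_nonneg.2 h.pos.le)

theorem mean_strongly_monotone (h : CurvatureBounds F c₀) {x y : ℝ} (hx : x ∈ F.dom) (hy : y ∈ F.dom) :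
    c₀ * (x - y) ^ 2 ≤ (F.mean x - F.mean y) * (x - y) := by
  wlog hxy : y ≤ x generalizing x y
  · have := this hy hx (le_of_not_ge hxy)
    nlinarith
  have hd : ∀ z ∈ F.dom, DifferentiableAt ℝ F.mean z := fun z hz =>
    (h.hasDerivAt_mean hz).differentiableAt
  have := F.convex_dom.mul_sub_le_image_sub_of_le_deriv (f := F.mean) (C := c₀)
    (fun z hz => (hd z hz).continuousAt.continuousWithinAt)
    (fun z hz => (hd z (interior_subset hz)).differentiableWithinAt)
    (fun z hz => by
      rw [(h.hasDerivAt_mean (interior_subset hz)).deriv]; exact h.lower z (interior_subset hz))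
    y hy x hx hxy
  nlinarith

end CurvatureBounds

end Smooth

/-! ### Moments of the exponential family -/

section Moments

variable {F : ExpFamily} {c₀ η ε : ℝ}

theorem ExpFamily.measurable_density (F : ExpFamily) (η : ℝ) :
    Measurable fun y => ENNReal.ofReal (Real.exp (F.logDensity F.φ η y)) := by
  have := F.measurable_c
  unfold ExpFamily.logDensity
  fun_prop

theorem ExpFamily.isProbabilityMeasure_law (hη : η ∈ F.dom) : IsProbabilityMeasure (F.law η) :=
  ⟨by rw [ExpFamily.law, withDensity_apply _ MeasurableSet.univ, Measure.restrict_univ]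
      exact F.normalized η hη⟩

/-- Exponential tilting: the factor exp(r y) turns the density at η into a constant multiple of the
density at η + φr, which integrates to one as long as the shifted parameter stays in the domain. -/
theorem ExpFamily.lintegral_exp_law {r : ℝ} (hη : η + F.φ * r ∈ F.dom) :
    ∫⁻ y, ENNReal.ofReal (Real.exp (r * y)) ∂(F.law η) =
      ENNReal.ofReal (Real.exp (F.φ⁻¹ * (F.a (η + F.φ * r) - F.a η))) := by
  rw [ExpFamily.law, lintegral_withDensity_eq_lintegral_mul _ (F.measurable_density η)
    (by fun_prop)]
  have : ∀ y, ((fun y => ENNReal.ofReal (Real.exp (F.logDensity F.φ η y))) *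
      fun y => ENNReal.ofReal (Real.exp (r * y))) y =
      ENNReal.ofReal (Real.exp (F.φ⁻¹ * (F.a (η + F.φ * r) - F.a η))) *
      ENNReal.ofReal (Real.exp (F.logDensity F.φ (η + F.φ * r) y)) := by
    intro y
    simp only [Pi.mul_apply]
    rw [← ENNReal.ofReal_mul (Real.exp_pos _).le, ← ENNReal.ofReal_mul (Real.exp_pos _).le,
      ← Real.exp_add, ← Real.exp_add]
    congr 2
    simp only [ExpFamily.logDensity]
    have := F.φ_pos.ne'
    field_simp
    ring
  simp_rw [this]
  rw [lintegral_const_mul _ (F.measurable_density _)]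
  have := F.normalized _ hη
  simp only [ExpFamily.logDensity] at *
  rw [this, mul_one]

theorem ExpFamily.integrable_exp_law {r : ℝ} (hη : η + F.φ * r ∈ F.dom) :
    Integrable (fun y => Real.exp (r * y)) (F.law η) := by
  refine ⟨by fun_prop, ?_⟩
  rw [hasFiniteIntegral_iff_ofReal (ae_of_all _ fun y => (Real.exp_pos _).le),
    F.lintegral_exp_law hη]
  exact ENNReal.ofReal_lt_top

theorem ExpFamily.mgf_law {r : ℝ} (hη : η + F.φ * r ∈ F.dom) :
    mgf id (F.law η) r = Real.exp (F.φ⁻¹ * (F.a (η + F.φ * r) - F.a η)) := by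
  rw [mgf, integral_eq_lintegral_of_nonneg_ae (ae_of_all _ fun y => (Real.exp_pos _).le)
    (by fun_prop)]
  simp only [id]
  rw [F.lintegral_exp_law hη, ENNReal.toReal_ofReal (Real.exp_pos _).le]

theorem ExpFamily.eventually_mem_dom (hη : η ∈ F.dom) : ∀ᶠ r in 𝓝 0, η + F.φ * r ∈ F.dom := by
  have : Tendsto (fun r => η + F.φ * r) (𝓝 0) (𝓝 η) := by
    have : Continuous fun r => η + F.φ * r := by fun_prop
    simpa using this.tendsto 0
  exact this.eventually_mem (F.isOpen_dom.mem_nhds hη)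

theorem ExpFamily.zero_mem_interior_integrableExpSet (hη : η ∈ F.dom) :
    (0 : ℝ) ∈ interior (integrableExpSet id (F.law η)) := by
  rw [mem_interior_iff_mem_nhds]
  filter_upwards [F.eventually_mem_dom hη] with r hr using F.integrable_exp_law hr

theorem ExpFamily.cgf_law_eventuallyEq (hη : η ∈ F.dom) :
    cgf id (F.law η) =ᶠ[𝓝 0] fun r => F.φ⁻¹ * (F.a (η + F.φ * r) - F.a η) := by
  filter_upwards [F.eventually_mem_dom hη] with r hr
  rw [cgf, F.mgf_law hr, Real.log_exp]

/-- The inner derivative φ cancels the prefactor φ⁻¹. The value at 0 yields the mean a'(η), and one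
more derivative yields the variance φ a''(η). -/
theorem CurvatureBounds.deriv_cgf_law_eventuallyEq (h : CurvatureBounds F c₀) (hη : η ∈ F.dom) :
    deriv (cgf id (F.law η)) =ᶠ[𝓝 0] fun r => F.mean (η + F.φ * r) := by
  refine (F.cgf_law_eventuallyEq hη).deriv.trans ?_
  filter_upwards [F.eventually_mem_dom hη] with r hr
  have h1 : HasDerivAt (fun r => η + F.φ * r) F.φ r := by
    simpa using ((hasDerivAt_id r).const_mul F.φ).const_add η
  have h2 := (((h.hasDerivAt hr).comp r h1).sub_const (F.a η)).const_mul F.φ⁻¹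
  rw [mul_comm (F.mean _), inv_mul_cancel_left₀ F.φ_pos.ne'] at h2
  exact h2.deriv

theorem CurvatureBounds.integral_law (h : CurvatureBounds F c₀) (hη : η ∈ F.dom) :
    ∫ y, y ∂(F.law η) = F.mean η := by
  have := F.isProbabilityMeasure_law hη
  have h1 := deriv_cgf_zero (F.zero_mem_interior_integrableExpSet hη)
  rw [(h.deriv_cgf_law_eventuallyEq hη).self_of_nhds] at h1
  simpa using h1.symm

theorem CurvatureBounds.integral_sq_law (h : CurvatureBounds F c₀) (hη : η ∈ F.dom) :
    ∫ y, (y - F.mean η) ^ 2 ∂(F.law η) = F.φ * iteratedDeriv 2 F.a η := by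
  have := F.isProbabilityMeasure_law hη
  have h1 := iteratedDeriv_two_cgf_eq_integral (F.zero_mem_interior_integrableExpSet hη)
  rw [iteratedDeriv_succ, iteratedDeriv_one, (h.deriv_cgf_law_eventuallyEq hη).deriv_eq,
    (h.deriv_cgf_law_eventuallyEq hη).self_of_nhds] at h1
  have h2 : HasDerivAt (fun r => η + F.φ * r) F.φ 0 := by
    simpa using ((hasDerivAt_id (0 : ℝ)).const_mul F.φ).const_add η
  have h3 : HasDerivAt F.mean (iteratedDeriv 2 F.a η) (η + F.φ * 0) := by
    simpa using h.hasDerivAt_mean hη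
  have h4 : HasDerivAt (fun r => F.mean (η + F.φ * r)) (iteratedDeriv 2 F.a η * F.φ) 0 :=
    h3.comp (0 : ℝ) h2
  rw [h4.deriv] at h1
  simp only [mul_zero, add_zero, id, zero_mul, Real.exp_zero, mul_one, mgf_zero, div_one] at h1
  rw [← h1, mul_comm]

/-- The point is uniformity: the bound does not involve η. Centring removes the linear term of the
cumulant function, and the quadratic remainder is controlled by the upper bound on a''. The two
signs of the tilt together dominate the absolute value. -/
theorem CurvatureBounds.integrable_exp_mul_abs (h : CurvatureBounds F c₀)
    (hε : Metric.ball η ε ⊆ F.dom) {r : ℝ} (hr0 : 0 ≤ r) (hr : F.φ * r < ε) :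
    Integrable (fun y => Real.exp (r * |y - F.mean η|)) (F.law η) ∧
      ∫ y, Real.exp (r * |y - F.mean η|) ∂(F.law η) ≤ 2 * Real.exp (c₀⁻¹ * F.φ * r ^ 2) := by
  have hε0 : 0 < ε := (mul_nonneg F.φ_pos.le hr0).trans_lt hr
  have hη : η ∈ F.dom := hε (Metric.mem_ball_self hε0)
  have key : ∀ s : ℝ, |s| = r → Integrable (fun y => Real.exp (s * (y - F.mean η))) (F.law η) ∧
      ∫ y, Real.exp (s * (y - F.mean η)) ∂(F.law η) ≤ Real.exp (c₀⁻¹ * F.φ * r ^ 2) := by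
    intro s hs
    have hmem : η + F.φ * s ∈ F.dom := by
      apply hε
      rw [Metric.mem_ball, Real.dist_eq, add_sub_cancel_left, abs_mul, hs, abs_of_pos F.φ_pos]
      exact hr
    have heq : ∀ y, Real.exp (s * (y - F.mean η)) =
        Real.exp (-(s * F.mean η)) * Real.exp (s * y) := by
      intro y; rw [← Real.exp_add]; congr 1; ring
    simp_rw [heq]
    refine ⟨(F.integrable_exp_law hmem).const_mul _, ?_⟩
    rw [integral_const_mul]
    have := F.mgf_law hmem
    simp only [mgf, id] at this
    rw [this, ← Real.exp_add]
    apply Real.exp_le_exp.2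
    have ht := h.cumulant_taylor_le hmem hη
    rw [add_sub_cancel_left] at ht
    have h2 := mul_le_mul_of_nonneg_left ht (inv_nonneg.2 F.φ_pos.le)
    have hφ := F.φ_pos.ne'
    have e1 : F.φ⁻¹ * (c₀⁻¹ * (F.φ * s) ^ 2) = c₀⁻¹ * F.φ * r ^ 2 := by
      rw [← hs, sq_abs]; field_simp
    have e2 : F.φ⁻¹ * (F.a (η + F.φ * s) - F.a η - F.mean η * (F.φ * s)) =
        -(s * F.mean η) + F.φ⁻¹ * (F.a (η + F.φ * s) - F.a η) := by
      field_simp; ring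
    linarith
  obtain ⟨i1, b1⟩ := key r (abs_of_nonneg hr0)
  obtain ⟨i2, b2⟩ := key (-r) (by rw [abs_neg, abs_of_nonneg hr0])
  have hle : ∀ y, Real.exp (r * |y - F.mean η|) ≤
      Real.exp (r * (y - F.mean η)) + Real.exp (-r * (y - F.mean η)) := by
    intro y
    have p1 := Real.exp_pos (r * (y - F.mean η))
    have p2 := Real.exp_pos (-r * (y - F.mean η))
    rcases abs_cases (y - F.mean η) with ⟨e, _⟩ | ⟨e, _⟩
    · rw [e]; linarith
    · rw [e, mul_neg, ← neg_mul]; linarith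
  have hint : Integrable (fun y => Real.exp (r * |y - F.mean η|)) (F.law η) := by
    refine (i1.add i2).mono' (by fun_prop) (ae_of_all _ fun y => ?_)
    rw [Real.norm_eq_abs, abs_of_pos (Real.exp_pos _)]
    exact hle y
  refine ⟨hint, (integral_mono hint (i1.add i2) hle).trans ?_⟩
  simp only [Pi.add_apply]
  rw [integral_add i1 i2]
  linarith

theorem ExpFamily.memLp_law (hη : η ∈ F.dom) (n : NNReal) : MemLp id n (F.law η) :=
  memLp_of_mem_interior_integrableExpSet (F.zero_mem_interior_integrableExpSet hη) n

end Moments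

/-! ### A central limit theorem for weighted sums -/

section CLT

/-- The third-order Taylor remainder of the exponential is at most |wz|³ exp(|wz|). Half of the
exponential moment absorbs |z|³, the other half absorbs exp(|wz|), whence the exponent 2s. -/
theorem norm_charFun_sub_le {μ : Measure ℝ} [IsProbabilityMeasure μ] {s K v w : ℝ} (hs : 0 < s)
    (hint : Integrable (fun z => Real.exp (2 * s * |z|)) μ)
    (hK : ∫ z, Real.exp (2 * s * |z|) ∂μ ≤ K) (i1 : Integrable (fun z => z) μ)
    (i2 : Integrable (fun z => z ^ 2) μ) (h0 : ∫ z, z ∂μ = 0)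
    (h2 : ∫ z, z ^ 2 ∂μ = v) (hw : |w| ≤ s) :
    ‖charFun μ w - (1 - w ^ 2 * v / 2 : ℝ)‖ ≤ 6 / s ^ 3 * K * |w| ^ 3 := by
  have hpt : ∀ z : ℝ, ‖Complex.exp (w * z * Complex.I) -
      (1 + (w * Complex.I) * (z : ℝ) - (w ^ 2 / 2 : ℝ) * ((z ^ 2 : ℝ) : ℂ))‖ ≤
      6 / s ^ 3 * |w| ^ 3 * Real.exp (2 * s * |z|) := by
    intro z
    have h := Complex.norm_exp_sub_sum_le_norm_mul_exp (w * z * Complex.I) 3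
    have hn : ‖(w * z * Complex.I : ℂ)‖ = |w| * |z| := by simp
    have hsum : ∑ m ∈ Finset.range 3, (w * z * Complex.I : ℂ) ^ m / (m.factorial : ℂ) =
        1 + (w * Complex.I) * (z : ℝ) - (w ^ 2 / 2 : ℝ) * ((z ^ 2 : ℝ) : ℂ) := by
      simp only [Finset.sum_range_succ, Finset.sum_range_zero, Nat.factorial]
      push_cast
      have := Complex.I_sq
      linear_combination ((w : ℂ) * z) ^ 2 / 2 * this
    rw [hsum, hn] at h
    refine h.trans ?_
    have e1 : (s * |z|) ^ 3 / 6 ≤ Real.exp (s * |z|) := by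
      have := Real.pow_div_factorial_le_exp (s * |z|) (by positivity) 3
      simpa [Nat.factorial] using this
    have e2 : Real.exp (|w| * |z|) ≤ Real.exp (s * |z|) := by gcongr
    have e3 : |z| ^ 3 ≤ 6 / s ^ 3 * Real.exp (s * |z|) := by
      rw [div_mul_eq_mul_div, le_div_iff₀ (by positivity)]
      rw [mul_pow] at e1
      linarith
    calc (|w| * |z|) ^ 3 * Real.exp (|w| * |z|)
        ≤ (|w| ^ 3 * (6 / s ^ 3 * Real.exp (s * |z|))) * Real.exp (s * |z|) := by
          rw [mul_pow]; gcongr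
      _ = 6 / s ^ 3 * |w| ^ 3 * Real.exp (2 * s * |z|) := by
          rw [show 2 * s * |z| = s * |z| + s * |z| by ring, Real.exp_add]; ring
  have hexp : Integrable (fun z : ℝ => Complex.exp (w * z * Complex.I)) μ := by
    refine Integrable.of_bound (by fun_prop) 1 (ae_of_all _ fun z => ?_)
    rw [← Complex.ofReal_mul, Complex.norm_exp_ofReal_mul_I]
  have j1 : Integrable (fun z : ℝ => (w * Complex.I) * ((z : ℝ) : ℂ)) μ :=
    (i1.ofReal (𝕜 := ℂ)).const_mul _
  have j2 : Integrable (fun z : ℝ => ((w ^ 2 / 2 : ℝ) : ℂ) * ((z ^ 2 : ℝ) : ℂ)) μ :=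
    (i2.ofReal (𝕜 := ℂ)).const_mul _
  have heq : charFun μ w - (1 - w ^ 2 * v / 2 : ℝ) = ∫ z : ℝ, (Complex.exp (w * z * Complex.I) -
      (1 + (w * Complex.I) * (z : ℝ) - (w ^ 2 / 2 : ℝ) * ((z ^ 2 : ℝ) : ℂ))) ∂μ := by
    have j3 : Integrable (fun z : ℝ => 1 + (w * Complex.I) * ((z : ℝ) : ℂ)) μ :=
      (integrable_const _).add j1
    have j4 : Integrable (fun z : ℝ => 1 + (w * Complex.I) * ((z : ℝ) : ℂ) -
      ((w ^ 2 / 2 : ℝ) : ℂ) * ((z ^ 2 : ℝ) : ℂ)) μ := j3.sub j2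
    rw [integral_sub hexp j4, integral_sub j3 j2, integral_add (integrable_const _) j1,
      integral_const_mul, integral_const_mul, integral_complex_ofReal, integral_complex_ofReal, h0, h2,
      charFun_apply_real]
    simp
    ring
  rw [heq]
  calc _ ≤ ∫ z, 6 / s ^ 3 * |w| ^ 3 * Real.exp (2 * s * |z|) ∂μ :=
        norm_integral_le_of_norm_le (hint.const_mul _) (ae_of_all _ hpt)
    _ = 6 / s ^ 3 * |w| ^ 3 * ∫ z, Real.exp (2 * s * |z|) ∂μ := integral_const_mul _ _
    _ ≤ 6 / s ^ 3 * |w| ^ 3 * K := by gcongr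
    _ = _ := by ring

/-- Telescoping: one factor is exchanged at a time and the others have norm at most one. -/
theorem norm_prod_sub_prod_le {ι : Type*} (s : Finset ι) (f g : ι → ℂ)
    (hf : ∀ i ∈ s, ‖f i‖ ≤ 1) (hg : ∀ i ∈ s, ‖g i‖ ≤ 1) :
    ‖∏ i ∈ s, f i - ∏ i ∈ s, g i‖ ≤ ∑ i ∈ s, ‖f i - g i‖ := by
  classical
  induction s using Finset.induction_on with
  | empty => simp
  | insert a s ha ih =>
    have hf' : ∀ i ∈ s, ‖f i‖ ≤ 1 := fun i hi => hf i (Finset.mem_insert_of_mem hi)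
    have hg' : ∀ i ∈ s, ‖g i‖ ≤ 1 := fun i hi => hg i (Finset.mem_insert_of_mem hi)
    rw [Finset.prod_insert ha, Finset.prod_insert ha, Finset.sum_insert ha]
    have hp : ‖∏ i ∈ s, f i‖ ≤ 1 := by
      rw [norm_prod]; exact Finset.prod_le_one (fun _ _ => norm_nonneg _) hf'
    have : f a * ∏ i ∈ s, f i - g a * ∏ i ∈ s, g i =
        (f a - g a) * ∏ i ∈ s, f i + g a * (∏ i ∈ s, f i - ∏ i ∈ s, g i) := by ring
    rw [this]
    refine (norm_add_le _ _).trans (add_le_add ?_ ?_)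
    · rw [norm_mul]; exact mul_le_of_le_one_right (norm_nonneg _) hp
    · rw [norm_mul]
      exact (mul_le_of_le_one_left (norm_nonneg _) (hg a (Finset.mem_insert_self a s))).trans
        (ih hf' hg')

/-- Convergence of the characteristic functions of weighted sums of independent variables with
variances `v t k`, stated for the product of the individual characteristic functions. -/
theorem tendsto_prod_charFun {ι : ℕ → Type*} [∀ t, Fintype (ι t)] (μ : ∀ t, ι t → Measure ℝ)
    [∀ t k, IsProbabilityMeasure (μ t k)] (w v : ∀ t, ι t → ℝ) {s C v₀ V σ : ℝ} (hs : 0 < s)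
    (hv₀ : 0 < v₀) (hC : 0 ≤ C)
    (hchar : ∀ t k, |w t k| ≤ s →
      ‖charFun (μ t k) (w t k) - (1 - w t k ^ 2 * v t k / 2 : ℝ)‖ ≤ C * |w t k| ^ 3)
    (hlow : ∀ t k, v₀ ≤ v t k) (hup : ∀ t k, v t k ≤ V)
    (hmax : ∀ δ > 0, ∀ᶠ t in atTop, ∀ k, |w t k| ≤ δ)
    (hvar : Tendsto (fun t => ∑ k, w t k ^ 2 * v t k) atTop (𝓝 σ)) :
    Tendsto (fun t => ∏ k, charFun (μ t k) (w t k)) atTop (𝓝 (Complex.exp (-(σ / 2 : ℝ)))) := by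
  have hlim : Tendsto (fun t => Complex.exp (-((∑ k, w t k ^ 2 * v t k) / 2 : ℝ))) atTop
      (𝓝 (Complex.exp (-(σ / 2 : ℝ)))) := by
    have : Continuous fun x : ℝ => Complex.exp (-(x / 2 : ℝ)) := by fun_prop
    exact (this.tendsto σ).comp hvar
  have hdiff : Tendsto (fun t => ∏ k, charFun (μ t k) (w t k) -
      Complex.exp (-((∑ k, w t k ^ 2 * v t k) / 2 : ℝ))) atTop (𝓝 0) := by
    rw [Metric.tendsto_nhds]
    intro ε hε
    -- The total error of the telescoped product will be at most δ times this constant, where δ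
    -- bounds all weights.
    have hT : 0 < (C + V ^ 2) / v₀ * (|σ| + 1) + 1 := by positivity
    set T := (C + V ^ 2) / v₀ * (|σ| + 1) + 1
    -- The four demands on δ serve, in order: the quadratic bound for exp on [-1, 0], the range of
    -- `hchar`, the inequality δ² ≤ δ, and the final estimate.
    have hVpos : ∀ᶠ δ in 𝓝[>] (0 : ℝ), δ ^ 2 * V / 2 < 1 ∧ δ < s ∧ δ < 1 ∧ δ * T < ε := by
      refine nhdsWithin_le_nhds ?_
      have c1 : Continuous fun δ : ℝ => δ ^ 2 * V / 2 := by fun_prop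
      have c2 : Continuous fun δ : ℝ => δ * T := by fun_prop
      refine ((c1.tendsto 0).eventually_lt_const (by simp)).and
        ((tendsto_id.eventually_lt_const hs).and ((tendsto_id.eventually_lt_const one_pos).and
          ((c2.tendsto 0).eventually_lt_const (by simpa using hε))))
    obtain ⟨δ, ⟨hδV, hδs, hδ1, hδT⟩, hδ⟩ := (hVpos.and self_mem_nhdsWithin).exists
    have hδ0 : 0 < δ := hδ
    have hbd : ∀ᶠ t in atTop, ∑ k, w t k ^ 2 * v t k < |σ| + 1 :=
      hvar.eventually_lt_const (by linarith [le_abs_self σ])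
    filter_upwards [hmax δ hδ0, hbd] with t ht hb
    have hvpos : ∀ k, 0 ≤ v t k := fun k => hv₀.le.trans (hlow t k)
    have hexp : Complex.exp (-((∑ k, w t k ^ 2 * v t k) / 2 : ℝ)) =
        ∏ k, ((Real.exp (-(w t k ^ 2 * v t k / 2)) : ℝ) : ℂ) := by
      rw [← Complex.ofReal_prod, ← Real.exp_sum, Finset.sum_neg_distrib, ← Finset.sum_div]
      simp
    rw [dist_zero_right, hexp]
    refine (norm_prod_sub_prod_le _ _ _ (fun k _ => norm_charFun_le_one _)
      (fun k _ => ?_)).trans_lt ?_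
    · rw [Complex.norm_real, Real.norm_eq_abs, abs_of_pos (Real.exp_pos _), Real.exp_le_one_iff]
      have := mul_nonneg (sq_nonneg (w t k)) (hvpos k)
      linarith
    have hterm : ∀ k, ‖charFun (μ t k) (w t k) -
        ((Real.exp (-(w t k ^ 2 * v t k / 2)) : ℝ) : ℂ)‖ ≤
        δ * ((C + V ^ 2) / v₀) * (w t k ^ 2 * v t k) := by
      intro k
      have h1 := hchar t k ((ht k).trans hδs.le)
      have hw2 : w t k ^ 2 ≤ δ ^ 2 := by
        rw [← sq_abs]; exact pow_le_pow_left₀ (abs_nonneg _) (ht k) 2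
      have hx0 : 0 ≤ w t k ^ 2 * v t k / 2 :=
        div_nonneg (mul_nonneg (sq_nonneg _) (hvpos k)) two_pos.le
      have hx1 : w t k ^ 2 * v t k / 2 ≤ 1 := by
        have : w t k ^ 2 * v t k ≤ δ ^ 2 * V :=
          mul_le_mul hw2 (hup t k) (hvpos k) (sq_nonneg _)
        linarith
      have h2 : ‖((1 - w t k ^ 2 * v t k / 2 : ℝ) : ℂ) -
          ((Real.exp (-(w t k ^ 2 * v t k / 2)) : ℝ) : ℂ)‖ ≤ (w t k ^ 2 * v t k / 2) ^ 2 := by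
        rw [← Complex.ofReal_sub, Complex.norm_real, Real.norm_eq_abs, abs_sub_comm]
        have := Real.abs_exp_sub_one_sub_id_le (x := -(w t k ^ 2 * v t k / 2))
          (by rw [abs_neg, abs_of_nonneg hx0]; exact hx1)
        rw [neg_sq] at this
        convert this using 2
        ring
      have h3 : C * |w t k| ^ 3 ≤ δ * C * w t k ^ 2 := by
        have e : |w t k| ^ 3 = |w t k| * w t k ^ 2 := by rw [pow_succ', sq_abs]
        rw [e]
        have := mul_le_mul_of_nonneg_right (ht k) (sq_nonneg (w t k))
        nlinarith
      have h4 : (w t k ^ 2 * v t k / 2) ^ 2 ≤ δ * V ^ 2 * w t k ^ 2 := by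
        have a1 : v t k ^ 2 ≤ V ^ 2 := pow_le_pow_left₀ (hvpos k) (hup t k) 2
        have a2 : w t k ^ 2 ≤ δ := hw2.trans (by nlinarith)
        have a3 : w t k ^ 2 * v t k ^ 2 ≤ δ * V ^ 2 :=
          mul_le_mul a2 a1 (sq_nonneg _) hδ0.le
        have a4 := mul_le_mul_of_nonneg_right a3 (sq_nonneg (w t k))
        have a5 : 0 ≤ w t k ^ 2 * v t k ^ 2 * w t k ^ 2 := by positivity
        nlinarith
      -- The lower bound on the variances turns squared weights into variance contributions, whose
      -- sum converges.
      have h5 : w t k ^ 2 ≤ (w t k ^ 2 * v t k) / v₀ := by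
        rw [le_div_iff₀ hv₀]
        exact mul_le_mul_of_nonneg_left (hlow t k) (sq_nonneg _)
      calc _ ≤ C * |w t k| ^ 3 + (w t k ^ 2 * v t k / 2) ^ 2 := by
            refine (norm_sub_le_norm_sub_add_norm_sub _ _ _).trans (add_le_add h1 h2)
        _ ≤ δ * (C + V ^ 2) * w t k ^ 2 := by linarith
        _ ≤ δ * (C + V ^ 2) * ((w t k ^ 2 * v t k) / v₀) := by gcongr
        _ = _ := by ring
    calc _ ≤ ∑ k, δ * ((C + V ^ 2) / v₀) * (w t k ^ 2 * v t k) :=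
          Finset.sum_le_sum fun k _ => hterm k
      _ = δ * ((C + V ^ 2) / v₀ * ∑ k, w t k ^ 2 * v t k) := by
          rw [← Finset.mul_sum]; ring
      _ ≤ δ * T := by
          have : (C + V ^ 2) / v₀ * ∑ k, w t k ^ 2 * v t k ≤ (C + V ^ 2) / v₀ * (|σ| + 1) := by
            gcongr
          gcongr
          linarith
      _ < ε := hδT
  have := hdiff.add hlim
  simpa using this

end CLT

/-! ### Gaussian random effects -/

/-- Gaussian norms are integrable, so the strong law makes the averages of ‖b_i‖ converge almost
surely, and a convergent sequence is bounded. -/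
theorem ae_cond3_of_gaussian {p : ℕ} (d : Design p) (F : ExpFamily) (β : Fin p → ℝ)
    (hdom : F.dom = Set.univ) (G : Matrix (Fin p) (Fin p) ℝ) :
    ∀ᵐ b ∂(Measure.infinitePi fun _ : ℕ =>
      multivariateGaussian (0 : EuclideanSpace ℝ (Fin p)) G), Cond3 d F β b := by
  set γ := multivariateGaussian (0 : EuclideanSpace ℝ (Fin p)) G with hγ
  have hmp : ∀ i : ℕ, MeasurePreserving (fun b : ℕ → EuclideanSpace ℝ (Fin p) => b i)
      (Measure.infinitePi fun _ : ℕ => γ) γ := fun i => measurePreserving_eval_infinitePi _ i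
  have hident : ∀ i : ℕ, IdentDistrib (fun b : ℕ → EuclideanSpace ℝ (Fin p) => ‖b i‖)
      (fun b => ‖b 0‖) (Measure.infinitePi fun _ : ℕ => γ) (Measure.infinitePi fun _ : ℕ => γ) := by
    intro i
    have : IdentDistrib (fun b : ℕ → EuclideanSpace ℝ (Fin p) => b i)
        (fun b => b 0) (Measure.infinitePi fun _ : ℕ => γ) (Measure.infinitePi fun _ : ℕ => γ) :=
      ⟨(hmp i).measurable.aemeasurable, (hmp 0).measurable.aemeasurable, by
        rw [(hmp i).map_eq, (hmp 0).map_eq]⟩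
    exact this.comp measurable_norm
  have hint : Integrable (fun b : ℕ → EuclideanSpace ℝ (Fin p) => ‖b 0‖)
      (Measure.infinitePi fun _ : ℕ => γ) :=
    (hmp 0).integrable_comp_of_integrable (g := fun x => ‖x‖) IsGaussian.integrable_id.norm
  have hind : iIndepFun (fun (i : ℕ) (b : ℕ → EuclideanSpace ℝ (Fin p)) => ‖b i‖)
      (Measure.infinitePi fun _ : ℕ => γ) :=
    iIndepFun_infinitePi (X := fun _ x => ‖x‖) (fun _ => measurable_norm)
  filter_upwards [strong_law_ae_real _ hint (fun i j hij => hind.indepFun hij) hident] with b hb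
  refine ⟨⟨1, one_pos, fun t i _ j _ => by rw [hdom]; exact Set.subset_univ _⟩, ?_⟩
  obtain ⟨C, hC⟩ := hb.bddAbove_range
  refine ⟨C, fun M => ?_⟩
  rcases Nat.eq_zero_or_pos M with rfl | hM
  · simp
  · have h1 : (∑ i ∈ Finset.range M, ‖b i‖) / M ≤ C := hC (Set.mem_range_self M)
    rwa [div_le_iff₀ (by exact_mod_cast hM)] at h1

/-! ### Weighted sums of residuals -/

section Residuals

variable {p : ℕ} {d : Design p} {F : ExpFamily} {β : Fin p → ℝ}
  {b : ℕ → EuclideanSpace ℝ (Fin p)} {Ω : Type*} [MeasurableSpace Ω] {P : Measure Ω}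
  {y : ℕ → ℕ → ℕ → Ω → ℝ} {c₀ ε : ℝ}

/-- The observations of stage `t`. -/
abbrev Design.Obs (d : Design p) (t : ℕ) : Type := Σ i : Fin (d.m t), Fin (d.n t i)

variable (d F β b y) in
/-- The residual of an observation at the true linear predictor. -/
def resid (t i j : ℕ) (ω : Ω) : ℝ := y t i j ω - F.mean (etaTrue d β b t i j)

variable (d F β b) in
/-- The variance of an observation. -/
def obsVar (t i j : ℕ) : ℝ := F.φ * iteratedDeriv 2 F.a (etaTrue d β b t i j)

theorem ResponseModel.aemeasurable_resid (hy : ResponseModel d F β b P y) (t : ℕ) (s : d.Obs t) :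
    AEMeasurable (resid d F β b y t s.1 s.2) P :=
  (hy.law t s.1 s.1.2 s.2 s.2.2).aemeasurable.sub_const _

theorem obsVar_le (hF : CurvatureBounds F c₀) {t i j : ℕ} (h : etaTrue d β b t i j ∈ F.dom) :
    obsVar d F β b t i j ≤ F.φ * c₀⁻¹ :=
  mul_le_mul_of_nonneg_left (hF.upper _ h) F.φ_pos.le

theorem le_obsVar (hF : CurvatureBounds F c₀) {t i j : ℕ} (h : etaTrue d β b t i j ∈ F.dom) :
    F.φ * c₀ ≤ obsVar d F β b t i j :=
  mul_le_mul_of_nonneg_left (hF.lower _ h) F.φ_pos.le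

theorem ResponseModel.iIndepFun_resid (hy : ResponseModel d F β b P y) (t : ℕ) :
    iIndepFun (fun (s : d.Obs t) => resid d F β b y t s.1 s.2) P :=
  (hy.indep t).comp (fun s x => x - F.mean (etaTrue d β b t s.1 s.2)) (fun _ => by fun_prop)

theorem ResponseModel.memLp_resid [IsProbabilityMeasure P] (hy : ResponseModel d F β b P y) {t : ℕ} {s : d.Obs t}
    (h : etaTrue d β b t s.1 s.2 ∈ F.dom) : MemLp (resid d F β b y t s.1 s.2) 2 P := by
  have hl := hy.law t s.1 s.1.2 s.2 s.2.2
  have h1 : MemLp id 2 (P.map (y t s.1 s.2)) := by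
    rw [hl.map_eq]; exact F.memLp_law h 2
  have h2 : MemLp (y t s.1 s.2) 2 P := (memLp_map_measure_iff (by fun_prop) hl.aemeasurable).1 h1
  exact h2.sub (memLp_const _)

theorem ResponseModel.integral_resid (hF : CurvatureBounds F c₀) (hy : ResponseModel d F β b P y)
    {t : ℕ} {s : d.Obs t} (h : etaTrue d β b t s.1 s.2 ∈ F.dom) :
    ∫ ω, resid d F β b y t s.1 s.2 ω ∂P = 0 := by
  have hl := hy.law t s.1 s.1.2 s.2 s.2.2
  have := F.isProbabilityMeasure_law h
  have h1 := hl.integral_comp (f := fun z => z - F.mean (etaTrue d β b t s.1 s.2)) (by fun_prop)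
  have hi : Integrable (fun z : ℝ => z) (F.law (etaTrue d β b t s.1 s.2)) :=
    (F.memLp_law h 1).integrable le_rfl
  rw [integral_sub hi (integrable_const _)] at h1
  rw [show ∫ z, z ∂(F.law (etaTrue d β b t s.1 s.2)) = _ from hF.integral_law h] at h1
  simpa [resid] using h1

theorem ResponseModel.integral_resid_sq (hF : CurvatureBounds F c₀)
    (hy : ResponseModel d F β b P y) {t : ℕ} {s : d.Obs t}
    (h : etaTrue d β b t s.1 s.2 ∈ F.dom) :
    ∫ ω, resid d F β b y t s.1 s.2 ω ^ 2 ∂P = obsVar d F β b t s.1 s.2 := by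
  have hl := hy.law t s.1 s.1.2 s.2 s.2.2
  have h1 := hl.integral_comp (f := fun z => (z - F.mean (etaTrue d β b t s.1 s.2)) ^ 2)
    (by fun_prop)
  rw [hF.integral_sq_law h] at h1
  exact h1

theorem ResponseModel.integral_weighted_sq [IsProbabilityMeasure P] (hF : CurvatureBounds F c₀)
    (hy : ResponseModel d F β b P y) {t : ℕ}
    (h : ∀ s : d.Obs t, etaTrue d β b t s.1 s.2 ∈ F.dom) (w : d.Obs t → ℝ) :
    Integrable (fun ω => (∑ s, w s * resid d F β b y t s.1 s.2 ω) ^ 2) P ∧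
    ∫ ω, (∑ s, w s * resid d F β b y t s.1 s.2 ω) ^ 2 ∂P =
      ∑ s, w s ^ 2 * obsVar d F β b t s.1 s.2 := by
  have hm : ∀ s : d.Obs t, MemLp (fun ω => w s * resid d F β b y t s.1 s.2 ω) 2 P :=
    fun s => (hy.memLp_resid (h s)).const_mul (w s)
  have hs : MemLp (fun ω => ∑ s, w s * resid d F β b y t s.1 s.2 ω) 2 P :=
    memLp_finsetSum _ fun s _ => hm s
  refine ⟨hs.integrable_sq, ?_⟩
  have hind : iIndepFun (fun (s : d.Obs t) ω => w s * resid d F β b y t s.1 s.2 ω) P :=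
    (hy.iIndepFun_resid t).comp (fun s x => w s * x) (fun _ => by fun_prop)
  have h0 : ∀ s : d.Obs t, ∫ ω, w s * resid d F β b y t s.1 s.2 ω ∂P = 0 := fun s => by
    rw [integral_const_mul, hy.integral_resid hF (h s), mul_zero]
  have hsum0 : ∫ ω, ∑ s, w s * resid d F β b y t s.1 s.2 ω ∂P = 0 := by
    rw [integral_finsetSum _ fun s _ => (hm s).integrable (by norm_num)]
    simp [h0]
  have hv := IndepFun.variance_sum (s := Finset.univ) (fun s _ => hm s)
    (fun i _ j _ hij => hind.indepFun hij)
  rw [variance_of_integral_eq_zero (by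
    have := hs.aestronglyMeasurable.aemeasurable
    convert this using 1
    ext ω; simp) (by simpa using hsum0)] at hv
  simp only [Finset.sum_apply] at hv
  rw [hv]
  refine Finset.sum_congr rfl fun s _ => ?_
  rw [variance_of_integral_eq_zero (hm s).aestronglyMeasurable.aemeasurable (h0 s)]
  simp_rw [mul_pow]
  rw [integral_const_mul, hy.integral_resid_sq hF (h s)]

theorem ResponseModel.tendsto_charFun_weighted [IsProbabilityMeasure P]
    (hF : CurvatureBounds F c₀) (hε : 0 < ε)
    (hint : ∀ t, ∀ i < d.m t, ∀ j < d.n t i, Metric.ball (etaTrue d β b t i j) ε ⊆ F.dom)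
    (hy : ResponseModel d F β b P y) (w : ∀ t, d.Obs t → ℝ) {σ : ℝ}
    (hmax : ∀ δ > 0, ∀ᶠ t in atTop, ∀ s, |w t s| ≤ δ)
    (hvar : Tendsto (fun t => ∑ s : d.Obs t, w t s ^ 2 * obsVar d F β b t s.1 s.2)
      atTop (𝓝 σ)) :
    Tendsto (fun t => charFun (P.map fun ω => ∑ s : d.Obs t, w t s * resid d F β b y t s.1 s.2 ω) 1)
      atTop (𝓝 (Complex.exp (-(σ / 2 : ℝ)))) := by
  have hφ := F.φ_pos
  have hc := hF.pos
  have hdom : ∀ t (s : d.Obs t), etaTrue d β b t s.1 s.2 ∈ F.dom := fun t s =>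
    hint t s.1 s.1.2 s.2 s.2.2 (Metric.mem_ball_self hε)
  have hprob : ∀ t (s : d.Obs t), IsProbabilityMeasure (P.map (resid d F β b y t s.1 s.2)) :=
    fun t s => Measure.isProbabilityMeasure_map (hy.aemeasurable_resid t s)
  -- With this choice a tilt by 2r shifts the canonical parameter by ε/2, inside the ball of radius
  -- ε granted by `hint`.
  set r := ε / (4 * F.φ) with hr
  have hrpos : 0 < r := by positivity
  have hr2 : F.φ * (2 * r) < ε := by
    rw [hr]; field_simp; norm_num
  set K := 2 * Real.exp (c₀⁻¹ * F.φ * (2 * r) ^ 2) with hK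
  have hchar : ∀ t (s : d.Obs t), |w t s| ≤ r →
      ‖charFun (P.map (resid d F β b y t s.1 s.2)) (w t s) -
        (1 - w t s ^ 2 * obsVar d F β b t s.1 s.2 / 2 : ℝ)‖ ≤ 6 / r ^ 3 * K * |w t s| ^ 3 := by
    intro t s hw
    have hl := hy.law t s.1 s.1.2 s.2 s.2.2
    have hX := hy.aemeasurable_resid t s
    obtain ⟨e1, e2⟩ := hF.integrable_exp_mul_abs (hint t s.1 s.1.2 s.2 s.2.2)
      (r := 2 * r) (by positivity) hr2
    have hm := hy.memLp_resid (hdom t s)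
    refine norm_charFun_sub_le hrpos ?_ ?_ ?_ ?_ ?_ ?_ hw
    · rw [integrable_map_measure (by fun_prop) hX]
      rw [← hl.map_eq, integrable_map_measure (by fun_prop) hl.aemeasurable] at e1
      exact e1
    · rw [integral_map hX (by fun_prop)]
      rw [← hl.map_eq, integral_map hl.aemeasurable (by fun_prop)] at e2
      exact e2
    · rw [integrable_map_measure (by fun_prop) hX]
      exact hm.integrable (by norm_num)
    · rw [integrable_map_measure (by fun_prop) hX]
      exact hm.integrable_sq
    · rw [integral_map hX (by fun_prop)]
      exact hy.integral_resid hF (hdom t s)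
    · rw [integral_map hX (by fun_prop)]
      exact hy.integral_resid_sq hF (hdom t s)
  have key := tendsto_prod_charFun (fun t (s : d.Obs t) => P.map (resid d F β b y t s.1 s.2)) w
    (fun t s => obsVar d F β b t s.1 s.2) hrpos (mul_pos hφ hc) (by positivity) hchar
    (fun t s => le_obsVar hF (hdom t s)) (fun t s => obsVar_le hF (hdom t s)) hmax hvar
  refine key.congr fun t => ?_
  have hind : iIndepFun (fun (s : d.Obs t) ω => w t s * resid d F β b y t s.1 s.2 ω) P :=
    (hy.iIndepFun_resid t).comp (fun s x => w t s * x) (fun _ => by fun_prop)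
  rw [iIndepFun.charFun_map_fun_sum_eq_prod
    (fun s => (hy.aemeasurable_resid t s).const_mul _) hind, Finset.prod_apply]
  refine Finset.prod_congr rfl fun s _ => ?_
  rw [charFun_map_mul_comp (hy.aemeasurable_resid t s), mul_one]

end Residuals

/-! ### Linear algebra in the maximum norm -/

section LinearAlgebra

variable {p : ℕ}

theorem abs_dotProduct_le (u v : Fin p → ℝ) : |u ⬝ᵥ v| ≤ p * (‖u‖ * ‖v‖) := by
  calc |u ⬝ᵥ v| ≤ ∑ k, |u k * v k| := Finset.abs_sum_le_sum_abs _ _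
    _ ≤ ∑ _k : Fin p, ‖u‖ * ‖v‖ := Finset.sum_le_sum fun k _ => by
        rw [abs_mul]
        exact mul_le_mul (norm_le_pi_norm u k) (norm_le_pi_norm v k) (abs_nonneg _)
          (norm_nonneg _)
    _ = p * (‖u‖ * ‖v‖) := by simp

theorem norm_sq_le_dotProduct_self (u : Fin p → ℝ) : ‖u‖ ^ 2 ≤ u ⬝ᵥ u := by
  have h0 : 0 ≤ u ⬝ᵥ u := Finset.sum_nonneg fun k _ => mul_self_nonneg (u k)
  have h : ‖u‖ ≤ Real.sqrt (u ⬝ᵥ u) := by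
    refine (pi_norm_le_iff_of_nonneg (Real.sqrt_nonneg _)).2 fun k => ?_
    rw [Real.norm_eq_abs]
    refine Real.le_sqrt_of_sq_le ?_
    rw [sq_abs, sq]
    exact Finset.single_le_sum (f := fun k => u k * u k) (fun k _ => mul_self_nonneg (u k))
      (Finset.mem_univ k)
  calc ‖u‖ ^ 2 ≤ Real.sqrt (u ⬝ᵥ u) ^ 2 := pow_le_pow_left₀ (norm_nonneg _) h 2
    _ = u ⬝ᵥ u := Real.sq_sqrt h0

theorem norm_mulVec_le {M : Matrix (Fin p) (Fin p) ℝ} {B : ℝ} (hB : 0 ≤ B)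
    (hM : ∀ k l, |M k l| ≤ B) (v : Fin p → ℝ) : ‖M *ᵥ v‖ ≤ p * B * ‖v‖ := by
  refine (pi_norm_le_iff_of_nonneg (by positivity)).2 fun k => ?_
  refine (abs_dotProduct_le (M k) v).trans ?_
  rw [mul_assoc]
  gcongr
  exact (pi_norm_le_iff_of_nonneg hB).2 (hM k)

namespace EigenvaluesWithin

variable {c : ℝ} {H : Matrix (Fin p) (Fin p) ℝ}

theorem posSemidef_sub_nonneg (h : EigenvaluesWithin c H) (v : Fin p → ℝ) :
    c * (v ⬝ᵥ v) ≤ v ⬝ᵥ (H *ᵥ v) := by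
  have := h.1.dotProduct_mulVec_nonneg v
  simp only [star_trivial, sub_mulVec, smul_mulVec, one_mulVec, dotProduct_sub,
    dotProduct_smul, smul_eq_mul] at this
  linarith

theorem le_inv_mul (h : EigenvaluesWithin c H) (v : Fin p → ℝ) :
    v ⬝ᵥ (H *ᵥ v) ≤ c⁻¹ * (v ⬝ᵥ v) := by
  have := h.2.dotProduct_mulVec_nonneg v
  simp only [star_trivial, sub_mulVec, smul_mulVec, one_mulVec, dotProduct_sub,
    dotProduct_smul, smul_eq_mul] at this
  linarith

theorem transpose_eq (h : EigenvaluesWithin c H) : Hᵀ = H := by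
  have h1 := h.1.1
  have h2 : (H - c • (1 : Matrix (Fin p) (Fin p) ℝ))ᵀ = H - c • 1 := by
    simpa [IsHermitian, conjTranspose_eq_transpose_of_trivial] using h1
  rw [transpose_sub, transpose_smul, transpose_one] at h2
  exact sub_left_injective h2

theorem posDef (h : EigenvaluesWithin c H) (hc : 0 < c) : H.PosDef := by
  refine PosDef.of_dotProduct_mulVec_pos ?_ fun v hv => ?_
  · rw [IsHermitian, conjTranspose_eq_transpose_of_trivial, h.transpose_eq]
  · have h1 : 0 < v ⬝ᵥ v := lt_of_lt_of_le (by positivity) (norm_sq_le_dotProduct_self v)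
    exact (mul_pos hc h1).trans_le (h.posSemidef_sub_nonneg v)

/-- The quadratic form is nonnegative at e_k ± e_l, so 2|H k l| ≤ H k k + H l l, and diagonal
entries are at most c⁻¹. -/
theorem abs_apply_le (h : EigenvaluesWithin c H) (hc : 0 < c) (k l : Fin p) :
    |H k l| ≤ c⁻¹ := by
  have hsymm : H l k = H k l := congrFun (congrFun h.transpose_eq k) l
  have hdiag : ∀ k, H k k ≤ c⁻¹ := fun k => by
    have := h.le_inv_mul (Pi.single k 1)
    simpa using this
  have hq : ∀ s : ℝ, 0 ≤ H k k + s * H k l + s * H l k + s ^ 2 * H l l := fun s => by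
    have := (h.posDef hc).posSemidef.dotProduct_mulVec_nonneg (Pi.single k 1 + s • Pi.single l 1)
    simp [mulVec_add, mulVec_smul, add_dotProduct, dotProduct_add] at this
    linarith
  have h1 := hq 1
  have h2 := hq (-1)
  have h3 := hdiag k
  have h4 := hdiag l
  rw [abs_le]
  constructor <;> linarith

theorem norm_mulVec_le (h : EigenvaluesWithin c H) (hc : 0 < c) (v : Fin p → ℝ) :
    ‖H *ᵥ v‖ ≤ p * c⁻¹ * ‖v‖ :=
  PQL.norm_mulVec_le (inv_nonneg.2 hc.le) (h.abs_apply_le hc) v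

/-- The matrix inverse is total, but if `M⁻¹` is positive definite then its determinant is nonzero,
and this makes `M` itself invertible. -/
theorem inv_mul_cancel {M : Matrix (Fin p) (Fin p) ℝ} (h : EigenvaluesWithin c M⁻¹)
    (hc : 0 < c) : M⁻¹ * M = 1 := by
  have hdet : IsUnit (M⁻¹).det := (h.posDef hc).det_pos.ne'.isUnit
  exact nonsing_inv_mul _ (isUnit_nonsing_inv_det_iff.1 hdet)

/-- Evaluating the form of M⁻¹ at Mu - cu gives 0 ≤ u·Mu - 2c u·u + c² u·M⁻¹u, and the last term is
at most c u·u. No diagonalisation is involved. -/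
theorem mul_le_of_inv {M : Matrix (Fin p) (Fin p) ℝ} (h : EigenvaluesWithin c M⁻¹)
    (hc : 0 < c) (u : Fin p → ℝ) : c * (u ⬝ᵥ u) ≤ u ⬝ᵥ (M *ᵥ u) := by
  have h1 := (h.posDef hc).posSemidef.dotProduct_mulVec_nonneg (M *ᵥ u - c • u)
  have hinv : M⁻¹ *ᵥ (M *ᵥ u) = u := by rw [mulVec_mulVec, h.inv_mul_cancel hc, one_mulVec]
  have hsymm : (M *ᵥ u) ⬝ᵥ (M⁻¹ *ᵥ u) = u ⬝ᵥ u := by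
    rw [dotProduct_mulVec, ← mulVec_transpose, h.transpose_eq, hinv]
  have h2 := h.le_inv_mul u
  have h3 := mul_le_mul_of_nonneg_left h2 (sq_nonneg c)
  have e : c ^ 2 * (c⁻¹ * (u ⬝ᵥ u)) = c * (u ⬝ᵥ u) := by field_simp
  simp only [star_trivial, mulVec_sub, mulVec_smul, hinv, sub_dotProduct, dotProduct_sub,
    smul_dotProduct, dotProduct_smul, smul_eq_mul, hsymm] at h1
  rw [dotProduct_comm (M *ᵥ u) u] at h1
  nlinarith

end EigenvaluesWithin

end LinearAlgebra

/-! ### Score equations within a cluster -/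

section Cluster

variable {p n : ℕ} {F : ExpFamily} {c₀ κ : ℝ} {x : Fin n → Fin p → ℝ} {z : Fin n → ℝ}
  {γ γ' l : Fin p → ℝ}

theorem sum_smul_dotProduct (f : Fin n → ℝ) (x : Fin n → Fin p → ℝ) (v : Fin p → ℝ) :
    (∑ j, f j • x j) ⬝ᵥ v = ∑ j, f j * (x j ⬝ᵥ v) := by
  rw [sum_dotProduct]
  simp

/-- Pair the difference of the two score vectors with u = γ' - γ. Strong monotonicity of a' bounds
the pairing below by a multiple of ‖u‖², Cauchy–Schwarz-type bounds above by a multiple of ‖u‖, and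
one factor ‖u‖ cancels. No prior closeness of γ' to γ is required. -/
theorem CurvatureBounds.norm_sub_le_of_score_eq (hF : CurvatureBounds F c₀) (hκ : 0 ≤ κ)
    (hγ : ∀ j, x j ⬝ᵥ γ ∈ F.dom) (hγ' : ∀ j, x j ⬝ᵥ γ' ∈ F.dom)
    (hx : ∀ u, κ * (u ⬝ᵥ u) ≤ ∑ j, (x j ⬝ᵥ u) ^ 2)
    (hscore : ∑ j, (z j - F.mean (x j ⬝ᵥ γ')) • x j = l) :
    c₀ * κ * ‖γ' - γ‖ ≤ p * (‖∑ j, (z j - F.mean (x j ⬝ᵥ γ)) • x j‖ + ‖l‖) := by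
  set u := γ' - γ with hu
  set S := ∑ j, (z j - F.mean (x j ⬝ᵥ γ)) • x j with hS
  have hxu : ∀ j, x j ⬝ᵥ u = x j ⬝ᵥ γ' - x j ⬝ᵥ γ := fun j => dotProduct_sub _ _ _
  have h1 : c₀ * ∑ j, (x j ⬝ᵥ u) ^ 2 ≤
      ∑ j, (F.mean (x j ⬝ᵥ γ') - F.mean (x j ⬝ᵥ γ)) * (x j ⬝ᵥ u) := by
    rw [Finset.mul_sum]
    refine Finset.sum_le_sum fun j _ => ?_
    rw [hxu]
    exact hF.mean_strongly_monotone (hγ' j) (hγ j)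
  have h2 : ∑ j, (F.mean (x j ⬝ᵥ γ') - F.mean (x j ⬝ᵥ γ)) * (x j ⬝ᵥ u) = (S - l) ⬝ᵥ u := by
    rw [← hscore, hS, sub_dotProduct, sum_smul_dotProduct, sum_smul_dotProduct,
      ← Finset.sum_sub_distrib]
    exact Finset.sum_congr rfl fun j _ => by ring
  have h3 : (S - l) ⬝ᵥ u ≤ p * ((‖S‖ + ‖l‖) * ‖u‖) := by
    refine (le_abs_self _).trans ((abs_dotProduct_le _ _).trans ?_)
    gcongr
    exact norm_sub_le _ _
  have h4 : c₀ * κ * ‖u‖ ^ 2 ≤ p * ((‖S‖ + ‖l‖) * ‖u‖) := by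
    have := mul_le_mul_of_nonneg_left (norm_sq_le_dotProduct_self u) (mul_nonneg hF.pos.le hκ)
    have := mul_le_mul_of_nonneg_left (hx u) hF.pos.le
    linarith
  rcases (norm_nonneg u).eq_or_lt with h0 | h0
  · rw [← h0]; simp only [mul_zero]; positivity
  · refine le_of_mul_le_mul_right ?_ h0
    linarith

/-- The difference is -l minus the Taylor remainders of a', each of which is quadratic in the error
and multiplied by a bounded covariate. -/
theorem CurvatureBounds.norm_score_expansion_le (hF : CurvatureBounds F c₀) {C : ℝ}
    (hC : 0 ≤ C) (hxC : ∀ j, ‖x j‖ ≤ C)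
    (hγ : ∀ j, x j ⬝ᵥ γ ∈ F.dom) (hγ' : ∀ j, x j ⬝ᵥ γ' ∈ F.dom)
    (hscore : ∑ j, (z j - F.mean (x j ⬝ᵥ γ')) • x j = l) :
    ‖∑ j, (iteratedDeriv 2 F.a (x j ⬝ᵥ γ) * (x j ⬝ᵥ (γ' - γ))) • x j -
      ∑ j, (z j - F.mean (x j ⬝ᵥ γ)) • x j‖ ≤
      ‖l‖ + n * (C * (c₀⁻¹ * (p * (C * ‖γ' - γ‖)) ^ 2)) := by
  set u := γ' - γ with hu
  have hc := hF.pos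
  have hxu : ∀ j, x j ⬝ᵥ u = x j ⬝ᵥ γ' - x j ⬝ᵥ γ := fun j => dotProduct_sub _ _ _
  have e : ∑ j, (iteratedDeriv 2 F.a (x j ⬝ᵥ γ) * (x j ⬝ᵥ u)) • x j -
      ∑ j, (z j - F.mean (x j ⬝ᵥ γ)) • x j = -l - ∑ j, (F.mean (x j ⬝ᵥ γ') -
        F.mean (x j ⬝ᵥ γ) - iteratedDeriv 2 F.a (x j ⬝ᵥ γ) * (x j ⬝ᵥ u)) • x j := by
    rw [← hscore, ← Finset.sum_sub_distrib, ← Finset.sum_neg_distrib, ← Finset.sum_sub_distrib]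
    refine Finset.sum_congr rfl fun j _ => ?_
    rw [← sub_smul, ← neg_smul, ← sub_smul]
    congr 1
    ring
  rw [e]
  refine (norm_sub_le _ _).trans ?_
  rw [norm_neg]
  gcongr
  calc _ ≤ ∑ j, ‖(F.mean (x j ⬝ᵥ γ') -
        F.mean (x j ⬝ᵥ γ) - iteratedDeriv 2 F.a (x j ⬝ᵥ γ) * (x j ⬝ᵥ u)) • x j‖ :=
        norm_sum_le _ _
    _ ≤ ∑ _j : Fin n, C * (c₀⁻¹ * (p * (C * ‖u‖)) ^ 2) := Finset.sum_le_sum fun j _ => by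
        rw [norm_smul, mul_comm]
        refine mul_le_mul (hxC j) ?_ (norm_nonneg _) hC
        rw [hxu]
        refine (hF.abs_mean_taylor_le (hγ' j) (hγ j)).trans ?_
        rw [← hxu, ← sq_abs (x j ⬝ᵥ u)]
        have : |x j ⬝ᵥ u| ≤ p * (C * ‖u‖) := by
          refine (abs_dotProduct_le _ _).trans ?_
          gcongr
          exact hxC j
        gcongr
    _ = _ := by simp

end Cluster

/-! ### First-order conditions -/

section FirstOrder

variable {p : ℕ} {d : Design p} {F : ExpFamily} {c₀ : ℝ} {t : ℕ}

theorem eta_add_smul (θ h : Param p (d.m t)) (s : ℝ) (i : Fin (d.m t)) (j : ℕ) :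
    eta d (θ + s • h) i j = eta d θ i j + s * eta d h i j := by
  have h1 : (θ + s • h).fixed = θ.fixed + s • h.fixed := rfl
  have h2 : (θ + s • h).random i = θ.random i + s • h.random i := rfl
  simp only [eta, h1, h2, dotProduct_add, dotProduct_smul, smul_eq_mul]
  ring

theorem hasDerivAt_quadratic {A : Matrix (Fin p) (Fin p) ℝ} (hA : Aᵀ = A) (u v : Fin p → ℝ) :
    HasDerivAt (fun s : ℝ => (u + s • v) ⬝ᵥ (A *ᵥ (u + s • v))) (2 * (v ⬝ᵥ (A *ᵥ u))) 0 := by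
  have hsymm : u ⬝ᵥ (A *ᵥ v) = v ⬝ᵥ (A *ᵥ u) := by
    rw [dotProduct_mulVec, ← mulVec_transpose, hA, dotProduct_comm]
  have e : (fun s : ℝ => (u + s • v) ⬝ᵥ (A *ᵥ (u + s • v))) =
      fun s : ℝ => u ⬝ᵥ (A *ᵥ u) + (s * (2 * (v ⬝ᵥ (A *ᵥ u))) + s ^ 2 * (v ⬝ᵥ (A *ᵥ v))) := by
    ext s
    simp only [mulVec_add, mulVec_smul, dotProduct_add, add_dotProduct, dotProduct_smul,
      smul_dotProduct, smul_eq_mul, hsymm]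
    ring
  rw [e]
  have h1 := (hasDerivAt_id (0 : ℝ)).mul_const (2 * (v ⬝ᵥ (A *ᵥ u)))
  have h2 := ((hasDerivAt_id (0 : ℝ)).pow 2).mul_const (v ⬝ᵥ (A *ᵥ v))
  have h3 := (h1.add h2).const_add (u ⬝ᵥ (A *ᵥ u))
  simpa using h3

theorem IsPQLEstimate.directional (hF : CurvatureBounds F c₀) {z : ℕ → ℕ → ℝ}
    {G : Matrix (Fin p) (Fin p) ℝ} (hG : G.PosDef) {ψ : ℝ} {θ : Param p (d.m t)}
    (hθ : IsPQLEstimate d F z G ψ θ) (h : Param p (d.m t)) :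
    ∑ i : Fin (d.m t), ∑ j : Fin (d.n t i), ψ⁻¹ * ((z i j - F.mean (eta d θ i j)) * eta d h i j) =
      ∑ i : Fin (d.m t), h.random i ⬝ᵥ (G⁻¹ *ᵥ θ.random i) := by
  have hA : (G⁻¹)ᵀ = G⁻¹ := by
    have := hG.inv.1
    rwa [IsHermitian, conjTranspose_eq_transpose_of_trivial] at this
  have hd : HasDerivAt (fun s : ℝ => objective d F z G ψ (θ + s • h))
      ((∑ i : Fin (d.m t), ∑ j : Fin (d.n t i),
        ψ⁻¹ * ((z i j - F.mean (eta d θ i j)) * eta d h i j)) -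
        (1 / 2) * ∑ i : Fin (d.m t), 2 * (h.random i ⬝ᵥ (G⁻¹ *ᵥ θ.random i))) 0 := by
    unfold objective
    refine HasDerivAt.sub ?_ (HasDerivAt.const_mul _ ?_)
    · refine HasDerivAt.fun_sum fun i _ => HasDerivAt.fun_sum fun j _ => ?_
      simp_rw [eta_add_smul, ExpFamily.logDensity]
      have h1 : HasDerivAt (fun s : ℝ => eta d θ i j + s * eta d h i j) (eta d h i j) 0 := by
        simpa using ((hasDerivAt_id (0 : ℝ)).mul_const (eta d h i j)).const_add (eta d θ i j)
      have h2 : HasDerivAt F.a (F.mean (eta d θ i j)) (eta d θ i j + 0 * eta d h i j) := by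
        simpa using hF.hasDerivAt (hθ.1 i j)
      have h3 := (((h1.const_mul (z i j)).sub (h2.comp (0 : ℝ) h1)).const_mul ψ⁻¹).add_const
        (F.c (z i j) ψ)
      rw [sub_mul]
      exact h3
    · exact HasDerivAt.fun_sum fun i _ => hasDerivAt_quadratic hA _ _
  -- A maximiser over the feasible set is a local maximiser along any line: the domain is open and
  -- only finitely many linear predictors are constrained.
  have hopen : ∀ᶠ s in 𝓝 (0 : ℝ), θ + s • h ∈ feasible d F t := by
    simp only [feasible, Set.mem_ofPred_eq, eventually_all]
    intro i j
    have hc : Continuous fun s : ℝ => eta d θ i j + s * eta d h i j := by fun_prop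
    have ht := hc.tendsto 0
    rw [zero_mul, add_zero] at ht
    simp_rw [eta_add_smul]
    exact ht.eventually_mem (F.isOpen_dom.mem_nhds (hθ.1 i j))
  have hmax : IsLocalMax (fun s : ℝ => objective d F z G ψ (θ + s • h)) 0 := by
    filter_upwards [hopen] with s hs
    simpa using hθ.2 hs
  have h0 := hmax.hasDerivAt_eq_zero hd
  rw [← Finset.mul_sum] at h0
  linarith

theorem IsPQLEstimate.score_eq (hF : CurvatureBounds F c₀) {z : ℕ → ℕ → ℝ}
    {G : Matrix (Fin p) (Fin p) ℝ} (hG : G.PosDef) {ψ : ℝ} (hψ : 0 < ψ) {θ : Param p (d.m t)}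
    (hθ : IsPQLEstimate d F z G ψ θ) (i : Fin (d.m t)) :
    ∑ j : Fin (d.n t i), (z i j - F.mean (eta d θ i j)) • d.x t i j =
      ψ • (G⁻¹ *ᵥ θ.random i) := by
  classical
  ext k
  have h := hθ.directional hF hG
    (fun s => if s.2 = some i then (Pi.single k 1 : Fin p → ℝ) s.1 else 0)
  set v : Param p (d.m t) :=
    fun s => if s.2 = some i then (Pi.single k 1 : Fin p → ℝ) s.1 else 0 with hv
  have hfix : v.fixed = 0 := by ext l; simp [Param.fixed, hv]
  have hran : ∀ i', v.random i' = if i' = i then Pi.single k 1 else 0 := by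
    intro i'; ext l
    by_cases hi : i' = i <;> simp [Param.random, hv, hi]
  rw [Finset.sum_eq_single i, Finset.sum_eq_single i] at h
  · simp only [eta, hfix, hran, if_true, dotProduct_zero, zero_add, single_one_dotProduct,
      dotProduct_single_one] at h
    rw [← Finset.mul_sum] at h
    simp only [Finset.sum_apply, Pi.smul_apply, smul_eq_mul]
    rw [← h, mul_inv_cancel_left₀ hψ.ne']
    rfl
  · intro i' _ hi; simp [hran, hi]
  · simp
  · intro i' _ hi
    refine Finset.sum_eq_zero fun j _ => ?_
    simp [eta, hfix, hran, hi]
  · simp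

/-- Fixed and random effects share their covariates, so lowering β by e_k and raising every b_i by
e_k leaves the likelihood unchanged. Only the penalty contributes to the derivative, and `G⁻¹` is
injective. -/
theorem IsPQLEstimate.sum_random (hF : CurvatureBounds F c₀) {z : ℕ → ℕ → ℝ}
    {G : Matrix (Fin p) (Fin p) ℝ} (hG : G.PosDef) {ψ : ℝ} {θ : Param p (d.m t)}
    (hθ : IsPQLEstimate d F z G ψ θ) : ∑ i, θ.random i = 0 := by
  have hzero : G⁻¹ *ᵥ ∑ i, θ.random i = 0 := by
    ext k
    have h := hθ.directional hF hG
      (fun s => oneStar s.2 * (Pi.single k 1 : Fin p → ℝ) s.1)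
    set v : Param p (d.m t) := fun s => oneStar s.2 * (Pi.single k 1 : Fin p → ℝ) s.1 with hv
    have hfix : v.fixed = -Pi.single k 1 := by ext l; simp [Param.fixed, hv, oneStar]
    have hran : ∀ i', v.random i' = Pi.single k 1 := by
      intro i'; ext l; simp [Param.random, hv, oneStar]
    simp only [eta, hfix, hran, dotProduct_neg, neg_add_cancel, mul_zero, Finset.sum_const_zero,
      single_one_dotProduct] at h
    rw [mulVec_sum, Finset.sum_apply, ← h]
    rfl
  have hu : IsUnit G := hG.isUnit
  have : G *ᵥ (G⁻¹ *ᵥ ∑ i, θ.random i) = 0 := by rw [hzero, mulVec_zero]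
  rwa [mulVec_mulVec, mul_nonsing_inv _ ((isUnit_iff_isUnit_det _).1 hu), one_mulVec] at this

end FirstOrder

/-! ### Designs at a fixed stage -/

section Stage

variable {p : ℕ} {d : Design p} {F : ExpFamily} {β : Fin p → ℝ}
  {b : ℕ → EuclideanSpace ℝ (Fin p)} {Ω : Type*}
  {y : ℕ → ℕ → ℕ → Ω → ℝ} {c₀ c₁ C₁ C₂ : ℝ} {t : ℕ}

variable (d F β b) in
/-- The properties of the design at stage `t` that hold for all large `t`, with named constants. -/
structure StageBounds (c₁ C₁ C₂ : ℝ) (t : ℕ) : Prop where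
  c_pos : 0 < c₁
  C_nonneg : 0 ≤ C₁
  one_le_m : 1 ≤ d.m t
  m_le : d.m t ≤ d.nL t
  nL_le : ∀ i < d.m t, d.nL t ≤ d.n t i
  size_le : ∀ i < d.m t, (d.n t i : ℝ) ≤ C₂ * d.nL t
  x_le : ∀ i < d.m t, ∀ j < d.n t i, ‖d.x t i j‖ ≤ C₁
  dom : ∀ i < d.m t, ∀ j < d.n t i, etaTrue d β b t i j ∈ F.dom
  eig : ∀ i < d.m t, EigenvaluesWithin c₁ (H d F β b t i)

theorem Design.nL_le_n (d : Design p) (t : ℕ) {i : ℕ} (hi : i < d.m t) : d.nL t ≤ d.n t i :=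
  ciInf_le (OrderBot.bddBelow _) (⟨i, hi⟩ : Fin (d.m t))

theorem eventually_stageBounds {K₀ : Matrix (Fin p) (Fin p) ℝ} {K : ℕ → Matrix (Fin p) (Fin p) ℝ}
    (hreg : d.Regime) (h2 : Cond2 d F β b K₀ K) (h3 : Cond3 d F β b) :
    ∃ c₁ C₁ C₂, ∀ᶠ t in atTop, StageBounds d F β b c₁ C₁ C₂ t := by
  obtain ⟨C₁, hC₁⟩ := h2.bounded
  obtain ⟨c₁, hc₁, heig, -⟩ := h2.eigenvalues
  obtain ⟨C₂, hC₂⟩ := hreg.balanced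
  obtain ⟨ε, hε, hint⟩ := h3.interior
  -- The maximum with 0 secures nonnegativity, which the covariate bound does not give when there
  -- are no observations.
  refine ⟨c₁, max C₁ 0, C₂, ?_⟩
  filter_upwards [hreg.m_tendsto.eventually_ge_atTop 1, hreg.nL_tendsto.eventually_ge_atTop 1,
    hreg.ratio.eventually_lt_const one_pos, heig, hC₂] with t t1 t2 t3 t4 t5
  have hn : (0 : ℝ) < d.nL t := by exact_mod_cast t2
  refine ⟨hc₁, le_max_right _ _, t1, ?_, fun i hi => d.nL_le_n t hi, t5, fun i hi j hj => ?_,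
    fun i hi j hj => hint t i hi j hj (Metric.mem_ball_self hε), t4⟩
  · rw [div_lt_one hn] at t3
    exact_mod_cast t3.le
  · exact (hC₁ t i hi j hj).le.trans (le_max_left _ _)

namespace StageBounds

theorem one_le_nL (h : StageBounds d F β b c₁ C₁ C₂ t) : (1 : ℝ) ≤ d.nL t := by
  exact_mod_cast h.one_le_m.trans h.m_le

theorem nL_pos (h : StageBounds d F β b c₁ C₁ C₂ t) : (0 : ℝ) < d.nL t :=
  one_pos.trans_le h.one_le_nL

theorem m_pos (h : StageBounds d F β b c₁ C₁ C₂ t) : (0 : ℝ) < d.m t := by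
  exact_mod_cast h.one_le_m

theorem nL_le_cast (h : StageBounds d F β b c₁ C₁ C₂ t) (i : Fin (d.m t)) :
    (d.nL t : ℝ) ≤ d.n t i := by exact_mod_cast h.nL_le i i.2

theorem n_pos (h : StageBounds d F β b c₁ C₁ C₂ t) (i : Fin (d.m t)) : (0 : ℝ) < d.n t i :=
  h.nL_pos.trans_le (h.nL_le_cast i)

theorem C₂_pos (h : StageBounds d F β b c₁ C₁ C₂ t) : 0 < C₂ := by
  have h1 := h.size_le 0 h.one_le_m
  have h2 := h.n_pos ⟨0, h.one_le_m⟩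
  have h3 := h.nL_pos
  by_contra hneg
  have := mul_nonpos_of_nonpos_of_nonneg (le_of_not_gt hneg) h3.le
  simp only at h2
  linarith

theorem N_le (h : StageBounds d F β b c₁ C₁ C₂ t) : (d.N t : ℝ) ≤ C₂ * (d.m t * d.nL t) := by
  rw [Design.N, Nat.cast_sum]
  calc ∑ i : Fin (d.m t), (d.n t i : ℝ) ≤ ∑ _i : Fin (d.m t), C₂ * d.nL t :=
        Finset.sum_le_sum fun i _ => h.size_le i i.2
    _ = _ := by simp; ring

end StageBounds

variable (d F β b) in
/-- `n_i⁻¹ X_iᵀ W_i X_i`, the inverse of `H`. -/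
def info (t i : ℕ) : Matrix (Fin p) (Fin p) ℝ :=
  (d.n t i : ℝ)⁻¹ • ((d.X t i)ᵀ * weight d F β b F.φ t i * d.X t i)

theorem H_eq_info_inv (t i : ℕ) : H d F β b t i = (info d F β b t i)⁻¹ := rfl

theorem info_mulVec (t i : ℕ) (u : Fin p → ℝ) :
    info d F β b t i *ᵥ u = ((d.n t i : ℝ) * F.φ)⁻¹ •
      ∑ j : Fin (d.n t i), (iteratedDeriv 2 F.a (etaTrue d β b t i j) * (d.x t i j ⬝ᵥ u)) •
        d.x t i j := by
  have e : ((d.X t i)ᵀ * weight d F β b F.φ t i * d.X t i) *ᵥ u = F.φ⁻¹ •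
      ∑ j : Fin (d.n t i), (iteratedDeriv 2 F.a (etaTrue d β b t i j) * (d.x t i j ⬝ᵥ u)) •
        d.x t i j := by
    rw [← mulVec_mulVec, ← mulVec_mulVec, weight, smul_mulVec, mulVec_smul]
    congr 1
    ext k
    simp only [mulVec, dotProduct, transpose_apply, Finset.sum_apply,
      Pi.smul_apply, smul_eq_mul]
    refine Finset.sum_congr rfl fun j _ => ?_
    rw [← dotProduct, ← mulVec, mulVec_diagonal]
    simp only [Design.X, of_apply]
    rw [mul_comm]
  rw [info, smul_mulVec, e, smul_smul, mul_inv]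

theorem dotProduct_info_mulVec (t i : ℕ) (u : Fin p → ℝ) :
    u ⬝ᵥ (info d F β b t i *ᵥ u) = ((d.n t i : ℝ) * F.φ)⁻¹ *
      ∑ j : Fin (d.n t i), iteratedDeriv 2 F.a (etaTrue d β b t i j) * (d.x t i j ⬝ᵥ u) ^ 2 := by
  rw [info_mulVec, dotProduct_smul, smul_eq_mul, dotProduct_comm, sum_smul_dotProduct]
  congr 1
  exact Finset.sum_congr rfl fun j _ => by ring

namespace StageBounds

theorem H_mulVec_info (h : StageBounds d F β b c₁ C₁ C₂ t) (i : Fin (d.m t)) (u : Fin p → ℝ) :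
    H d F β b t i *ᵥ (info d F β b t i *ᵥ u) = u := by
  have := h.eig i i.2
  rw [H_eq_info_inv] at this ⊢
  rw [mulVec_mulVec, this.inv_mul_cancel h.c_pos, one_mulVec]

theorem info_mulVec_H (h : StageBounds d F β b c₁ C₁ C₂ t) (i : Fin (d.m t)) (u : Fin p → ℝ) :
    info d F β b t i *ᵥ (H d F β b t i *ᵥ u) = u := by
  have := (h.eig i i.2)
  rw [H_eq_info_inv] at this ⊢
  rw [mulVec_mulVec, mul_eq_one_comm.1 (this.inv_mul_cancel h.c_pos), one_mulVec]

theorem mul_dotProduct_self_le (h : StageBounds d F β b c₁ C₁ C₂ t) (hF : CurvatureBounds F c₀)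
    (i : Fin (d.m t)) (u : Fin p → ℝ) :
    c₀ * F.φ * c₁ * d.n t i * (u ⬝ᵥ u) ≤ ∑ j : Fin (d.n t i), (d.x t i j ⬝ᵥ u) ^ 2 := by
  have hφ := F.φ_pos
  have hc := hF.pos
  have hn := h.n_pos i
  have h1 : c₁ * (u ⬝ᵥ u) ≤ u ⬝ᵥ (info d F β b t i *ᵥ u) :=
    EigenvaluesWithin.mul_le_of_inv (h.eig i i.2) h.c_pos u
  have h2 : ∑ j : Fin (d.n t i), iteratedDeriv 2 F.a (etaTrue d β b t i j) *
      (d.x t i j ⬝ᵥ u) ^ 2 ≤ c₀⁻¹ * ∑ j : Fin (d.n t i), (d.x t i j ⬝ᵥ u) ^ 2 := by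
    rw [Finset.mul_sum]
    exact Finset.sum_le_sum fun j _ =>
      mul_le_mul_of_nonneg_right (hF.upper _ (h.dom i i.2 j j.2)) (sq_nonneg _)
  rw [dotProduct_info_mulVec] at h1
  have h3 : c₁ * (u ⬝ᵥ u) ≤ ((d.n t i : ℝ) * F.φ)⁻¹ *
      (c₀⁻¹ * ∑ j : Fin (d.n t i), (d.x t i j ⬝ᵥ u) ^ 2) := h1.trans (by gcongr)
  have h4 := mul_le_mul_of_nonneg_left h3 (by positivity : 0 ≤ c₀ * F.φ * d.n t i)
  calc _ = c₀ * F.φ * d.n t i * (c₁ * (u ⬝ᵥ u)) := by ring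
    _ ≤ _ := h4
    _ = _ := by field_simp

end StageBounds

/-! ### Scores and leading terms -/

variable (d F β b y) in
/-- The score `X_iᵀ (y_i - μ_i)` of cluster `i` at the truth. -/
def score (t i : ℕ) (ω : Ω) : Fin p → ℝ :=
  ∑ j : Fin (d.n t i), resid d F β b y t i j ω • d.x t i j

variable (d F β b y) in
/-- The leading term of the estimation error of cluster `i`. -/
def lead (t i : ℕ) (ω : Ω) : Fin p → ℝ :=
  ((d.n t i : ℝ) * F.φ)⁻¹ • (H d F β b t i *ᵥ score d F β b y t i ω)

variable (d F β b y) in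
/-- The average of the leading terms. -/
def leadMean (t : ℕ) (ω : Ω) : Fin p → ℝ :=
  (d.m t : ℝ)⁻¹ • ∑ i : Fin (d.m t), lead d F β b y t i ω

theorem sum_dotProduct_score (g : Fin (d.m t) → Fin p → ℝ) (ω : Ω) :
    ∑ i : Fin (d.m t), g i ⬝ᵥ score d F β b y t i ω =
      ∑ s : d.Obs t, (g s.1 ⬝ᵥ d.x t s.1 s.2) * resid d F β b y t s.1 s.2 ω := by
  rw [Fintype.sum_sigma]
  refine Finset.sum_congr rfl fun i _ => ?_
  rw [score, dotProduct_comm, sum_smul_dotProduct]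
  exact Finset.sum_congr rfl fun j _ => by rw [mul_comm, dotProduct_comm]

/-- The variance of an observation is φ a'', and the weights of the information matrix are φ⁻¹a'':
the score covariance of a cluster is n φ² times `info`. -/
theorem sum_weight_sq_mul_obsVar (h : StageBounds d F β b c₁ C₁ C₂ t)
    (g : Fin (d.m t) → Fin p → ℝ) :
    ∑ s : d.Obs t, (g s.1 ⬝ᵥ d.x t s.1 s.2) ^ 2 * obsVar d F β b t s.1 s.2 =
      ∑ i : Fin (d.m t), d.n t i * F.φ ^ 2 * (g i ⬝ᵥ (info d F β b t i *ᵥ g i)) := by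
  rw [Fintype.sum_sigma]
  refine Finset.sum_congr rfl fun i _ => ?_
  rw [dotProduct_info_mulVec, ← mul_assoc, Finset.mul_sum]
  refine Finset.sum_congr rfl fun j _ => ?_
  have hφ := F.φ_pos.ne'
  have hn := (h.n_pos i).ne'
  rw [obsVar, dotProduct_comm]
  field_simp

theorem sum_weight_sq_mul_obsVar_le (h : StageBounds d F β b c₁ C₁ C₂ t)
    (hF : CurvatureBounds F c₀) (g : Fin (d.m t) → Fin p → ℝ) :
    ∑ s : d.Obs t, (g s.1 ⬝ᵥ d.x t s.1 s.2) ^ 2 * obsVar d F β b t s.1 s.2 ≤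
      F.φ * c₀⁻¹ * (p * C₁) ^ 2 * ∑ i : Fin (d.m t), d.n t i * ‖g i‖ ^ 2 := by
  have hφ := F.φ_pos
  have hc := hF.pos
  rw [Fintype.sum_sigma, Finset.mul_sum]
  refine Finset.sum_le_sum fun i _ => ?_
  calc _ ≤ ∑ _j : Fin (d.n t i), (p * (‖g i‖ * C₁)) ^ 2 * (F.φ * c₀⁻¹) := by
        refine Finset.sum_le_sum fun j _ => ?_
        refine mul_le_mul ?_ (obsVar_le hF (h.dom i i.2 j j.2)) ?_ (by positivity)
        · rw [← sq_abs]
          refine pow_le_pow_left₀ (abs_nonneg _) ((abs_dotProduct_le _ _).trans ?_) 2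
          gcongr
          exact h.x_le i i.2 j j.2
        · exact le_trans (by positivity) (le_obsVar hF (h.dom i i.2 j j.2))
    _ = _ := by simp; ring

/-- The second moment of a linear combination of the scores. -/
theorem StageBounds.integral_sum_dotProduct_score_sq [MeasurableSpace Ω] {P : Measure Ω}
    [IsProbabilityMeasure P]
    (h : StageBounds d F β b c₁ C₁ C₂ t) (hF : CurvatureBounds F c₀)
    (hy : ResponseModel d F β b P y) (g : Fin (d.m t) → Fin p → ℝ) :
    Integrable (fun ω => (∑ i : Fin (d.m t), g i ⬝ᵥ score d F β b y t i ω) ^ 2) P ∧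
    ∫ ω, (∑ i : Fin (d.m t), g i ⬝ᵥ score d F β b y t i ω) ^ 2 ∂P ≤
      F.φ * c₀⁻¹ * (p * C₁) ^ 2 * ∑ i : Fin (d.m t), d.n t i * ‖g i‖ ^ 2 := by
  simp_rw [sum_dotProduct_score]
  obtain ⟨h1, h2⟩ := hy.integral_weighted_sq hF (t := t)
    (fun s => h.dom s.1 s.1.2 s.2 s.2.2) (fun s => g s.1 ⬝ᵥ d.x t s.1 s.2)
  exact ⟨h1, h2.trans_le (sum_weight_sq_mul_obsVar_le h hF g)⟩

theorem StageBounds.integral_score_sq [MeasurableSpace Ω] {P : Measure Ω}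
    [IsProbabilityMeasure P]
    (h : StageBounds d F β b c₁ C₁ C₂ t) (hF : CurvatureBounds F c₀)
    (hy : ResponseModel d F β b P y) (i : Fin (d.m t)) :
    Integrable (fun ω => score d F β b y t i ω ⬝ᵥ score d F β b y t i ω) P ∧
    ∫ ω, score d F β b y t i ω ⬝ᵥ score d F β b y t i ω ∂P ≤
      p * (F.φ * c₀⁻¹ * (p * C₁) ^ 2 * d.n t i) := by
  classical
  have key : ∀ k : Fin p, Integrable (fun ω => score d F β b y t i ω k * score d F β b y t i ω k) P ∧
      ∫ ω, score d F β b y t i ω k * score d F β b y t i ω k ∂P ≤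
        F.φ * c₀⁻¹ * (p * C₁) ^ 2 * d.n t i := by
    intro k
    have h1 := h.integral_sum_dotProduct_score_sq hF hy
      (fun i' => if i' = i then (Pi.single k 1 : Fin p → ℝ) else 0)
    have e : ∀ ω, ∑ i' : Fin (d.m t), (if i' = i then (Pi.single k 1 : Fin p → ℝ) else 0) ⬝ᵥ
        score d F β b y t i' ω = score d F β b y t i ω k := by
      intro ω
      rw [Finset.sum_eq_single i (fun i' _ hi => by simp [hi]) (by simp)]
      simp
    have e2 : ∑ i' : Fin (d.m t), (d.n t i' : ℝ) *
        ‖if i' = i then (Pi.single k 1 : Fin p → ℝ) else 0‖ ^ 2 = d.n t i := by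
      rw [Finset.sum_eq_single i (fun i' _ hi => by simp [hi]) (by simp)]
      simp [Pi.norm_single]
    simp_rw [e, e2, sq] at h1
    simpa [sq] using h1
  simp only [dotProduct]
  refine ⟨integrable_finsetSum _ fun k _ => (key k).1, ?_⟩
  rw [integral_finsetSum _ fun k _ => (key k).1]
  calc _ ≤ ∑ _k : Fin p, F.φ * c₀⁻¹ * (p * C₁) ^ 2 * d.n t i :=
        Finset.sum_le_sum fun k _ => (key k).2
    _ = _ := by simp

theorem dotProduct_lead (h : StageBounds d F β b c₁ C₁ C₂ t) (i : Fin (d.m t))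
    (v : Fin p → ℝ) (ω : Ω) : v ⬝ᵥ lead d F β b y t i ω =
      (((d.n t i : ℝ) * F.φ)⁻¹ • (H d F β b t i *ᵥ v)) ⬝ᵥ score d F β b y t i ω := by
  rw [lead, dotProduct_smul, smul_dotProduct, dotProduct_mulVec, ← mulVec_transpose,
    (h.eig i i.2).transpose_eq]

theorem StageBounds.norm_inv_smul_H_mulVec_le (h : StageBounds d F β b c₁ C₁ C₂ t)
    (i : Fin (d.m t)) (v : Fin p → ℝ) :
    ‖((d.n t i : ℝ) * F.φ)⁻¹ • (H d F β b t i *ᵥ v)‖ ≤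
      (d.n t i : ℝ)⁻¹ * (F.φ⁻¹ * (p * c₁⁻¹)) * ‖v‖ := by
  have hφ := F.φ_pos
  have hn := h.n_pos i
  rw [norm_smul, Real.norm_eq_abs, abs_of_pos (by positivity), mul_inv]
  have := (h.eig i i.2).norm_mulVec_le h.c_pos v
  calc _ ≤ (d.n t i : ℝ)⁻¹ * F.φ⁻¹ * (p * c₁⁻¹ * ‖v‖) := by gcongr
    _ = _ := by ring

/-- Each leading term is of order n_L^(-1/2); independence across the m clusters gains a further
m^(-1/2) for their average. -/
theorem StageBounds.integral_leadMean_sq [MeasurableSpace Ω] {P : Measure Ω}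
    [IsProbabilityMeasure P]
    (h : StageBounds d F β b c₁ C₁ C₂ t) (hF : CurvatureBounds F c₀)
    (hy : ResponseModel d F β b P y) :
    Integrable (fun ω => leadMean d F β b y t ω ⬝ᵥ leadMean d F β b y t ω) P ∧
    (d.m t * d.nL t) * ∫ ω, leadMean d F β b y t ω ⬝ᵥ leadMean d F β b y t ω ∂P ≤
      p * (F.φ * c₀⁻¹ * (p * C₁) ^ 2 * (F.φ⁻¹ * (p * c₁⁻¹)) ^ 2) := by
  have hφ := F.φ_pos
  have hc := hF.pos
  have hm := h.m_pos
  have hnL := h.nL_pos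
  set D := F.φ⁻¹ * (p * c₁⁻¹) with hD
  have hD0 : 0 ≤ D := by have := h.c_pos; positivity
  have key : ∀ k : Fin p, Integrable (fun ω => leadMean d F β b y t ω k * leadMean d F β b y t ω k) P ∧
      (d.m t * d.nL t) * ∫ ω, leadMean d F β b y t ω k * leadMean d F β b y t ω k ∂P ≤
        F.φ * c₀⁻¹ * (p * C₁) ^ 2 * D ^ 2 := by
    intro k
    set g : Fin (d.m t) → Fin p → ℝ := fun i => (d.m t : ℝ)⁻¹ •
      (((d.n t i : ℝ) * F.φ)⁻¹ • (H d F β b t i *ᵥ (Pi.single k 1 : Fin p → ℝ))) with hg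
    have e : ∀ ω, leadMean d F β b y t ω k =
        ∑ i : Fin (d.m t), g i ⬝ᵥ score d F β b y t i ω := by
      intro ω
      simp only [leadMean, Pi.smul_apply, Finset.sum_apply, smul_eq_mul, Finset.mul_sum, hg]
      refine Finset.sum_congr rfl fun i _ => ?_
      rw [smul_dotProduct, ← dotProduct_lead h, single_one_dotProduct, smul_eq_mul]
    have hgn : ∀ i, ‖g i‖ ≤ (d.m t : ℝ)⁻¹ * ((d.n t i : ℝ)⁻¹ * D) := by
      intro i
      rw [hg, norm_smul, Real.norm_eq_abs, abs_of_pos (by positivity)]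
      gcongr
      refine (h.norm_inv_smul_H_mulVec_le i _).trans ?_
      rw [Pi.norm_single, norm_one, mul_one]
    have hsum : ∑ i : Fin (d.m t), d.n t i * ‖g i‖ ^ 2 ≤ D ^ 2 / (d.m t * d.nL t) := by
      calc _ ≤ ∑ _i : Fin (d.m t), (d.m t : ℝ)⁻¹ ^ 2 * (D ^ 2 / d.nL t) := by
            refine Finset.sum_le_sum fun i _ => ?_
            have hn := h.n_pos i
            calc (d.n t i : ℝ) * ‖g i‖ ^ 2
                ≤ d.n t i * ((d.m t : ℝ)⁻¹ * ((d.n t i : ℝ)⁻¹ * D)) ^ 2 := by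
                  gcongr; exact hgn i
              _ = (d.m t : ℝ)⁻¹ ^ 2 * (D ^ 2 / d.n t i) := by field_simp
              _ ≤ _ := by gcongr; exact h.nL_le i i.2
        _ = _ := by simp; field_simp
    obtain ⟨h1, h2⟩ := h.integral_sum_dotProduct_score_sq hF hy g
    simp_rw [← e, sq (leadMean d F β b y t _ k)] at h1 h2
    refine ⟨h1, ?_⟩
    calc _ ≤ (d.m t * d.nL t) * (F.φ * c₀⁻¹ * (p * C₁) ^ 2 * (D ^ 2 / (d.m t * d.nL t))) := by
          gcongr
          exact h2.trans (by gcongr)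
      _ = _ := by field_simp
  simp only [dotProduct]
  refine ⟨integrable_finsetSum _ fun k _ => (key k).1, ?_⟩
  rw [integral_finsetSum _ fun k _ => (key k).1, Finset.mul_sum]
  calc _ ≤ ∑ _k : Fin p, F.φ * c₀⁻¹ * (p * C₁) ^ 2 * D ^ 2 :=
        Finset.sum_le_sum fun k _ => (key k).2
    _ = _ := by simp

end Stage

/-! ### Deterministic bounds on the estimation error -/

set_option maxHeartbeats 1000000 in
/-- The system of inequalities satisfied by the errors `U`, the score norms `s`, the norms `B` of the
centred random effects and the linearisation errors `E` of the clusters yields explicit bounds. -/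
theorem exists_cluster_error_const {q k M Cb D : ℝ} (hq : 0 ≤ q) (hk : 0 < k) (hM : 0 ≤ M)
    (hCb : 0 ≤ Cb) (hD : 0 ≤ D) : ∃ C, 0 ≤ C ∧ ∀ (m : ℕ) (r Ub : ℝ) (U s B E : Fin m → ℝ),
      0 < m → 1 ≤ r → (m : ℝ) ≤ r ^ 2 → 4 * (q * M) ≤ k * r ^ 2 → (∀ i, 0 ≤ U i) →
      (∀ i, 0 ≤ s i) → (∀ i, 0 ≤ B i) → m * Ub = ∑ i, U i →
      (∀ i, k * r ^ 2 * U i ≤ q * (s i + M * (U i + Ub + B i))) →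
      ∑ i, s i ^ 2 ≤ M * (m * r ^ 2) → ∑ i, B i ≤ Cb * m →
      (∀ i, r ^ 2 * E i ≤ D * (M * (U i + Ub + B i) + r ^ 2 * U i ^ 2)) →
      (∀ i, r ^ 2 * U i ≤ C * (s i + 1 + B i)) ∧ r ^ 2 * ∑ i, E i ≤ C * m ∧
        ∀ i, s i ^ 2 ≤ M * r ^ 2 → r ^ 2 * E i ≤ C * (1 + B i) ^ 2 := by
  -- In the application r = √n_L. `Ca` bounds r times the average error, `C1` the individual errors,
  -- `C2` the sum of r²U², `C3` the sum of the linearisation errors; `a` bounds rU/(1 + B), and `C4`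
  -- the linearisation error, in a cluster whose own score is under control.
  obtain ⟨Ca, hCa⟩ : ∃ Ca, Ca = 2 * q * (M + 1 + M * Cb) / k := ⟨_, rfl⟩
  obtain ⟨C1, hC1⟩ : ∃ C1, C1 = 2 * q * (1 + M * Ca + M) / k := ⟨_, rfl⟩
  obtain ⟨C2, hC2⟩ : ∃ C2, C2 = 3 * C1 ^ 2 * (M + 1 + Cb ^ 2) := ⟨_, rfl⟩
  obtain ⟨C3, hC3⟩ : ∃ C3, C3 = D * (M * (2 * Ca + Cb) + C2) := ⟨_, rfl⟩
  obtain ⟨a, ha⟩ : ∃ a, a = C1 * (M + 3) := ⟨_, rfl⟩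
  obtain ⟨C4, hC4⟩ : ∃ C4, C4 = D * (M * (a + Ca + 1) + a ^ 2) := ⟨_, rfl⟩
  have pCa : 0 ≤ Ca := by rw [hCa]; positivity
  have pC1 : 0 ≤ C1 := by rw [hC1]; positivity
  have pC2 : 0 ≤ C2 := by rw [hC2]; positivity
  have pC3 : 0 ≤ C3 := by rw [hC3]; positivity
  have pa : 0 ≤ a := by rw [ha]; positivity
  have pC4 : 0 ≤ C4 := by rw [hC4]; positivity
  have kCa : k * Ca = 2 * q * (M + 1 + M * Cb) := by rw [hCa]; field_simp
  have kC1 : k * C1 = 2 * q * (1 + M * Ca + M) := by rw [hC1]; field_simp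
  refine ⟨C1 + C3 + C4, by positivity, ?_⟩
  intro m r Ub U s B E hm hr hmr hqM hU hs hB hUb hmain hS hBs hE
  have hm0 : (0 : ℝ) < m := by exact_mod_cast hm
  have hr0 : 0 < r := one_pos.trans_le hr
  have hUb0 : 0 ≤ Ub := by
    have : 0 ≤ m * Ub := hUb ▸ Finset.sum_nonneg fun i _ => hU i
    exact nonneg_of_mul_nonneg_right this hm0
  -- the average error
  have hss : ∑ i, s i ≤ m * (r * (M + 1)) := by
    have h1 : ∀ i, s i * r ≤ s i ^ 2 + r ^ 2 := fun i => by
      linarith [sq_nonneg (s i - r), sub_sq' (s i) r, sq_nonneg (s i), sq_nonneg r]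
    have h2 : (∑ i, s i) * r ≤ M * (m * r ^ 2) + m * r ^ 2 := by
      rw [Finset.sum_mul]
      calc _ ≤ ∑ i, (s i ^ 2 + r ^ 2) := Finset.sum_le_sum fun i _ => h1 i
        _ = ∑ i, s i ^ 2 + m * r ^ 2 := by rw [Finset.sum_add_distrib]; simp
        _ ≤ _ := by linarith
    refine le_of_mul_le_mul_right ?_ hr0
    calc _ ≤ _ := h2
      _ = _ := by ring
  have hUbr : r * Ub ≤ Ca := by
    have h1 : k * r ^ 2 * (m * Ub) ≤ q * (∑ i, s i + M * (2 * (m * Ub) + ∑ i, B i)) := by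
      calc k * r ^ 2 * (m * Ub) = ∑ i, k * r ^ 2 * U i := by rw [hUb, Finset.mul_sum]
        _ ≤ ∑ i, q * (s i + M * (U i + Ub + B i)) := Finset.sum_le_sum fun i _ => hmain i
        _ = q * (∑ i, s i + M * (∑ i, U i + m * Ub + ∑ i, B i)) := by
          rw [← Finset.mul_sum, Finset.sum_add_distrib, ← Finset.mul_sum, Finset.sum_add_distrib,
            Finset.sum_add_distrib]
          simp
        _ = _ := by rw [← hUb]; ring
    have h2 : k * r ^ 2 * (m * Ub) ≤
        q * (m * (r * (M + 1)) + M * (2 * (m * Ub) + Cb * m)) := h1.trans (by gcongr)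
    have h3 : k * r ^ 2 * Ub ≤ q * (r * (M + 1) + M * (2 * Ub + Cb)) := by
      refine le_of_mul_le_mul_left ?_ hm0
      calc _ = k * r ^ 2 * (m * Ub) := by ring
        _ ≤ _ := h2
        _ = _ := by ring
    -- The penalty feeds 2qM·Ub back into the right-hand side. As 4qM ≤ k r², this is at most half
    -- of the left-hand side and is absorbed.
    have h4 : 4 * (q * M) * Ub ≤ k * r ^ 2 * Ub := mul_le_mul_of_nonneg_right hqM hUb0
    have h5 : q * M * Cb ≤ q * M * Cb * r := le_mul_of_one_le_right (by positivity) hr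
    have h6 : k * r ^ 2 * Ub ≤ (k * Ca) * r := by rw [kCa]; linarith
    refine le_of_mul_le_mul_left ?_ (mul_pos hk hr0)
    calc _ = k * r ^ 2 * Ub := by ring
      _ ≤ _ := h6
      _ = _ := by ring
  have hUbC : Ub ≤ Ca := (le_mul_of_one_le_left hUb0 hr).trans hUbr
  -- the individual errors
  have hUi : ∀ i, r ^ 2 * U i ≤ C1 * (s i + 1 + B i) := by
    intro i
    have h1 := hmain i
    have h2 : 4 * (q * M) * U i ≤ k * r ^ 2 * U i := mul_le_mul_of_nonneg_right hqM (hU i)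
    have h3 : q * M * Ub ≤ q * M * Ca := by gcongr
    have h4 : k * (r ^ 2 * U i) ≤ 2 * q * (s i + M * Ca + M * B i) := by
      have : 0 ≤ q * s i := mul_nonneg hq (hs i)
      have : 0 ≤ q * M * B i := mul_nonneg (mul_nonneg hq hM) (hB i)
      have : 0 ≤ q * M * Ca := by positivity
      linarith
    refine le_of_mul_le_mul_left ?_ hk
    have h5 : s i + M * Ca + M * B i ≤ (1 + M * Ca + M) * (s i + 1 + B i) := by
      have p1 := mul_nonneg (mul_nonneg hM pCa) (hs i)
      have p2 := mul_nonneg (mul_nonneg hM pCa) (hB i)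
      have p3 := mul_nonneg hM (hs i)
      have p4 := hB i
      linarith
    calc _ ≤ 2 * q * (s i + M * Ca + M * B i) := h4
      _ ≤ 2 * q * ((1 + M * Ca + M) * (s i + 1 + B i)) := by gcongr
      _ = k * (C1 * (s i + 1 + B i)) := by rw [← mul_assoc k, kC1]; ring
  have hUsq : r ^ 2 * ∑ i, U i ^ 2 ≤ C2 * m := by
    have h1 : ∀ i, (r ^ 2 * U i) ^ 2 ≤ 3 * C1 ^ 2 * (s i ^ 2 + 1 + B i ^ 2) := by
      intro i
      have p0 : 0 ≤ r ^ 2 * U i := mul_nonneg (by positivity) (hU i)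
      refine (pow_le_pow_left₀ p0 (hUi i) 2).trans ?_
      have : (s i + 1 + B i) ^ 2 ≤ 3 * (s i ^ 2 + 1 + B i ^ 2) := by
        linarith [sq_nonneg (s i - 1), sq_nonneg (s i - B i), sq_nonneg (B i - 1),
          add_sq' (s i + 1) (B i), add_sq' (s i) 1, sub_sq' (s i) 1, sub_sq' (s i) (B i),
          sub_sq' (B i) 1]
      calc (C1 * (s i + 1 + B i)) ^ 2 = C1 ^ 2 * (s i + 1 + B i) ^ 2 := mul_pow _ _ _
        _ ≤ C1 ^ 2 * (3 * (s i ^ 2 + 1 + B i ^ 2)) := by gcongr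
        _ = _ := by ring
    -- Only the sum of the norms of the random effects is controlled. The crude bound ∑B² ≤ (∑B)²
    -- costs a factor m, which m ≤ r² pays for.
    have hB2 : ∑ i, B i ^ 2 ≤ Cb ^ 2 * (m * r ^ 2) := by
      calc _ ≤ (∑ i, B i) ^ 2 := Finset.sum_sq_le_sq_sum_of_nonneg fun i _ => hB i
        _ ≤ (Cb * m) ^ 2 := pow_le_pow_left₀ (Finset.sum_nonneg fun i _ => hB i) hBs 2
        _ = Cb ^ 2 * (m * m) := by ring
        _ ≤ _ := by gcongr
    have h2 : r ^ 2 * (r ^ 2 * ∑ i, U i ^ 2) ≤ r ^ 2 * (C2 * m) := by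
      calc _ = ∑ i, (r ^ 2 * U i) ^ 2 := by
            rw [Finset.mul_sum, Finset.mul_sum]
            exact Finset.sum_congr rfl fun i _ => by ring
        _ ≤ ∑ i, 3 * C1 ^ 2 * (s i ^ 2 + 1 + B i ^ 2) := Finset.sum_le_sum fun i _ => h1 i
        _ = 3 * C1 ^ 2 * (∑ i, s i ^ 2 + m + ∑ i, B i ^ 2) := by
            rw [← Finset.mul_sum, Finset.sum_add_distrib, Finset.sum_add_distrib]; simp
        _ ≤ 3 * C1 ^ 2 * (M * (m * r ^ 2) + m * r ^ 2 + Cb ^ 2 * (m * r ^ 2)) := by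
            gcongr
            exact le_mul_of_one_le_right hm0.le (one_le_pow₀ hr)
        _ = _ := by rw [hC2]; ring
    exact le_of_mul_le_mul_left h2 (by positivity)
  refine ⟨fun i => (hUi i).trans ?_, ?_, fun i hi => ?_⟩
  · have p1 := hs i
    have p2 := hB i
    gcongr
    linarith
  · calc r ^ 2 * ∑ i, E i = ∑ i, r ^ 2 * E i := Finset.mul_sum _ _ _
      _ ≤ ∑ i, D * (M * (U i + Ub + B i) + r ^ 2 * U i ^ 2) := Finset.sum_le_sum fun i _ => hE i
      _ = D * (M * (∑ i, U i + m * Ub + ∑ i, B i) + r ^ 2 * ∑ i, U i ^ 2) := by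
          rw [← Finset.mul_sum, Finset.sum_add_distrib, ← Finset.mul_sum, ← Finset.mul_sum,
            Finset.sum_add_distrib, Finset.sum_add_distrib]
          simp
      _ ≤ D * (M * (m * Ca + m * Ca + Cb * m) + C2 * m) := by rw [← hUb]; gcongr
      _ = C3 * m := by rw [hC3]; ring
      _ ≤ _ := by gcongr; linarith
  · have hsi : s i ≤ (M + 1) * r := by
      refine abs_le_of_sq_le_sq' ?_ (by positivity) |>.2
      calc s i ^ 2 ≤ M * r ^ 2 := hi
        _ ≤ (M + 1) ^ 2 * r ^ 2 := by
          gcongr; linarith [sq_nonneg M, add_sq' M 1]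
        _ = _ := by ring
    have hBi := hB i
    have hrU : r * U i ≤ a * (1 + B i) := by
      have h1 : r ^ 2 * U i ≤ C1 * ((M + 1) * r + 1 + B i) :=
        (hUi i).trans (by gcongr)
      have h2 : C1 * ((M + 1) * r + 1 + B i) ≤ r * (a * (1 + B i)) := by
        have e1 : (M + 1) * r + 1 + B i ≤ r * ((M + 3) * (1 + B i)) := by
          have q1 : 0 ≤ M * B i := mul_nonneg hM hBi
          have q2 : B i ≤ r * B i := le_mul_of_one_le_left hBi hr
          have q3 : 0 ≤ r * (M * B i) := mul_nonneg hr0.le q1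
          have q4 : 0 ≤ r * B i := mul_nonneg hr0.le hBi
          linarith
        calc _ ≤ C1 * (r * ((M + 3) * (1 + B i))) := by gcongr
          _ = _ := by rw [ha]; ring
      refine le_of_mul_le_mul_left ?_ hr0
      calc _ = r ^ 2 * U i := by ring
        _ ≤ _ := h1.trans h2
    have hUa : U i ≤ a * (1 + B i) := (le_mul_of_one_le_left (hU i) hr).trans hrU
    have hrU0 : 0 ≤ r * U i := mul_nonneg hr0.le (hU i)
    have hU2 : r ^ 2 * U i ^ 2 ≤ a ^ 2 * (1 + B i) ^ 2 := by
      rw [← mul_pow, ← mul_pow]; exact pow_le_pow_left₀ hrU0 hrU 2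
    have hone : 1 + B i ≤ (1 + B i) ^ 2 := le_self_pow₀ (by linarith) two_ne_zero
    have hlin : U i + Ub + B i ≤ (a + Ca + 1) * (1 + B i) ^ 2 := by
      have e2 : U i + Ub + B i ≤ (a + Ca + 1) * (1 + B i) := by
        have := mul_nonneg pCa hBi
        linarith
      exact e2.trans (by gcongr)
    calc r ^ 2 * E i ≤ D * (M * (U i + Ub + B i) + r ^ 2 * U i ^ 2) := hE i
      _ ≤ D * (M * ((a + Ca + 1) * (1 + B i) ^ 2) + a ^ 2 * (1 + B i) ^ 2) := by gcongr
      _ = C4 * (1 + B i) ^ 2 := by rw [hC4]; ring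
      _ ≤ _ := by gcongr; linarith

/-! ### Errors of the cluster coefficients β + b_i -/

section Deviation

variable {p : ℕ} {d : Design p} {F : ExpFamily} {β : Fin p → ℝ}
  {b : ℕ → EuclideanSpace ℝ (Fin p)} {Ω : Type*}
  {y : ℕ → ℕ → ℕ → Ω → ℝ} {c₀ c₁ C₁ C₂ : ℝ} {t : ℕ}

variable (d β b) in
/-- The error of `θ` for the coefficients `β + b_i` of cluster `i`. -/
def dev (θ : Param p (d.m t)) (i : Fin (d.m t)) : Fin p → ℝ :=
  θ.fixed + θ.random i - (β + (b i).ofLp)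

variable (d b) in
/-- The centred true random effects. -/
def centred (t : ℕ) (i : ℕ) : Fin p → ℝ := (b i).ofLp - (bbar d b t).ofLp

variable (d β b) in
/-- The average of the errors over the clusters. -/
def devMean (θ : Param p (d.m t)) : Fin p → ℝ := (d.m t : ℝ)⁻¹ • ∑ i, dev d β b θ i

theorem eta_eq (θ : Param p (d.m t)) (i : Fin (d.m t)) (j : ℕ) :
    eta d θ i j = d.x t i j ⬝ᵥ (θ.fixed + θ.random i) := by
  rw [eta, dotProduct_add]

theorem etaTrue_eq (t i j : ℕ) :
    etaTrue d β b t i j = d.x t i j ⬝ᵥ (β + (b i).ofLp) := by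
  rw [etaTrue, dotProduct_add]

/-- As the estimated random effects sum to zero, averaging over clusters isolates the fixed effects;
the mean of the true effects survives, which is why the centre must be the recentred truth. -/
theorem devMean_eq (hm : 0 < d.m t) {θ : Param p (d.m t)} (hθ : ∑ i, θ.random i = 0) :
    devMean d β b θ = θ.fixed - β - (bbar d b t).ofLp := by
  have hm0 : (d.m t : ℝ) ≠ 0 := by exact_mod_cast hm.ne'
  have e : ∑ i, dev d β b θ i =
      (d.m t : ℝ) • θ.fixed - (d.m t : ℝ) • β - ∑ i : Fin (d.m t), (b i).ofLp := by
    simp only [dev, Finset.sum_sub_distrib, Finset.sum_add_distrib, hθ]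
    simp [← Nat.cast_smul_eq_nsmul ℝ]
    abel
  rw [devMean, e, smul_sub, smul_sub, inv_smul_smul₀ hm0, inv_smul_smul₀ hm0, bbar]
  simp

/-- Expresses the argument of the penalty through the errors that are being bounded, closing the
system of inequalities. -/
theorem random_eq (hm : 0 < d.m t) {θ : Param p (d.m t)} (hθ : ∑ i, θ.random i = 0)
    (i : Fin (d.m t)) : θ.random i = dev d β b θ i - devMean d β b θ + centred d b t i := by
  rw [devMean_eq hm hθ, dev, centred]
  abel

theorem sub_target_fixed (hm : 0 < d.m t) {θ : Param p (d.m t)} (hθ : ∑ i, θ.random i = 0)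
    (k : Fin p) : (θ - target d β b t) (k, none) = devMean d β b θ k := by
  rw [devMean_eq hm hθ]
  simp [target, thetaTrue, oneStar, Param.fixed]
  ring

theorem sub_target_random (hm : 0 < d.m t) {θ : Param p (d.m t)} (hθ : ∑ i, θ.random i = 0)
    (k : Fin p) (i : Fin (d.m t)) :
    (θ - target d β b t) (k, some i) = dev d β b θ i k - devMean d β b θ k := by
  have := congrFun (random_eq (β := β) (b := b) hm hθ i) k
  simp only [Pi.add_apply, Pi.sub_apply, Param.random, centred] at this
  simp only [target, thetaTrue, oneStar, Pi.sub_apply, this]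
  ring

theorem norm_devMean_le (θ : Param p (d.m t)) :
    ‖devMean d β b θ‖ ≤ (d.m t : ℝ)⁻¹ * ∑ i, ‖dev d β b θ i‖ := by
  rw [devMean, norm_smul, Real.norm_eq_abs, abs_of_nonneg (by positivity)]
  gcongr
  exact norm_sum_le _ _

theorem StageBounds.norm_dev_le (h : StageBounds d F β b c₁ C₁ C₂ t) (hF : CurvatureBounds F c₀)
    {ω : Ω} {G : Matrix (Fin p) (Fin p) ℝ} (hG : G.PosDef) {ψ : ℝ} (hψ : 0 < ψ)
    {θ : Param p (d.m t)} (hθ : IsPQLEstimate d F (fun i j => y t i j ω) G ψ θ)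
    (i : Fin (d.m t)) :
    c₀ * (c₀ * F.φ * c₁) * d.n t i * ‖dev d β b θ i‖ ≤
      p * (‖score d F β b y t i ω‖ + ‖ψ • (G⁻¹ *ᵥ θ.random i)‖) := by
  have hs := hθ.score_eq hF hG hψ i
  simp only [eta_eq] at hs
  have hφ := F.φ_pos
  have hc := hF.pos
  have hc1 := h.c_pos
  have key := hF.norm_sub_le_of_score_eq (γ := β + (b i).ofLp)
    (κ := c₀ * F.φ * c₁ * d.n t i) (by positivity)
    (fun j => by rw [← etaTrue_eq]; exact h.dom i i.2 j j.2)
    (fun j => by rw [← eta_eq]; exact hθ.1 i j) (h.mul_dotProduct_self_le hF i) hs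
  simp only [← etaTrue_eq] at key
  calc _ = c₀ * (c₀ * F.φ * c₁ * d.n t i) * ‖dev d β b θ i‖ := by ring
    _ ≤ _ := key

theorem StageBounds.norm_dev_sub_lead_le (h : StageBounds d F β b c₁ C₁ C₂ t)
    (hF : CurvatureBounds F c₀)
    {ω : Ω} {G : Matrix (Fin p) (Fin p) ℝ} (hG : G.PosDef) {ψ : ℝ} (hψ : 0 < ψ)
    {θ : Param p (d.m t)} (hθ : IsPQLEstimate d F (fun i j => y t i j ω) G ψ θ)
    (i : Fin (d.m t)) :
    ‖dev d β b θ i - lead d F β b y t i ω‖ ≤ (d.n t i : ℝ)⁻¹ * (F.φ⁻¹ * (p * c₁⁻¹)) *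
      (‖ψ • (G⁻¹ *ᵥ θ.random i)‖ +
        d.n t i * (C₁ * (c₀⁻¹ * (p * (C₁ * ‖dev d β b θ i‖)) ^ 2))) := by
  have hs := hθ.score_eq hF hG hψ i
  simp only [eta_eq] at hs
  have hφ := F.φ_pos
  have hc1 := h.c_pos
  have key := hF.norm_score_expansion_le (γ := β + (b i).ofLp) h.C_nonneg
    (fun j => h.x_le i i.2 j j.2)
    (fun j => by rw [← etaTrue_eq]; exact h.dom i i.2 j j.2)
    (fun j => by rw [← eta_eq]; exact hθ.1 i j) hs
  simp only [← etaTrue_eq] at key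
  -- Since H_i inverts the information matrix, the difference is H_i applied to the error of the
  -- linearised score equation.
  have e : dev d β b θ i - lead d F β b y t i ω = ((d.n t i : ℝ) * F.φ)⁻¹ • (H d F β b t i *ᵥ
      (∑ j : Fin (d.n t i), (iteratedDeriv 2 F.a (etaTrue d β b t i j) *
        (d.x t i j ⬝ᵥ dev d β b θ i)) • d.x t i j - score d F β b y t i ω)) := by
    rw [mulVec_sub, smul_sub, ← mulVec_smul, ← info_mulVec, h.H_mulVec_info, lead]
  rw [e]
  refine (h.norm_inv_smul_H_mulVec_le i _).trans ?_
  gcongr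
  exact key

/-- The constant is chosen before the stage, the outcome, the working parameters and the estimate.
All randomness thus enters through the bound `M` on the operator φ̂ Ĝ⁻¹ and on the scores. -/
theorem exists_estimate_const (hF : CurvatureBounds F c₀) (hc₁ : 0 < c₁) (hC₁ : 0 ≤ C₁)
    {M Cb : ℝ} (hM : 0 ≤ M) (hCb : 0 ≤ Cb) : ∃ C, 0 ≤ C ∧ ∀ t, StageBounds d F β b c₁ C₁ C₂ t →
      4 * (p * M) ≤ c₀ * (c₀ * F.φ * c₁) * d.nL t →
      ∑ i : Fin (d.m t), ‖centred d b t i‖ ≤ Cb * d.m t →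
      ∀ (ω : Ω) (G : Matrix (Fin p) (Fin p) ℝ) (ψ : ℝ) (θ : Param p (d.m t)), G.PosDef → 0 < ψ →
      IsPQLEstimate d F (fun i j => y t i j ω) G ψ θ →
      (∀ v : Fin p → ℝ, ‖ψ • (G⁻¹ *ᵥ v)‖ ≤ M * ‖v‖) →
      ∑ i : Fin (d.m t), ‖score d F β b y t i ω‖ ^ 2 ≤ M * (d.m t * d.nL t) →
      (∀ i, d.nL t * ‖dev d β b θ i‖ ≤
        C * (‖score d F β b y t i ω‖ + 1 + ‖centred d b t i‖)) ∧
      d.nL t * ∑ i, ‖dev d β b θ i - lead d F β b y t i ω‖ ≤ C * d.m t ∧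
      ∀ i : Fin (d.m t), ‖score d F β b y t i ω‖ ^ 2 ≤ M * d.nL t →
        d.nL t * ‖dev d β b θ i - lead d F β b y t i ω‖ ≤ C * (1 + ‖centred d b t i‖) ^ 2 := by
  have hφ := F.φ_pos
  have hc := hF.pos
  obtain ⟨D₁, hD₁⟩ : ∃ D₁, D₁ = F.φ⁻¹ * (p * c₁⁻¹) := ⟨_, rfl⟩
  obtain ⟨D₂, hD₂⟩ : ∃ D₂, D₂ = C₁ * (c₀⁻¹ * (p * C₁) ^ 2) := ⟨_, rfl⟩
  have pD₁ : 0 ≤ D₁ := by rw [hD₁]; positivity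
  have pD₂ : 0 ≤ D₂ := by rw [hD₂]; positivity
  obtain ⟨C, hC0, hC⟩ := exists_cluster_error_const (q := p) (k := c₀ * (c₀ * F.φ * c₁)) (M := M)
    (Cb := Cb) (D := D₁ * (1 + D₂)) (by positivity) (by positivity) hM hCb (by positivity)
  refine ⟨C, hC0, ?_⟩
  intro t h hqM hcen ω G ψ θ hG hψ hθ hΛ hS
  have hnL := h.nL_pos
  have hr2 : Real.sqrt (d.nL t) ^ 2 = d.nL t := Real.sq_sqrt hnL.le
  have hsum := hθ.sum_random hF hG
  set Ub := (d.m t : ℝ)⁻¹ * ∑ i, ‖dev d β b θ i‖ with hUb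
  have hrand : ∀ i, ‖ψ • (G⁻¹ *ᵥ θ.random i)‖ ≤
      M * (‖dev d β b θ i‖ + Ub + ‖centred d b t i‖) := by
    intro i
    refine (hΛ _).trans ?_
    gcongr
    rw [random_eq (β := β) (b := b) h.one_le_m hsum i]
    refine (norm_add_le _ _).trans ?_
    gcongr
    refine (norm_sub_le _ _).trans ?_
    gcongr
    exact norm_devMean_le θ
  have key := hC (d.m t) (Real.sqrt (d.nL t)) Ub (fun i => ‖dev d β b θ i‖)
    (fun i => ‖score d F β b y t i ω‖) (fun i => ‖centred d b t i‖)
    (fun i => ‖dev d β b θ i - lead d F β b y t i ω‖) h.one_le_m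
    (Real.one_le_sqrt.2 h.one_le_nL) (by rw [hr2]; exact_mod_cast h.m_le) (by rw [hr2]; exact hqM)
    (fun _ => norm_nonneg _) (fun _ => norm_nonneg _) (fun _ => norm_nonneg _)
    (by rw [hUb, mul_inv_cancel_left₀ h.m_pos.ne']) ?_ (by rw [hr2]; exact hS) hcen ?_
  · rw [hr2] at key
    exact key
  · intro i
    rw [hr2]
    refine le_trans ?_ ((h.norm_dev_le hF hG hψ hθ i).trans ?_)
    · gcongr
      exact h.nL_le i i.2
    · gcongr
      exact hrand i
  · intro i
    rw [hr2]
    have hn := h.n_pos i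
    set U := ‖dev d β b θ i‖
    set l := M * (U + Ub + ‖centred d b t i‖)
    have hl : 0 ≤ l := (norm_nonneg _).trans (hrand i)
    have h1 : ‖dev d β b θ i - lead d F β b y t i ω‖ ≤
        (d.n t i : ℝ)⁻¹ * D₁ * (l + d.n t i * (D₂ * U ^ 2)) := by
      refine (h.norm_dev_sub_lead_le hF hG hψ hθ i).trans ?_
      rw [← hD₁]
      have e : C₁ * (c₀⁻¹ * (p * (C₁ * U)) ^ 2) = D₂ * U ^ 2 := by rw [hD₂]; ring
      rw [e]
      gcongr
      exact hrand i
    calc (d.nL t : ℝ) * ‖dev d β b θ i - lead d F β b y t i ω‖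
        ≤ d.nL t * ((d.n t i : ℝ)⁻¹ * D₁ * (l + d.n t i * (D₂ * U ^ 2))) := by gcongr
      _ = D₁ * (d.nL t / d.n t i * l + d.nL t * (D₂ * U ^ 2)) := by field_simp
      _ ≤ D₁ * (1 * l + d.nL t * (D₂ * U ^ 2)) := by
          gcongr
          rw [div_le_one hn]
          exact h.nL_le_cast i
      _ ≤ D₁ * (1 + D₂) * (l + d.nL t * U ^ 2) := by
          rw [mul_assoc]
          gcongr
          have q1 : 0 ≤ D₂ * l := mul_nonneg pD₂ hl
          have q2 : 0 ≤ (d.nL t : ℝ) * U ^ 2 := by positivity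
          nlinarith

end Deviation

/-! ### Boundedness in probability -/

section InProb

variable {Ω : Type*} [MeasurableSpace Ω] {P : Measure Ω}

/-- Markov's inequality. -/
theorem boundedInProb_of_integral_le [IsProbabilityMeasure P] {Z : ℕ → Ω → ℝ} (C : ℝ)
    (h0 : ∀ t ω, 0 ≤ Z t ω) (h : ∀ᶠ t in atTop, Integrable (Z t) P ∧ ∫ ω, Z t ω ∂P ≤ C) :
    BoundedInProb P Z := by
  intro ε hε
  set M := (|C| + 1) / ε with hM
  have hM0 : 0 < M := by positivity
  refine ⟨M, ?_⟩
  filter_upwards [h] with t ht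
  have h1 := mul_meas_ge_le_integral_of_nonneg (ae_of_all _ (h0 t)) ht.1 M
  have h2 : P.real {ω | M ≤ Z t ω} ≤ ε := by
    refine le_of_mul_le_mul_left (h1.trans (ht.2.trans ?_)) hM0
    rw [hM, div_mul_cancel₀ _ hε.ne']
    linarith [le_abs_self C]
  calc P {ω | M < |Z t ω|} ≤ P {ω | M ≤ Z t ω} := by
        refine measure_mono fun ω hω => ?_
        have : M < |Z t ω| := hω
        rw [abs_of_nonneg (h0 t ω)] at this
        exact this.le
    _ = ENNReal.ofReal (P.real {ω | M ≤ Z t ω}) := by simp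
    _ ≤ ENNReal.ofReal ε := ENNReal.ofReal_le_ofReal h2

/-- Outside an event of small probability finitely many O_p(1) quantities share one bound M, so a
deterministic estimate for each fixed M suffices. -/
theorem tendstoInMeasure_of_boundedInProb {α : Type*} [Finite α] {Z : α → ℕ → Ω → ℝ}
    (hZ : ∀ a, BoundedInProb P (Z a)) {good : ℕ → Set Ω}
    (hgood : Tendsto (fun t => P (good t)ᶜ) atTop (𝓝 0)) {R : ℕ → Ω → ℝ}
    (h : ∀ M, 0 ≤ M → ∀ δ > 0, ∀ᶠ t in atTop, ∀ ω ∈ good t, (∀ a, |Z a t ω| ≤ M) → |R t ω| < δ) :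
    TendstoInMeasure P R atTop fun _ => 0 := by
  have := Fintype.ofFinite α
  rw [tendstoInMeasure_iff_norm]
  intro δ hδ
  rw [ENNReal.tendsto_nhds_zero]
  intro ε hε
  by_cases htop : ε = ⊤
  · simp [htop]
  obtain ⟨r, hr0, hr⟩ : ∃ r : ℝ, 0 < r ∧ ENNReal.ofReal r = ε :=
    ⟨ε.toReal, ENNReal.toReal_pos hε.ne' htop, ENNReal.ofReal_toReal htop⟩
  -- One share of the probability for each quantity, and one for the complement of `good`.
  set r' := r / (Fintype.card α + 1) with hr'
  have hr'0 : 0 < r' := by positivity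
  choose M hM using fun a => hZ a r' hr'0
  set M' := ∑ a, |M a| with hM'
  have hle : ∀ a, M a ≤ M' := fun a => (le_abs_self _).trans
    (Finset.single_le_sum (f := fun a => |M a|) (fun _ _ => abs_nonneg _) (Finset.mem_univ a))
  have hg : ∀ᶠ t in atTop, P (good t)ᶜ ≤ ENNReal.ofReal r' :=
    (ENNReal.tendsto_nhds_zero.1 hgood) _ (by simpa using hr'0)
  filter_upwards [h M' (Finset.sum_nonneg fun _ _ => abs_nonneg _) δ hδ, hg,
    eventually_all.2 hM] with t t1 t2 t3
  calc P {x | δ ≤ ‖R t x - 0‖} ≤ P ((good t)ᶜ ∪ ⋃ a, {ω | M a < |Z a t ω|}) := by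
        refine measure_mono fun ω hω => ?_
        by_contra hcon
        simp only [Set.mem_union, Set.mem_compl_iff, Set.mem_iUnion, not_or, not_not,
          not_exists] at hcon
        have hω' : δ ≤ ‖R t ω - 0‖ := hω
        rw [sub_zero, Real.norm_eq_abs] at hω'
        exact absurd (t1 ω hcon.1 fun a => (not_lt.1 (hcon.2 a)).trans (hle a)) (not_lt.2 hω')
    _ ≤ P (good t)ᶜ + ∑ a, P {ω | M a < |Z a t ω|} :=
        (measure_union_le _ _).trans (add_le_add le_rfl (measure_iUnion_fintype_le _ _))
    _ ≤ ENNReal.ofReal r' + ∑ _a : α, ENNReal.ofReal r' :=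
        add_le_add t2 (Finset.sum_le_sum fun a _ => t3 a)
    _ = ENNReal.ofReal r := by
        rw [Finset.sum_const, Finset.card_univ, nsmul_eq_mul, ← ENNReal.ofReal_natCast,
          ← ENNReal.ofReal_mul (by positivity), ← ENNReal.ofReal_add hr'0.le (by positivity)]
        congr 1
        rw [hr']
        field_simp
        ring
    _ = ε := hr

end InProb

/-! ### Error bounds on events of high probability -/

section Estimate

variable {p : ℕ} {d : Design p} {F : ExpFamily} {β : Fin p → ℝ}
  {b : ℕ → EuclideanSpace ℝ (Fin p)} {Ω : Type*} {y : ℕ → ℕ → ℕ → Ω → ℝ} {c₀ c₁ C₁ C₂ : ℝ}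

theorem norm_ofLp_le (v : EuclideanSpace ℝ (Fin p)) : ‖v.ofLp‖ ≤ ‖v‖ :=
  (pi_norm_le_iff_of_nonneg (norm_nonneg _)).2 fun k => PiLp.norm_apply_le v k

theorem norm_bbar_le {Cb : ℝ} (hCb : ∀ M : ℕ, ∑ i ∈ Finset.range M, ‖b i‖ ≤ Cb * M) {t : ℕ}
    (hm : 0 < d.m t) : ‖(bbar d b t).ofLp‖ ≤ Cb := by
  have hm0 : (0 : ℝ) < d.m t := by exact_mod_cast hm
  refine (norm_ofLp_le _).trans ?_
  rw [bbar, norm_smul, Real.norm_eq_abs, abs_of_pos (inv_pos.2 hm0), inv_mul_le_iff₀ hm0]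
  refine (norm_sum_le _ _).trans ?_
  have := hCb (d.m t)
  rw [Finset.sum_range] at this
  linarith

theorem norm_centred_le {Cb : ℝ} (hCb : ∀ M : ℕ, ∑ i ∈ Finset.range M, ‖b i‖ ≤ Cb * M) {t : ℕ}
    (hm : 0 < d.m t) (i : ℕ) : ‖centred d b t i‖ ≤ ‖b i‖ + Cb :=
  (norm_sub_le _ _).trans (add_le_add (norm_ofLp_le _) (norm_bbar_le hCb hm))

theorem sum_norm_centred_le {Cb : ℝ} (hCb : ∀ M : ℕ, ∑ i ∈ Finset.range M, ‖b i‖ ≤ Cb * M)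
    {t : ℕ} (hm : 0 < d.m t) : ∑ i : Fin (d.m t), ‖centred d b t i‖ ≤ 2 * Cb * d.m t := by
  calc _ ≤ ∑ i : Fin (d.m t), (‖b i‖ + Cb) :=
        Finset.sum_le_sum fun i _ => norm_centred_le hCb hm i
    _ = ∑ i ∈ Finset.range (d.m t), ‖b i‖ + d.m t * Cb := by
        rw [Finset.sum_add_distrib, Finset.sum_range]; simp
    _ ≤ _ := by linarith [hCb (d.m t)]

variable (d F β b y) in
/-- The bounds on the errors of an estimate `θ` at stage `t`, linearised at the clusters
`i < m₀`. -/
structure ErrorBounds (m₀ : ℕ) (C : ℝ) (t : ℕ) (ω : Ω) (θ : Param p (d.m t)) : Prop where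
  sum_random : ∑ i, θ.random i = 0
  dev_le : ∀ i, d.nL t * ‖dev d β b θ i‖ ≤
    C * (‖score d F β b y t i ω‖ + 1 + ‖centred d b t i‖)
  sum_dev_sub_lead_le : d.nL t * ∑ i, ‖dev d β b θ i - lead d F β b y t i ω‖ ≤ C * d.m t
  dev_sub_lead_le : ∀ i : Fin (d.m t), (i : ℕ) < m₀ →
    d.nL t * ‖dev d β b θ i - lead d F β b y t i ω‖ ≤ C * (1 + ‖centred d b t i‖) ^ 2
  sum_score_sq_le : ∑ i : Fin (d.m t), ‖score d F β b y t i ω‖ ^ 2 ≤ C * (d.m t * d.nL t)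
  leadMean_sq_le : (d.m t * d.nL t) * ‖leadMean d F β b y t ω‖ ^ 2 ≤ C

variable [MeasurableSpace Ω] {P : Measure Ω} [IsProbabilityMeasure P]

theorem boundedInProb_sum_score (hF : CurvatureBounds F c₀) (hy : ResponseModel d F β b P y)
    (hst : ∀ᶠ t in atTop, StageBounds d F β b c₁ C₁ C₂ t) :
    BoundedInProb P fun t ω => ((d.m t : ℝ) * d.nL t)⁻¹ *
      ∑ i : Fin (d.m t), score d F β b y t i ω ⬝ᵥ score d F β b y t i ω := by
  have hφ := F.φ_pos
  have hc := hF.pos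
  refine boundedInProb_of_integral_le (p * (F.φ * c₀⁻¹ * (p * C₁) ^ 2 * C₂)) (fun t ω => ?_) ?_
  · exact mul_nonneg (by positivity) (Finset.sum_nonneg fun i _ =>
      (sq_nonneg _).trans (norm_sq_le_dotProduct_self _))
  filter_upwards [hst] with t h
  have hm := h.m_pos
  have hn := h.nL_pos
  refine ⟨(integrable_finsetSum _ fun i _ => (h.integral_score_sq hF hy i).1).const_mul _, ?_⟩
  rw [integral_const_mul, integral_finsetSum _ fun i _ => (h.integral_score_sq hF hy i).1,
    inv_mul_le_iff₀ (by positivity)]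
  calc _ ≤ ∑ i : Fin (d.m t), p * (F.φ * c₀⁻¹ * (p * C₁) ^ 2 * d.n t i) :=
        Finset.sum_le_sum fun i _ => (h.integral_score_sq hF hy i).2
    _ = p * (F.φ * c₀⁻¹ * (p * C₁) ^ 2) * d.N t := by
        rw [Design.N, Nat.cast_sum, Finset.mul_sum]
        exact Finset.sum_congr rfl fun i _ => by ring
    _ ≤ p * (F.φ * c₀⁻¹ * (p * C₁) ^ 2) * (C₂ * (d.m t * d.nL t)) := by
        gcongr
        exact h.N_le
    _ = _ := by ring

/-- For a fixed cluster the squared score is of order n_L. Over all clusters at once only the sum of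
the squares is used, so the sharper individual linearisation is confined to fixed clusters. -/
theorem boundedInProb_score (hF : CurvatureBounds F c₀) (hy : ResponseModel d F β b P y)
    (hm : Tendsto d.m atTop atTop) (hst : ∀ᶠ t in atTop, StageBounds d F β b c₁ C₁ C₂ t) (i : ℕ) :
    BoundedInProb P fun t ω => (d.nL t : ℝ)⁻¹ *
      (score d F β b y t i ω ⬝ᵥ score d F β b y t i ω) := by
  have hφ := F.φ_pos
  have hc := hF.pos
  refine boundedInProb_of_integral_le (p * (F.φ * c₀⁻¹ * (p * C₁) ^ 2 * C₂)) (fun t ω => ?_) ?_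
  · exact mul_nonneg (by positivity) ((sq_nonneg _).trans (norm_sq_le_dotProduct_self _))
  filter_upwards [hst, hm.eventually_gt_atTop i] with t h hi
  have hn := h.nL_pos
  obtain ⟨h1, h2⟩ := h.integral_score_sq hF hy ⟨i, hi⟩
  refine ⟨h1.const_mul _, ?_⟩
  rw [integral_const_mul, inv_mul_le_iff₀ hn]
  calc _ ≤ p * (F.φ * c₀⁻¹ * (p * C₁) ^ 2 * d.n t i) := h2
    _ ≤ p * (F.φ * c₀⁻¹ * (p * C₁) ^ 2 * (C₂ * d.nL t)) := by
        gcongr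
        exact h.size_le i hi
    _ = _ := by ring

theorem boundedInProb_leadMean (hF : CurvatureBounds F c₀) (hy : ResponseModel d F β b P y)
    (hst : ∀ᶠ t in atTop, StageBounds d F β b c₁ C₁ C₂ t) :
    BoundedInProb P fun t ω => ((d.m t : ℝ) * d.nL t) *
      (leadMean d F β b y t ω ⬝ᵥ leadMean d F β b y t ω) := by
  refine boundedInProb_of_integral_le
    (p * (F.φ * c₀⁻¹ * (p * C₁) ^ 2 * (F.φ⁻¹ * (p * c₁⁻¹)) ^ 2)) (fun t ω => ?_) ?_
  · exact mul_nonneg (by positivity) ((sq_nonneg _).trans (norm_sq_le_dotProduct_self _))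
  filter_upwards [hst] with t h
  obtain ⟨h1, h2⟩ := h.integral_leadMean_sq hF hy
  refine ⟨h1.const_mul _, ?_⟩
  rw [integral_const_mul]
  exact h2

/-- A quantity that is small whenever the error bounds hold with a fixed constant tends to zero in
probability. -/
theorem tendstoInMeasure_of_errorBounds (hreg : d.Regime) (hF : CurvatureBounds F c₀)
    (h3 : Cond3 d F β b) (hst : ∀ᶠ t in atTop, StageBounds d F β b c₁ C₁ C₂ t)
    (hy : ResponseModel d F β b P y)
    {Ghat : ℕ → Ω → Matrix (Fin p) (Fin p) ℝ} {φhat : ℕ → Ω → ℝ} (h4 : Cond4 P Ghat φhat)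
    {θhat : ∀ t, Ω → Param p (d.m t)}
    (hθ : Tendsto (fun t => P {ω | ¬ IsPQLEstimate d F (fun i j => y t i j ω)
        (Ghat t ω) (φhat t ω) (θhat t ω)}) atTop (𝓝 0)) (m₀ : ℕ) {R : ℕ → Ω → ℝ}
    (hR : ∀ C, 0 ≤ C → ∀ δ > 0, ∀ᶠ t in atTop, ∀ ω,
      ErrorBounds d F β b y m₀ C t ω (θhat t ω) → |R t ω| < δ) :
    TendstoInMeasure P R atTop fun _ => 0 := by
  obtain ⟨Cb, hCb⟩ := h3.effects
  have hCb0 : 0 ≤ Cb := by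
    have := hCb 1
    simp only [Finset.sum_range_one, Nat.cast_one, mul_one] at this
    exact (norm_nonneg _).trans this
  obtain ⟨t₀, ht₀⟩ := hst.exists
  have hc₁ := ht₀.c_pos
  have hC₁ := ht₀.C_nonneg
  have hφ := F.φ_pos
  have hc := hF.pos
  -- The finite family to be bounded: the entries of Ĝ⁻¹, the scaled squared scores of the clusters
  -- below `m₀`, then φ̂, the scaled sum of all squared scores, and the scaled square of the average
  -- leading term.
  set Z : ((Fin p × Fin p) ⊕ Fin m₀) ⊕ Fin 3 → ℕ → Ω → ℝ := Sum.elim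
    (Sum.elim (fun kl t ω => (Ghat t ω)⁻¹ kl.1 kl.2) (fun i t ω => (d.nL t : ℝ)⁻¹ *
      (score d F β b y t i ω ⬝ᵥ score d F β b y t i ω)))
    ![φhat, fun t ω => ((d.m t : ℝ) * d.nL t)⁻¹ *
      ∑ i : Fin (d.m t), score d F β b y t i ω ⬝ᵥ score d F β b y t i ω,
      fun t ω => ((d.m t : ℝ) * d.nL t) *
      (leadMean d F β b y t ω ⬝ᵥ leadMean d F β b y t ω)] with hZdef
  have hZ : ∀ a, BoundedInProb P (Z a) := by
    rintro ((kl | i) | a)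
    · exact h4.inv_bounded kl.1 kl.2
    · exact boundedInProb_score hF hy hreg.m_tendsto hst i
    · fin_cases a
      · exact h4.bounded
      · exact boundedInProb_sum_score hF hy hst
      · exact boundedInProb_leadMean hF hy hst
  refine tendstoInMeasure_of_boundedInProb hZ (good := fun t => {ω | IsPQLEstimate d F
    (fun i j => y t i j ω) (Ghat t ω) (φhat t ω) (θhat t ω)})
    (by simpa [Set.compl_ofPred] using hθ) ?_
  intro M hM δ hδ
  -- The single constant M + pM² serves both purposes: pM² bounds the operator φ̂ Ĝ⁻¹ in the maximum
  -- norm, and M bounds the scores.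
  obtain ⟨C, hC0, hC⟩ := exists_estimate_const (d := d) (β := β) (b := b) (y := y) (C₂ := C₂)
    hF hc₁ hC₁ (M := M + p * M * M) (Cb := 2 * Cb) (by positivity) (by positivity)
  have hbig : ∀ᶠ t in atTop, 4 * (p * (M + p * M * M)) ≤ c₀ * (c₀ * F.φ * c₁) * d.nL t := by
    have h1 : Tendsto (fun t => (d.nL t : ℝ)) atTop atTop :=
      tendsto_natCast_atTop_atTop.comp hreg.nL_tendsto
    exact (h1.const_mul_atTop (by positivity)).eventually_ge_atTop _
  filter_upwards [hst, hbig, hR (C + (M + p * M * M)) (by positivity) δ hδ] with t h hb hRt ω hω hZM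
  apply hRt
  have hm := h.m_pos
  have hn := h.nL_pos
  have hψ : |φhat t ω| ≤ M := hZM (Sum.inr 0)
  have hG : ∀ k l, |(Ghat t ω)⁻¹ k l| ≤ M := fun k l => hZM (Sum.inl (Sum.inl (k, l)))
  have hMle : M ≤ M + p * M * M := le_add_of_nonneg_right (by positivity)
  have hΛ : ∀ v : Fin p → ℝ, ‖φhat t ω • ((Ghat t ω)⁻¹ *ᵥ v)‖ ≤ (M + p * M * M) * ‖v‖ := by
    intro v
    rw [norm_smul, Real.norm_eq_abs]
    have := norm_mulVec_le hM hG v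
    calc _ ≤ M * (p * M * ‖v‖) := by gcongr
      _ = (p * M * M) * ‖v‖ := by ring
      _ ≤ _ := by gcongr; linarith
  have hS : ∑ i : Fin (d.m t), ‖score d F β b y t i ω‖ ^ 2 ≤
      (M + p * M * M) * (d.m t * d.nL t) := by
    have h1 := (le_abs_self _).trans (hZM (Sum.inr 1))
    change ((d.m t : ℝ) * d.nL t)⁻¹ * ∑ i : Fin (d.m t), score d F β b y t i ω ⬝ᵥ
      score d F β b y t i ω ≤ M at h1
    rw [inv_mul_le_iff₀ (by positivity)] at h1
    calc _ ≤ ∑ i : Fin (d.m t), score d F β b y t i ω ⬝ᵥ score d F β b y t i ω :=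
          Finset.sum_le_sum fun i _ => norm_sq_le_dotProduct_self _
      _ ≤ d.m t * d.nL t * M := h1
      _ = M * (d.m t * d.nL t) := mul_comm _ _
      _ ≤ _ := by gcongr
  have hSi : ∀ i : Fin (d.m t), (i : ℕ) < m₀ →
      ‖score d F β b y t i ω‖ ^ 2 ≤ (M + p * M * M) * d.nL t := by
    intro i hi
    have h1 := (le_abs_self _).trans (hZM (Sum.inl (Sum.inr ⟨i, hi⟩)))
    change (d.nL t : ℝ)⁻¹ * (score d F β b y t i ω ⬝ᵥ score d F β b y t i ω) ≤ M at h1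
    rw [inv_mul_le_iff₀ hn] at h1
    calc _ ≤ d.nL t * M := (norm_sq_le_dotProduct_self _).trans h1
      _ = M * d.nL t := mul_comm _ _
      _ ≤ _ := by gcongr
  have hlead : (d.m t * d.nL t) * ‖leadMean d F β b y t ω‖ ^ 2 ≤ M := by
    have h1 := (le_abs_self _).trans (hZM (Sum.inr 2))
    refine le_trans ?_ h1
    change _ ≤ ((d.m t : ℝ) * d.nL t) * (leadMean d F β b y t ω ⬝ᵥ leadMean d F β b y t ω)
    gcongr
    exact norm_sq_le_dotProduct_self _
  have hsum := IsPQLEstimate.sum_random hF (h4.posDef t ω) hω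
  obtain ⟨k1, k2, k3⟩ := hC t h hb (sum_norm_centred_le hCb h.one_le_m) ω (Ghat t ω) (φhat t ω)
    (θhat t ω) (h4.posDef t ω) (h4.pos t ω) hω hΛ hS
  have hCle : C ≤ C + (M + p * M * M) := le_add_of_nonneg_right (by positivity)
  refine ⟨hsum, fun i => (k1 i).trans ?_, k2.trans ?_, fun i hi => (k3 i (hSi i hi)).trans ?_,
    hS.trans ?_, hlead.trans ?_⟩
  · gcongr
  · gcongr
  · gcongr
  · exact mul_le_mul_of_nonneg_right (by linarith) (by positivity)
  · linarith [show 0 ≤ p * M * M by positivity]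

end Estimate

/-! ### Consistency and size of the remainders -/

section Consistency

variable {p : ℕ} {d : Design p} {F : ExpFamily} {β : Fin p → ℝ}
  {b : ℕ → EuclideanSpace ℝ (Fin p)} {Ω : Type*} {y : ℕ → ℕ → ℕ → Ω → ℝ} {c₀ c₁ C₁ C₂ : ℝ}
  {m₀ : ℕ} {C : ℝ} {t : ℕ} {ω : Ω} {θ : Param p (d.m t)}

/-- A uniform bound over a growing number of clusters is obtained by dominating one summand by the
whole sum, both for squared scores and for centred effects. The loss is compensated by m/n_L → 0. -/
theorem ErrorBounds.norm_sub_target_le (e : ErrorBounds d F β b y m₀ C t ω θ)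
    (h : StageBounds d F β b c₁ C₁ C₂ t) (hC : 0 ≤ C) {Cb : ℝ}
    (hcen : ∑ i : Fin (d.m t), ‖centred d b t i‖ ≤ Cb * d.m t) :
    ‖θ - target d β b t‖ ≤ 2 * (C * (Real.sqrt (C * ((d.m t : ℝ) / d.nL t)) + (d.nL t : ℝ)⁻¹ +
      Cb * ((d.m t : ℝ) / d.nL t))) := by
  have hm := h.m_pos
  have hn := h.nL_pos
  obtain ⟨ρ, hρ⟩ : ∃ ρ, ρ = C * (Real.sqrt (C * ((d.m t : ℝ) / d.nL t)) + (d.nL t : ℝ)⁻¹ +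
      Cb * ((d.m t : ℝ) / d.nL t)) := ⟨_, rfl⟩
  rw [← hρ]
  have hdev : ∀ i, ‖dev d β b θ i‖ ≤ ρ := by
    intro i
    have h1 : ‖score d F β b y t i ω‖ ≤ Real.sqrt (C * (d.m t * d.nL t)) := by
      refine Real.le_sqrt_of_sq_le (le_trans ?_ e.sum_score_sq_le)
      exact Finset.single_le_sum (f := fun i : Fin (d.m t) => ‖score d F β b y t i ω‖ ^ 2)
        (fun _ _ => sq_nonneg _) (Finset.mem_univ i)
    have h2 : ‖centred d b t i‖ ≤ Cb * d.m t := le_trans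
      (Finset.single_le_sum (f := fun i : Fin (d.m t) => ‖centred d b t i‖)
        (fun _ _ => norm_nonneg _) (Finset.mem_univ i)) hcen
    have h3 : Real.sqrt (C * (d.m t * d.nL t)) =
        d.nL t * Real.sqrt (C * ((d.m t : ℝ) / d.nL t)) := by
      rw [← Real.sqrt_sq hn.le, ← Real.sqrt_mul (sq_nonneg _), Real.sqrt_sq hn.le]
      congr 1
      field_simp
    refine le_of_mul_le_mul_left ((e.dev_le i).trans ?_) hn
    calc _ ≤ C * (d.nL t * Real.sqrt (C * ((d.m t : ℝ) / d.nL t)) + 1 + Cb * d.m t) := by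
          rw [← h3]; gcongr
      _ = _ := by rw [hρ]; field_simp
  have hρ0 : 0 ≤ ρ := (norm_nonneg _).trans (hdev ⟨0, h.one_le_m⟩)
  have hmean : ‖devMean d β b θ‖ ≤ ρ := by
    refine (norm_devMean_le θ).trans ?_
    rw [inv_mul_le_iff₀ hm]
    calc _ ≤ ∑ _i : Fin (d.m t), ρ := Finset.sum_le_sum fun i _ => hdev i
      _ = _ := by simp
  refine (pi_norm_le_iff_of_nonneg (by positivity)).2 ?_
  rintro ⟨k, _ | i⟩
  · rw [sub_target_fixed h.one_le_m e.sum_random]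
    have := (norm_le_pi_norm (devMean d β b θ) k).trans hmean
    linarith
  · rw [sub_target_random h.one_le_m e.sum_random]
    have h1 := (norm_le_pi_norm (devMean d β b θ) k).trans hmean
    have h2 := (norm_le_pi_norm (dev d β b θ i) k).trans (hdev i)
    have := norm_sub_le (dev d β b θ i k) (devMean d β b θ k)
    linarith

/-- The linearisation error of the average does not profit from independence and stays of order
1/n_L; against √N ≤ √(C₂ m n_L) this leaves √(m/n_L). -/
theorem ErrorBounds.sqrt_mul_norm_devMean_sub_le (e : ErrorBounds d F β b y m₀ C t ω θ)
    (h : StageBounds d F β b c₁ C₁ C₂ t) :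
    Real.sqrt (d.N t) * ‖devMean d β b θ - leadMean d F β b y t ω‖ ≤
      C * Real.sqrt (C₂ * ((d.m t : ℝ) / d.nL t)) ∧
    ‖devMean d β b θ - leadMean d F β b y t ω‖ ≤ C * (d.nL t : ℝ)⁻¹ := by
  have hm := h.m_pos
  have hn := h.nL_pos
  have h1 : ‖devMean d β b θ - leadMean d F β b y t ω‖ ≤ C * (d.nL t : ℝ)⁻¹ := by
    rw [devMean, leadMean, ← smul_sub, ← Finset.sum_sub_distrib, norm_smul, Real.norm_eq_abs,
      abs_of_pos (by positivity), inv_mul_le_iff₀ hm]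
    refine (norm_sum_le _ _).trans ?_
    refine le_of_mul_le_mul_left (e.sum_dev_sub_lead_le.trans ?_) hn
    apply le_of_eq
    field_simp
  refine ⟨?_, h1⟩
  have h2 : Real.sqrt (d.N t) ≤ d.nL t * Real.sqrt (C₂ * ((d.m t : ℝ) / d.nL t)) := by
    rw [← Real.sqrt_sq hn.le, ← Real.sqrt_mul (sq_nonneg _), Real.sqrt_sq hn.le]
    refine Real.sqrt_le_sqrt (h.N_le.trans (le_of_eq ?_))
    field_simp
  calc _ ≤ d.nL t * Real.sqrt (C₂ * ((d.m t : ℝ) / d.nL t)) * (C * (d.nL t : ℝ)⁻¹) := by gcongr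
    _ = _ := by field_simp

/-- The estimated random effect carries the common term ū, but averaging makes it of smaller order
than n_L^(-1/2). Hence a fixed cluster is governed by its own leading term. -/
theorem ErrorBounds.sqrt_mul_norm_dev_sub_le (e : ErrorBounds d F β b y m₀ C t ω θ)
    (h : StageBounds d F β b c₁ C₁ C₂ t) (hC : 0 ≤ C) {B : ℝ} {i : Fin (d.m t)}
    (hi : (i : ℕ) < m₀) (hB : ‖centred d b t i‖ ≤ B) :
    Real.sqrt (d.n t i) * ‖dev d β b θ i - lead d F β b y t i ω - devMean d β b θ‖ ≤
      Real.sqrt C₂ * (C * (1 + B) ^ 2 * (Real.sqrt (d.nL t))⁻¹ + C * (Real.sqrt (d.nL t))⁻¹ +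
        Real.sqrt C * (Real.sqrt (d.m t))⁻¹) := by
  have hm := h.m_pos
  have hn := h.nL_pos
  have hsm : 0 < Real.sqrt (d.m t) := Real.sqrt_pos.2 hm
  have hr : 0 < Real.sqrt (d.nL t) := Real.sqrt_pos.2 hn
  have hinv : (d.nL t : ℝ)⁻¹ = (Real.sqrt (d.nL t))⁻¹ * (Real.sqrt (d.nL t))⁻¹ := by
    rw [← mul_inv, Real.mul_self_sqrt hn.le]
  have h1 : Real.sqrt (d.n t i) ≤ Real.sqrt C₂ * Real.sqrt (d.nL t) := by
    rw [← Real.sqrt_mul h.C₂_pos.le]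
    exact Real.sqrt_le_sqrt (h.size_le i i.2)
  have h2 : ‖dev d β b θ i - lead d F β b y t i ω‖ ≤ C * (1 + B) ^ 2 * (d.nL t : ℝ)⁻¹ := by
    refine le_of_mul_le_mul_left ((e.dev_sub_lead_le i hi).trans ?_) hn
    calc _ ≤ C * (1 + B) ^ 2 := by gcongr
      _ = _ := by field_simp
  have h3 := (e.sqrt_mul_norm_devMean_sub_le h).2
  have h4 : ‖leadMean d F β b y t ω‖ ≤
      Real.sqrt C * ((Real.sqrt (d.m t))⁻¹ * (Real.sqrt (d.nL t))⁻¹) := by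
    have h5 : ‖leadMean d F β b y t ω‖ ^ 2 ≤ C / (d.m t * d.nL t) := by
      rw [le_div_iff₀ (by positivity), mul_comm]
      exact e.leadMean_sq_le
    refine (Real.le_sqrt_of_sq_le h5).trans (le_of_eq ?_)
    rw [Real.sqrt_div hC, Real.sqrt_mul hm.le, div_eq_mul_inv, mul_inv]
  have h6 : ‖dev d β b θ i - lead d F β b y t i ω - devMean d β b θ‖ ≤
      C * (1 + B) ^ 2 * (d.nL t : ℝ)⁻¹ + (C * (d.nL t : ℝ)⁻¹ +
        Real.sqrt C * ((Real.sqrt (d.m t))⁻¹ * (Real.sqrt (d.nL t))⁻¹)) := by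
    refine (norm_sub_le _ _).trans (add_le_add h2 ?_)
    have : devMean d β b θ =
      (devMean d β b θ - leadMean d F β b y t ω) + leadMean d F β b y t ω := by abel
    rw [this]
    exact (norm_add_le _ _).trans (add_le_add h3 h4)
  calc _ ≤ (Real.sqrt C₂ * Real.sqrt (d.nL t)) * (C * (1 + B) ^ 2 * (d.nL t : ℝ)⁻¹ +
        (C * (d.nL t : ℝ)⁻¹ +
        Real.sqrt C * ((Real.sqrt (d.m t))⁻¹ * (Real.sqrt (d.nL t))⁻¹))) := by gcongr
    _ = _ := by rw [hinv]; field_simp; ring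

theorem Design.Regime.tendsto_inv_nL (hreg : d.Regime) :
    Tendsto (fun t => (d.nL t : ℝ)⁻¹) atTop (𝓝 0) :=
  tendsto_inv_atTop_zero.comp (tendsto_natCast_atTop_atTop.comp hreg.nL_tendsto)

theorem Design.Regime.tendsto_inv_sqrt_nL (hreg : d.Regime) :
    Tendsto (fun t => (Real.sqrt (d.nL t))⁻¹) atTop (𝓝 0) :=
  tendsto_inv_atTop_zero.comp (Real.tendsto_sqrt_atTop.comp
    (tendsto_natCast_atTop_atTop.comp hreg.nL_tendsto))

theorem Design.Regime.tendsto_inv_sqrt_m (hreg : d.Regime) :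
    Tendsto (fun t => (Real.sqrt (d.m t))⁻¹) atTop (𝓝 0) :=
  tendsto_inv_atTop_zero.comp (Real.tendsto_sqrt_atTop.comp
    (tendsto_natCast_atTop_atTop.comp hreg.m_tendsto))

theorem Design.Regime.tendsto_sqrt_ratio (hreg : d.Regime) (c : ℝ) :
    Tendsto (fun t => Real.sqrt (c * ((d.m t : ℝ) / d.nL t))) atTop (𝓝 0) := by
  have := (hreg.ratio.const_mul c).sqrt
  simpa using this

variable [MeasurableSpace Ω] {P : Measure Ω} [IsProbabilityMeasure P]

/-- Consistency of the estimator in the maximum norm. -/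
theorem tendstoInMeasure_norm_sub_target (hreg : d.Regime) (hF : CurvatureBounds F c₀)
    (h3 : Cond3 d F β b) (hst : ∀ᶠ t in atTop, StageBounds d F β b c₁ C₁ C₂ t)
    (hy : ResponseModel d F β b P y)
    {Ghat : ℕ → Ω → Matrix (Fin p) (Fin p) ℝ} {φhat : ℕ → Ω → ℝ} (h4 : Cond4 P Ghat φhat)
    {θhat : ∀ t, Ω → Param p (d.m t)}
    (hθ : Tendsto (fun t => P {ω | ¬ IsPQLEstimate d F (fun i j => y t i j ω)
        (Ghat t ω) (φhat t ω) (θhat t ω)}) atTop (𝓝 0)) :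
    TendstoInMeasure P (fun t ω => ‖θhat t ω - target d β b t‖) atTop (fun _ => 0) := by
  obtain ⟨Cb, hCb⟩ := h3.effects
  refine tendstoInMeasure_of_errorBounds hreg hF h3 hst hy h4 hθ 0 fun C hC δ hδ => ?_
  have hlim : Tendsto (fun t => 2 * (C * (Real.sqrt (C * ((d.m t : ℝ) / d.nL t)) +
      (d.nL t : ℝ)⁻¹ + 2 * Cb * ((d.m t : ℝ) / d.nL t)))) atTop (𝓝 0) := by
    have := ((((hreg.tendsto_sqrt_ratio C).add hreg.tendsto_inv_nL).add
      (hreg.ratio.const_mul (2 * Cb))).const_mul C).const_mul 2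
    simpa using this
  filter_upwards [hst, hlim.eventually_lt_const hδ] with t h hlt ω e
  rw [abs_of_nonneg (norm_nonneg _)]
  exact (e.norm_sub_target_le h hC (sum_norm_centred_le hCb h.one_le_m)).trans_lt hlt

end Consistency

/-! ### Selections of finitely many blocks -/

section Selection

variable {p q : ℕ} {d : Design p} {F : ExpFamily} {β : Fin p → ℝ}
  {b : ℕ → EuclideanSpace ℝ (Fin p)} {Ω : Type*} {y : ℕ → ℕ → ℕ → Ω → ℝ} {c₀ c₁ C₁ C₂ : ℝ}

theorem sum_fin_eq_sum_range {E : Type*} [AddCommMonoid E] {m m₀ : ℕ} (hm : m₀ ≤ m) {g : ℕ → E}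
    (hg : ∀ i, m₀ ≤ i → i < m → g i = 0) : ∑ i : Fin m, g i = ∑ i ∈ Finset.range m₀, g i := by
  rw [← Finset.sum_range]
  symm
  refine Finset.sum_subset (Finset.range_mono hm) fun i hi hi' => ?_
  simp only [Finset.mem_range] at hi hi'
  exact hg i (not_lt.1 hi') hi

theorem dotProduct_param {m : ℕ} (α δ : Param p m) :
    α ⬝ᵥ δ = α.fixed ⬝ᵥ δ.fixed + ∑ i, α.random i ⬝ᵥ δ.random i := by
  simp only [dotProduct, Param.fixed, Param.random]
  rw [Fintype.sum_prod_type, Finset.sum_comm (s := (Finset.univ : Finset (Fin m))),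
    ← Finset.sum_add_distrib]
  refine Finset.sum_congr rfl fun k _ => ?_
  rw [Fintype.sum_option]

theorem scaling_mulVec_fixed {t : ℕ} (δ : Param p (d.m t)) :
    Param.fixed (scaling d t *ᵥ δ) = Real.sqrt (d.N t) • δ.fixed := by
  ext k
  simp [scaling, Param.fixed, mulVec_diagonal]

theorem scaling_mulVec_random {t : ℕ} (δ : Param p (d.m t)) (i : Fin (d.m t)) :
    Param.random (scaling d t *ᵥ δ) i = Real.sqrt (d.n t i) • δ.random i := by
  ext k
  simp [scaling, Param.random, mulVec_diagonal]

theorem blockMatrix_mulVec_fixed {t : ℕ} (δ : Param p (d.m t)) :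
    Param.fixed (blockMatrix d F β b t *ᵥ δ) = Hbar d F β b t *ᵥ δ.fixed := by
  ext k
  simp only [blockMatrix, Param.fixed, mulVec, dotProduct]
  rw [Fintype.sum_prod_type]
  refine Finset.sum_congr rfl fun l _ => ?_
  rw [Fintype.sum_option]
  simp [blockDiagonal_apply]

theorem blockMatrix_mulVec_random {t : ℕ} (δ : Param p (d.m t)) (i : Fin (d.m t)) :
    Param.random (blockMatrix d F β b t *ᵥ δ) i = H d F β b t i *ᵥ δ.random i := by
  ext k
  simp only [blockMatrix, Param.random, mulVec, dotProduct]
  rw [Fintype.sum_prod_type]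
  refine Finset.sum_congr rfl fun l _ => ?_
  rw [Fintype.sum_option]
  simp [blockDiagonal_apply]

end Selection

/-! ### Limiting covariance of a selection -/

section SelectionLimits

variable {p q : ℕ} {d : Design p} {F : ExpFamily} {β : Fin p → ℝ}
  {b : ℕ → EuclideanSpace ℝ (Fin p)} {Ω : Type*} {y : ℕ → ℕ → ℕ → Ω → ℝ} {c₀ c₁ C₁ C₂ : ℝ}
  {A : ∀ t, Matrix (Fin q) (Fin p × Option (Fin (d.m t))) ℝ}
  {L : Option ℕ → Matrix (Fin q) (Fin p) ℝ} {K₀ : Matrix (Fin p) (Fin p) ℝ}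
  {K : ℕ → Matrix (Fin p) (Fin p) ℝ}

theorem FiniteSelection.exists_entry_eq_zero (hA : FiniteSelection d A L) :
    ∃ m₀ : ℕ, ∀ t, m₀ < d.m t → ∀ i, m₀ ≤ i → ∀ r k, entry (A t) r k (some i) = 0 := by
  choose m₀ hm₀ using hA.finite
  have hle : ∀ r, m₀ r ≤ ∑ r, m₀ r := fun r =>
    Finset.single_le_sum (fun _ _ => Nat.zero_le _) (Finset.mem_univ r)
  -- The sum over the rows serves as an upper bound for their individual thresholds.
  refine ⟨∑ r, m₀ r, fun t ht i hi r k => ?_⟩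
  simp only [entry]
  split_ifs with h
  · exact hm₀ r t ((hle r).trans_lt ht) ⟨i, h⟩ ((hle r).trans hi) k
  · rfl

theorem entry_some {m : ℕ} (A : Matrix (Fin q) (Fin p × Option (Fin m)) ℝ) (r : Fin q)
    (k : Fin p) (i : Fin m) : entry A r k (some i) = A r (k, some i) := by
  simp [entry]

theorem FiniteSelection.limit_eq_zero (hA : FiniteSelection d A L)
    (hm : Tendsto d.m atTop atTop) {m₀ : ℕ}
    (hm₀ : ∀ t, m₀ < d.m t → ∀ i, m₀ ≤ i → ∀ r k, entry (A t) r k (some i) = 0) {i : ℕ}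
    (hi : m₀ ≤ i) : L (some i) = 0 := by
  ext r k
  refine tendsto_nhds_unique (hA.tendsto r k (some i)) (tendsto_const_nhds.congr' ?_)
  filter_upwards [hm.eventually_gt_atTop m₀] with t ht
  exact (hm₀ t ht i hi r k).symm

theorem dotProduct_blockMatrix_mulVec {t : ℕ} (α δ : Param p (d.m t)) :
    α ⬝ᵥ (blockMatrix d F β b t *ᵥ δ) = α.fixed ⬝ᵥ (Hbar d F β b t *ᵥ δ.fixed) +
      ∑ i, α.random i ⬝ᵥ (H d F β b t i *ᵥ δ.random i) := by
  rw [dotProduct_param, blockMatrix_mulVec_fixed]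
  simp_rw [blockMatrix_mulVec_random]

theorem tendsto_dotProduct_mulVec {M : ℕ → Matrix (Fin p) (Fin p) ℝ}
    {M' : Matrix (Fin p) (Fin p) ℝ} {u v : ℕ → Fin p → ℝ} {u' v' : Fin p → ℝ}
    (hM : Tendsto M atTop (𝓝 M')) (hu : Tendsto u atTop (𝓝 u')) (hv : Tendsto v atTop (𝓝 v')) :
    Tendsto (fun t => u t ⬝ᵥ (M t *ᵥ v t)) atTop (𝓝 (u' ⬝ᵥ (M' *ᵥ v'))) := by
  have hc : Continuous fun x : (Fin p → ℝ) × Matrix (Fin p) (Fin p) ℝ × (Fin p → ℝ) =>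
      x.1 ⬝ᵥ (x.2.1 *ᵥ x.2.2) :=
    continuous_fst.dotProduct (continuous_snd.fst.matrix_mulVec continuous_snd.snd)
  exact (hc.tendsto (u', M', v')).comp (hu.prodMk_nhds (hM.prodMk_nhds hv))

/-- The dimension grows, but beyond a fixed cluster all coefficients vanish, so each entry is a
fixed finite sum of convergent terms. -/
theorem FiniteSelection.tendsto_mul_blockMatrix_mul (hA : FiniteSelection d A L)
    (hm : Tendsto d.m atTop atTop) (h2 : Cond2 d F β b K₀ K) {m₀ : ℕ}
    (hm₀ : ∀ t, m₀ < d.m t → ∀ i, m₀ ≤ i → ∀ r k, entry (A t) r k (some i) = 0) :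
    Tendsto (fun t => A t * blockMatrix d F β b t * (A t)ᵀ) atTop
      (𝓝 (L none * K₀ * (L none)ᵀ +
        ∑ i ∈ Finset.range m₀, L (some i) * K i * (L (some i))ᵀ)) := by
  have hent : ∀ r s, Tendsto (fun t k => entry (A t) r k s) atTop (𝓝 (L s r)) := fun r s =>
    tendsto_pi_nhds.2 fun k => hA.tendsto r k s
  refine tendsto_pi_nhds.2 fun r => tendsto_pi_nhds.2 fun r' => ?_
  have hlim : Tendsto (fun t => (fun k => entry (A t) r k none) ⬝ᵥ
      (Hbar d F β b t *ᵥ fun k => entry (A t) r' k none) + ∑ i ∈ Finset.range m₀,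
        (fun k => entry (A t) r k (some i)) ⬝ᵥ
          (H d F β b t i *ᵥ fun k => entry (A t) r' k (some i))) atTop
      (𝓝 (L none r ⬝ᵥ (K₀ *ᵥ L none r') + ∑ i ∈ Finset.range m₀,
        L (some i) r ⬝ᵥ (K i *ᵥ L (some i) r'))) :=
    (tendsto_dotProduct_mulVec h2.tendsto_bar (hent r none) (hent r' none)).add
      (tendsto_finsetSum _ fun i _ =>
        tendsto_dotProduct_mulVec (h2.tendsto i) (hent r (some i)) (hent r' (some i)))
  have hval : ∀ {n : ℕ} {κ : Type} [Fintype κ] (B : Matrix (Fin n) κ ℝ) (M : Matrix κ κ ℝ)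
      (r r' : Fin n), (B * M * Bᵀ) r r' = B r ⬝ᵥ (M *ᵥ B r') := by
    intro n κ _ B M r r'
    rw [dotProduct_mulVec]
    rfl
  have hlimval : (L none * K₀ * (L none)ᵀ +
      ∑ i ∈ Finset.range m₀, L (some i) * K i * (L (some i))ᵀ) r r' =
      L none r ⬝ᵥ (K₀ *ᵥ L none r') + ∑ i ∈ Finset.range m₀,
        L (some i) r ⬝ᵥ (K i *ᵥ L (some i) r') := by
    rw [Matrix.add_apply, Matrix.sum_apply, hval]
    simp_rw [hval]
  rw [hlimval]
  refine hlim.congr' ?_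
  filter_upwards [hm.eventually_gt_atTop m₀] with t ht
  rw [hval, dotProduct_blockMatrix_mulVec]
  congr 1
  rw [← sum_fin_eq_sum_range (g := fun i => (fun k => entry (A t) r k (some i)) ⬝ᵥ
    (H d F β b t i *ᵥ fun k => entry (A t) r' k (some i))) ht.le]
  · refine Finset.sum_congr rfl fun i _ => ?_
    simp_rw [entry_some]
    rfl
  · intro i hi _
    have : (fun k => entry (A t) r k (some i)) = 0 := by
      ext k; exact hm₀ t ht i hi r k
    rw [this, zero_dotProduct]

/-! ### The leading term of a selection -/

variable (d F β b y) in
/-- The leading terms, arranged as a parameter vector. -/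
def leadParam (t : ℕ) (ω : Ω) : Param p (d.m t)
  | (k, none) => leadMean d F β b y t ω k
  | (k, some i) => lead d F β b y t i ω k

variable (d) in
/-- The combination `(N^{1/2} / m) α₀ + n_i^{1/2} α_i` of the blocks of `α`. -/
def blockComb {t : ℕ} (α : Param p (d.m t)) (i : Fin (d.m t)) : Fin p → ℝ :=
  (Real.sqrt (d.N t) / d.m t) • α.fixed + Real.sqrt (d.n t i) • α.random i

variable (d F β b) in
/-- The coefficient of the score of cluster `i` in a selection. -/
def scoreCoeff {t : ℕ} (α : Param p (d.m t)) (i : Fin (d.m t)) : Fin p → ℝ :=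
  ((d.n t i : ℝ) * F.φ)⁻¹ • (H d F β b t i *ᵥ blockComb d α i)

/-- The leading term of cluster i enters twice, through the average in the fixed block and through
its own block; `blockComb` collects the two coefficients. -/
theorem dotProduct_scaling_leadParam {t : ℕ} (h : StageBounds d F β b c₁ C₁ C₂ t)
    (α : Param p (d.m t)) (ω : Ω) : α ⬝ᵥ (scaling d t *ᵥ leadParam d F β b y t ω) =
      ∑ i : Fin (d.m t), scoreCoeff d F β b α i ⬝ᵥ score d F β b y t i ω := by
  rw [dotProduct_param, scaling_mulVec_fixed]
  simp_rw [scaling_mulVec_random]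
  have h1 : (leadParam d F β b y t ω).fixed = leadMean d F β b y t ω := rfl
  have h2 : ∀ i, (leadParam d F β b y t ω).random i = lead d F β b y t i ω := fun _ => rfl
  simp_rw [h1, h2, scoreCoeff, ← dotProduct_lead h]
  rw [leadMean, dotProduct_smul, dotProduct_smul, dotProduct_sum, smul_smul, Finset.smul_sum,
    ← Finset.sum_add_distrib]
  refine Finset.sum_congr rfl fun i _ => ?_
  rw [blockComb, add_dotProduct, smul_dotProduct, smul_dotProduct, dotProduct_smul,
    div_eq_mul_inv]

theorem Hbar_mulVec {t : ℕ} (u : Fin p → ℝ) : u ⬝ᵥ (Hbar d F β b t *ᵥ u) =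
    ∑ i : Fin (d.m t), (d.m t : ℝ)⁻¹ * (d.nbar t / d.n t i) * (u ⬝ᵥ (H d F β b t i *ᵥ u)) := by
  rw [Hbar, smul_mulVec, sum_mulVec, dotProduct_smul, dotProduct_sum, Finset.smul_sum]
  refine Finset.sum_congr rfl fun i _ => ?_
  rw [smul_mulVec, dotProduct_smul, smul_eq_mul, smul_eq_mul, mul_assoc]

/-- Expand the square of (√N/m) α₀ + √n_i α_i in the form n_i⁻¹H_i. The pure α₀ terms carry N/(m²
n_i) = m⁻¹ n̄/n_i and add up to `Hbar`, the pure α_i terms give H_i, and the mixed terms form the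
second sum. -/
theorem variance_scoreCoeff {t : ℕ} (h : StageBounds d F β b c₁ C₁ C₂ t)
    (α : Param p (d.m t)) :
    ∑ s : d.Obs t, (scoreCoeff d F β b α s.1 ⬝ᵥ d.x t s.1 s.2) ^ 2 *
      obsVar d F β b t s.1 s.2 = α ⬝ᵥ (blockMatrix d F β b t *ᵥ α) +
      ∑ i : Fin (d.m t), 2 * (Real.sqrt (d.N t) / (d.m t * Real.sqrt (d.n t i))) *
        (α.fixed ⬝ᵥ (H d F β b t i *ᵥ α.random i)) := by
  rw [sum_weight_sq_mul_obsVar h, dotProduct_blockMatrix_mulVec, Hbar_mulVec,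
    ← Finset.sum_add_distrib, ← Finset.sum_add_distrib]
  refine Finset.sum_congr rfl fun i _ => ?_
  have hφ := F.φ_pos.ne'
  have hn := h.n_pos i
  have hm := h.m_pos.ne'
  have hsq : Real.sqrt (d.n t i) ^ 2 = d.n t i := Real.sq_sqrt hn.le
  have hsN : Real.sqrt (d.N t) ^ 2 = d.N t := Real.sq_sqrt (Nat.cast_nonneg _)
  have hs0 : Real.sqrt (d.n t i) ≠ 0 := (Real.sqrt_pos.2 hn).ne'
  have hsymm : α.random i ⬝ᵥ (H d F β b t i *ᵥ α.fixed) =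
      α.fixed ⬝ᵥ (H d F β b t i *ᵥ α.random i) := by
    rw [dotProduct_mulVec, ← mulVec_transpose, (h.eig i i.2).transpose_eq, dotProduct_comm]
  have e1 : (d.n t i : ℝ) * F.φ ^ 2 * (scoreCoeff d F β b α i ⬝ᵥ
      (info d F β b t i *ᵥ scoreCoeff d F β b α i)) =
      (d.n t i : ℝ)⁻¹ * (blockComb d α i ⬝ᵥ (H d F β b t i *ᵥ blockComb d α i)) := by
    rw [scoreCoeff, mulVec_smul, h.info_mulVec_H, dotProduct_smul, smul_dotProduct,
      dotProduct_comm (H d F β b t i *ᵥ _), smul_eq_mul, smul_eq_mul]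
    field_simp
  rw [e1, blockComb]
  simp only [mulVec_add, mulVec_smul, dotProduct_add, add_dotProduct, dotProduct_smul,
    smul_dotProduct, smul_eq_mul, hsymm]
  rw [Design.nbar]
  -- With the roots as variables and n_i = s², N = S², the identity becomes rational.
  generalize Real.sqrt (d.n t i) = s at *
  generalize Real.sqrt (d.N t) = S at *
  rw [← hsq, ← hsN]
  field_simp
  ring

end SelectionLimits

/-! ### Gaussian limits of linear combinations of leading terms -/

section Normality

variable {p q : ℕ} {d : Design p} {F : ExpFamily} {β : Fin p → ℝ}
  {b : ℕ → EuclideanSpace ℝ (Fin p)} {Ω : Type*} {y : ℕ → ℕ → ℕ → Ω → ℝ} {c₀ c₁ C₁ C₂ : ℝ}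
  {A : ∀ t, Matrix (Fin q) (Fin p × Option (Fin (d.m t))) ℝ}
  {L : Option ℕ → Matrix (Fin q) (Fin p) ℝ} {K₀ : Matrix (Fin p) (Fin p) ℝ}
  {K : ℕ → Matrix (Fin p) (Fin p) ℝ} {m₀ : ℕ}

theorem Param.norm_fixed_le {m : ℕ} (α : Param p m) : ‖α.fixed‖ ≤ ‖α‖ :=
  (pi_norm_le_iff_of_nonneg (norm_nonneg _)).2 fun k => norm_le_pi_norm α (k, none)

theorem Param.norm_random_le {m : ℕ} (α : Param p m) (i : Fin m) : ‖α.random i‖ ≤ ‖α‖ :=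
  (pi_norm_le_iff_of_nonneg (norm_nonneg _)).2 fun k => norm_le_pi_norm α (k, some i)

/-- Convergent entries are eventually bounded, and only finitely many blocks are nonzero, so the
bound is uniform in spite of the growing dimension. -/
theorem FiniteSelection.exists_norm_row_le (hA : FiniteSelection d A L)
    (hm : Tendsto d.m atTop atTop)
    (hm₀ : ∀ t, m₀ < d.m t → ∀ i, m₀ ≤ i → ∀ r k, entry (A t) r k (some i) = 0) :
    ∃ a, 0 ≤ a ∧ ∀ᶠ t in atTop, ∀ r, ‖A t r‖ ≤ a := by
  obtain ⟨a, ha⟩ : ∃ a, a = ∑ r, ∑ k, ((|L none r k| + 1) +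
      ∑ i ∈ Finset.range m₀, (|L (some i) r k| + 1)) := ⟨_, rfl⟩
  have h0 : ∀ r k, 0 ≤ ∑ i ∈ Finset.range m₀, (|L (some i) r k| + 1) := fun r k => by positivity
  have hle : ∀ r k, (|L none r k| + 1) + ∑ i ∈ Finset.range m₀, (|L (some i) r k| + 1) ≤ a := by
    intro r k
    rw [ha]
    refine le_trans ?_ (Finset.single_le_sum (f := fun r => ∑ k, ((|L none r k| + 1) +
      ∑ i ∈ Finset.range m₀, (|L (some i) r k| + 1))) (fun r _ => by positivity)
      (Finset.mem_univ r))
    exact Finset.single_le_sum (f := fun k => ((|L none r k| + 1) +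
      ∑ i ∈ Finset.range m₀, (|L (some i) r k| + 1))) (fun k _ => by positivity)
      (Finset.mem_univ k)
  have hev : ∀ r k s, ∀ᶠ t in atTop, |entry (A t) r k s| ≤ |L s r k| + 1 := fun r k s =>
    ((hA.tendsto r k s).abs.eventually_lt_const (lt_add_one _)).mono fun _ h => h.le
  have ha0 : 0 ≤ a := by rw [ha]; positivity
  refine ⟨a, ha0, ?_⟩
  have hall : ∀ᶠ t in atTop, ∀ r k, |entry (A t) r k none| ≤ |L none r k| + 1 ∧
      ∀ i ∈ Finset.range m₀, |entry (A t) r k (some i)| ≤ |L (some i) r k| + 1 :=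
    eventually_all.2 fun r => eventually_all.2 fun k =>
      (hev r k none).and ((eventually_all_finset _).2 fun i _ => hev r k (some i))
  filter_upwards [hall, hm.eventually_gt_atTop m₀] with t ht hmt r
  refine (pi_norm_le_iff_of_nonneg ha0).2 ?_
  rintro ⟨k, _ | i⟩
  · rw [Real.norm_eq_abs]
    exact ((ht r k).1.trans (le_add_of_nonneg_right (h0 r k))).trans (hle r k)
  · rw [Real.norm_eq_abs]
    rw [← entry_some (A t) r k i]
    rcases lt_or_ge (i : ℕ) m₀ with hi | hi
    · have hi' := Finset.mem_range.2 hi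
      refine ((ht r k).2 i hi').trans (le_trans ?_ (hle r k))
      refine le_trans ?_ (le_add_of_nonneg_left (by positivity))
      exact Finset.single_le_sum (f := fun i : ℕ => |L (some i) r k| + 1)
        (fun _ _ => by positivity) hi'
    · rw [hm₀ t hmt i hi r k, abs_zero]
      exact ha0

theorem StageBounds.sqrt_N_div_le {t : ℕ} (h : StageBounds d F β b c₁ C₁ C₂ t) :
    Real.sqrt (d.N t) / d.m t ≤
      Real.sqrt C₂ * (Real.sqrt (d.m t))⁻¹ * Real.sqrt (d.nL t) := by
  have hm := h.m_pos
  have hsm : 0 < Real.sqrt (d.m t) := Real.sqrt_pos.2 hm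
  rw [div_le_iff₀ hm]
  refine (Real.sqrt_le_sqrt h.N_le).trans (le_of_eq ?_)
  rw [Real.sqrt_mul h.C₂_pos.le, Real.sqrt_mul hm.le]
  nth_rewrite 3 [← Real.mul_self_sqrt hm.le]
  field_simp

/-- Asymptotic negligibility of each observation: its weight is of order n_L^(-1/2), uniformly. -/
theorem StageBounds.abs_scoreCoeff_dotProduct_le {t : ℕ} (h : StageBounds d F β b c₁ C₁ C₂ t)
    {a : ℝ} {α : Param p (d.m t)} (hα : ‖α‖ ≤ a) (s : d.Obs t) :
    |scoreCoeff d F β b α s.1 ⬝ᵥ d.x t s.1 s.2| ≤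
      p * (F.φ⁻¹ * (p * c₁⁻¹) * (a * (Real.sqrt C₂ + 1)) * C₁) * (Real.sqrt (d.nL t))⁻¹ := by
  have hφ := F.φ_pos
  have hc := h.c_pos
  have hC := h.C_nonneg
  have hm := h.m_pos
  have hL := h.nL_pos
  have hn := h.n_pos s.1
  have ha : 0 ≤ a := (norm_nonneg _).trans hα
  have hsn : 0 < Real.sqrt (d.n t s.1) := Real.sqrt_pos.2 hn
  have hsL : 0 < Real.sqrt (d.nL t) := Real.sqrt_pos.2 hL
  have hLn : Real.sqrt (d.nL t) ≤ Real.sqrt (d.n t s.1) := Real.sqrt_le_sqrt (h.nL_le_cast _)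
  have h1 : Real.sqrt (d.N t) / d.m t ≤ Real.sqrt C₂ * Real.sqrt (d.n t s.1) := by
    have hone : (Real.sqrt (d.m t))⁻¹ ≤ 1 :=
      inv_le_one_of_one_le₀ (Real.one_le_sqrt.2 (by exact_mod_cast h.one_le_m))
    calc _ ≤ Real.sqrt C₂ * (Real.sqrt (d.m t))⁻¹ * Real.sqrt (d.nL t) := h.sqrt_N_div_le
      _ ≤ Real.sqrt C₂ * 1 * Real.sqrt (d.n t s.1) := by gcongr
      _ = _ := by ring
  have h2 : ‖blockComb d α s.1‖ ≤ a * (Real.sqrt C₂ + 1) * Real.sqrt (d.n t s.1) := by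
    refine (norm_add_le _ _).trans ?_
    rw [norm_smul, norm_smul, Real.norm_eq_abs, Real.norm_eq_abs, abs_of_nonneg (by positivity),
      abs_of_nonneg (by positivity)]
    calc _ ≤ Real.sqrt C₂ * Real.sqrt (d.n t s.1) * a + Real.sqrt (d.n t s.1) * a := by
          gcongr
          · exact α.norm_fixed_le.trans hα
          · exact (α.norm_random_le _).trans hα
      _ = _ := by ring
  have h3 : ‖scoreCoeff d F β b α s.1‖ ≤
      F.φ⁻¹ * (p * c₁⁻¹) * (a * (Real.sqrt C₂ + 1)) * (Real.sqrt (d.nL t))⁻¹ := by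
    have hinv : (d.n t s.1 : ℝ)⁻¹ = (Real.sqrt (d.n t s.1))⁻¹ * (Real.sqrt (d.n t s.1))⁻¹ := by
      rw [← mul_inv, Real.mul_self_sqrt hn.le]
    refine (h.norm_inv_smul_H_mulVec_le s.1 _).trans ?_
    calc _ ≤ (d.n t s.1 : ℝ)⁻¹ * (F.φ⁻¹ * (p * c₁⁻¹)) *
          (a * (Real.sqrt C₂ + 1) * Real.sqrt (d.n t s.1)) := by gcongr
      _ = F.φ⁻¹ * (p * c₁⁻¹) * (a * (Real.sqrt C₂ + 1)) * (Real.sqrt (d.n t s.1))⁻¹ := by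
          rw [hinv]; field_simp
      _ ≤ _ := by gcongr
  refine (abs_dotProduct_le _ _).trans ?_
  calc _ ≤ p * ((F.φ⁻¹ * (p * c₁⁻¹) * (a * (Real.sqrt C₂ + 1)) * (Real.sqrt (d.nL t))⁻¹) *
        C₁) := by
        gcongr
        exact h.x_le _ s.1.2 _ s.2.2
    _ = _ := by ring

/-- At most `m₀` mixed terms are nonzero and each is of order m^(-1/2). This is the asymptotic
independence of the fixed effects and the clusters. -/
theorem StageBounds.abs_cross_le {t : ℕ} (h : StageBounds d F β b c₁ C₁ C₂ t)
    {a : ℝ} {α : Param p (d.m t)} (hα : ‖α‖ ≤ a) (hmt : m₀ < d.m t)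
    (hz : ∀ i : Fin (d.m t), m₀ ≤ i → α.random i = 0) :
    |∑ i : Fin (d.m t), 2 * (Real.sqrt (d.N t) / (d.m t * Real.sqrt (d.n t i))) *
        (α.fixed ⬝ᵥ (H d F β b t i *ᵥ α.random i))| ≤
      m₀ * (2 * Real.sqrt C₂ * (p * (a * (p * c₁⁻¹ * a)))) * (Real.sqrt (d.m t))⁻¹ := by
  have hc := h.c_pos
  have hm := h.m_pos
  have ha : 0 ≤ a := (norm_nonneg _).trans hα
  obtain ⟨B, hB⟩ : ∃ B, B = (2 * Real.sqrt C₂ * (p * (a * (p * c₁⁻¹ * a)))) *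
    (Real.sqrt (d.m t))⁻¹ := ⟨_, rfl⟩
  have hle : ∀ i : Fin (d.m t), |2 * (Real.sqrt (d.N t) / (d.m t * Real.sqrt (d.n t i))) *
      (α.fixed ⬝ᵥ (H d F β b t i *ᵥ α.random i))| ≤ if (i : ℕ) < m₀ then B else 0 := by
    intro i
    split_ifs with hi
    · have hn := h.n_pos i
      have hsn : 0 < Real.sqrt (d.n t i) := Real.sqrt_pos.2 hn
      have h1 : Real.sqrt (d.N t) / (d.m t * Real.sqrt (d.n t i)) ≤
          Real.sqrt C₂ * (Real.sqrt (d.m t))⁻¹ := by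
        rw [← div_div, div_le_iff₀ hsn]
        refine h.sqrt_N_div_le.trans ?_
        gcongr
        exact h.nL_le i i.2
      have h2 : |α.fixed ⬝ᵥ (H d F β b t i *ᵥ α.random i)| ≤ p * (a * (p * c₁⁻¹ * a)) := by
        refine (abs_dotProduct_le _ _).trans ?_
        gcongr
        · exact α.norm_fixed_le.trans hα
        · refine ((h.eig i i.2).norm_mulVec_le h.c_pos _).trans ?_
          gcongr
          exact (α.norm_random_le _).trans hα
      rw [abs_mul, abs_of_nonneg (by positivity), hB]
      calc _ ≤ 2 * (Real.sqrt C₂ * (Real.sqrt (d.m t))⁻¹) * (p * (a * (p * c₁⁻¹ * a))) := by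
            gcongr
        _ = _ := by ring
    · rw [hz i (not_lt.1 hi)]
      simp
  refine (Finset.abs_sum_le_sum_abs _ _).trans ((Finset.sum_le_sum fun i _ => hle i).trans ?_)
  rw [sum_fin_eq_sum_range (g := fun i => if i < m₀ then B else 0) hmt.le
    fun i hi _ => if_neg (not_lt.2 hi), Finset.sum_ite_of_true fun i hi => Finset.mem_range.1 hi,
    hB]
  simp
  exact le_of_eq (by ring)

variable [MeasurableSpace Ω] {P : Measure Ω}

theorem ResponseModel.aemeasurable_leadParam (hy : ResponseModel d F β b P y) (t : ℕ) :
    AEMeasurable (leadParam d F β b y t) P := by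
  have hscore : ∀ i : Fin (d.m t), AEMeasurable (score d F β b y t i) P := by
    intro i
    have : score d F β b y t i =
        fun ω => ∑ j : Fin (d.n t i), resid d F β b y t i j ω • d.x t i j := rfl
    rw [this]
    exact Finset.aemeasurable_fun_sum _ fun j _ =>
      (hy.aemeasurable_resid t ⟨i, j⟩).smul_const _
  have hlead : ∀ i : Fin (d.m t), AEMeasurable (lead d F β b y t i) P := by
    intro i
    have hc : Continuous fun v : Fin p → ℝ => H d F β b t i *ᵥ v :=
      continuous_const.matrix_mulVec continuous_id
    exact (hc.measurable.comp_aemeasurable (hscore i)).const_smul (((d.n t i : ℝ) * F.φ)⁻¹)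
  have hmean : AEMeasurable (leadMean d F β b y t) P :=
    (Finset.aemeasurable_fun_sum _ fun i _ => hlead i).const_smul ((d.m t : ℝ)⁻¹)
  refine aemeasurable_pi_lambda _ ?_
  rintro ⟨k, _ | i⟩
  · exact (measurable_pi_apply k).comp_aemeasurable hmean
  · exact (measurable_pi_apply k).comp_aemeasurable (hlead i)

variable [IsProbabilityMeasure P]

theorem tendsto_charFun_dotProduct_leadParam (hreg : d.Regime) (hF : CurvatureBounds F c₀)
    (h3 : Cond3 d F β b) (hst : ∀ᶠ t in atTop, StageBounds d F β b c₁ C₁ C₂ t)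
    (hy : ResponseModel d F β b P y) {a σ : ℝ} {α : ∀ t, Param p (d.m t)}
    (hα : ∀ᶠ t in atTop, ‖α t‖ ≤ a)
    (hz : ∀ t, m₀ < d.m t → ∀ i : Fin (d.m t), m₀ ≤ i → (α t).random i = 0)
    (hσ : Tendsto (fun t => α t ⬝ᵥ (blockMatrix d F β b t *ᵥ α t)) atTop (𝓝 σ)) :
    Tendsto (fun t => charFun (P.map fun ω =>
        α t ⬝ᵥ (scaling d t *ᵥ leadParam d F β b y t ω)) 1)
      atTop (𝓝 (Complex.exp (-(σ / 2 : ℝ)))) := by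
  obtain ⟨ε, hε, hint⟩ := h3.interior
  refine (hy.tendsto_charFun_weighted hF hε hint
    (fun t s => scoreCoeff d F β b (α t) s.1 ⬝ᵥ d.x t s.1 s.2) ?_ ?_ (σ := σ)).congr' ?_
  · intro δ hδ
    have hlim := hreg.tendsto_inv_sqrt_nL.const_mul
      (p * (F.φ⁻¹ * (p * c₁⁻¹) * (a * (Real.sqrt C₂ + 1)) * C₁))
    rw [mul_zero] at hlim
    filter_upwards [hst, hα, hlim.eventually_lt_const hδ] with t h ht hlt s
    exact (h.abs_scoreCoeff_dotProduct_le ht s).trans hlt.le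
  · have hcross : Tendsto (fun t => ∑ i : Fin (d.m t),
        2 * (Real.sqrt (d.N t) / (d.m t * Real.sqrt (d.n t i))) *
          ((α t).fixed ⬝ᵥ (H d F β b t i *ᵥ (α t).random i))) atTop (𝓝 0) := by
      have hlim := hreg.tendsto_inv_sqrt_m.const_mul
        (m₀ * (2 * Real.sqrt C₂ * (p * (a * (p * c₁⁻¹ * a)))))
      rw [mul_zero] at hlim
      refine squeeze_zero_norm' ?_ hlim
      filter_upwards [hst, hα, hreg.m_tendsto.eventually_gt_atTop m₀] with t h ht hmt
      exact h.abs_cross_le ht hmt (hz t hmt)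
    have hsum := hσ.add hcross
    rw [add_zero] at hsum
    refine hsum.congr' ?_
    filter_upwards [hst] with t h
    exact (variance_scoreCoeff h (α t)).symm
  · filter_upwards [hst] with t h
    congr 2
    ext ω
    rw [dotProduct_scaling_leadParam h, sum_dotProduct_score]

end Normality

/-! ### Limit law of a selection -/

section SelectionLaw

variable {p q : ℕ} {d : Design p} {F : ExpFamily} {β : Fin p → ℝ}
  {b : ℕ → EuclideanSpace ℝ (Fin p)} {Ω : Type*} {y : ℕ → ℕ → ℕ → Ω → ℝ} {c₀ c₁ C₁ C₂ : ℝ}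
  {A : ∀ t, Matrix (Fin q) (Fin p × Option (Fin (d.m t))) ℝ}
  {L : Option ℕ → Matrix (Fin q) (Fin p) ℝ} {K₀ : Matrix (Fin p) (Fin p) ℝ}
  {K : ℕ → Matrix (Fin p) (Fin p) ℝ} {m₀ : ℕ}

theorem row_random_eq_zero {t : ℕ}
    (hm₀ : ∀ i, m₀ ≤ i → ∀ r k, entry (A t) r k (some i) = 0) (r : Fin q) (i : Fin (d.m t))
    (hi : m₀ ≤ i) : Param.random (A t r) i = 0 := by
  ext k
  have := hm₀ i hi r k
  rwa [entry_some] at this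

theorem abs_dotProduct_scaling_le {t : ℕ} {a B₀ B₁ : ℝ} {α δ : Param p (d.m t)} (hα : ‖α‖ ≤ a)
    (hmt : m₀ < d.m t) (hz : ∀ i : Fin (d.m t), m₀ ≤ i → α.random i = 0)
    (hfix : Real.sqrt (d.N t) * ‖δ.fixed‖ ≤ B₀)
    (hran : ∀ i : Fin (d.m t), (i : ℕ) < m₀ → Real.sqrt (d.n t i) * ‖δ.random i‖ ≤ B₁) :
    |α ⬝ᵥ (scaling d t *ᵥ δ)| ≤ p * (a * B₀) + m₀ * (p * (a * B₁)) := by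
  have ha : 0 ≤ a := (norm_nonneg _).trans hα
  rw [dotProduct_param, scaling_mulVec_fixed]
  simp_rw [scaling_mulVec_random]
  refine (abs_add_le _ _).trans (add_le_add ?_ ?_)
  · refine (abs_dotProduct_le _ _).trans ?_
    rw [norm_smul, Real.norm_eq_abs, abs_of_nonneg (Real.sqrt_nonneg _)]
    gcongr
    exact α.norm_fixed_le.trans hα
  · have hle : ∀ i : Fin (d.m t), |α.random i ⬝ᵥ (Real.sqrt (d.n t i) • δ.random i)| ≤
        if (i : ℕ) < m₀ then p * (a * B₁) else 0 := by
      intro i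
      split_ifs with hi
      · refine (abs_dotProduct_le _ _).trans ?_
        rw [norm_smul, Real.norm_eq_abs, abs_of_nonneg (Real.sqrt_nonneg _)]
        gcongr
        · exact (α.norm_random_le i).trans hα
        · exact hran i hi
      · rw [hz i (not_lt.1 hi)]
        simp
    refine (Finset.abs_sum_le_sum_abs _ _).trans ((Finset.sum_le_sum fun i _ => hle i).trans ?_)
    rw [sum_fin_eq_sum_range (g := fun i => if i < m₀ then p * (a * B₁) else 0) hmt.le
      fun i hi _ => if_neg (not_lt.2 hi), Finset.sum_ite_of_true fun i hi => Finset.mem_range.1 hi]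
    simp

theorem norm_toLp_le_sum (u : Fin q → ℝ) : ‖WithLp.toLp 2 u‖ ≤ ∑ r, |u r| := by
  rw [EuclideanSpace.norm_eq]
  refine Real.sqrt_le_iff.2 ⟨Finset.sum_nonneg fun _ _ => abs_nonneg _, ?_⟩
  exact Finset.sum_sq_le_sq_sum_of_nonneg fun _ _ => abs_nonneg _

variable [MeasurableSpace Ω] {P : Measure Ω}

/-- The Cramér–Wold reduction to real-valued linear combinations. -/
theorem charFun_map_toLp {T : Ω → Fin q → ℝ} (hT : AEMeasurable T P)
    (v : EuclideanSpace ℝ (Fin q)) :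
    charFun (P.map fun ω => WithLp.toLp 2 (T ω)) v = charFun (P.map fun ω => v.ofLp ⬝ᵥ T ω) 1 := by
  have h1 : AEMeasurable (fun ω => WithLp.toLp 2 (T ω)) P :=
    (PiLp.continuous_toLp 2 _).measurable.comp_aemeasurable hT
  have hc : Continuous fun u : Fin q → ℝ => v.ofLp ⬝ᵥ u := continuous_const.dotProduct continuous_id
  have h2 : AEMeasurable (fun ω => v.ofLp ⬝ᵥ T ω) P := hc.measurable.comp_aemeasurable hT
  rw [charFun_apply, charFun_apply, integral_map h1 (by fun_prop), integral_map h2 (by fun_prop)]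
  refine integral_congr_ae (Eventually.of_forall fun ω => ?_)
  simp [EuclideanSpace.inner_eq_star_dotProduct]

variable [IsProbabilityMeasure P]

/-- By Lévy's continuity theorem it suffices to test each v. The combination of rows `v ᵥ* A t`
inherits boundedness and vanishing beyond `m₀`, so the scalar limit applies with variance v·Ωv. -/
theorem FiniteSelection.tendstoInDistribution_leadParam (hA : FiniteSelection d A L)
    (hreg : d.Regime) (hF : CurvatureBounds F c₀)
    (h3 : Cond3 d F β b) (hst : ∀ᶠ t in atTop, StageBounds d F β b c₁ C₁ C₂ t)
    (hy : ResponseModel d F β b P y)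
    (hm₀ : ∀ t, m₀ < d.m t → ∀ i, m₀ ≤ i → ∀ r k, entry (A t) r k (some i) = 0)
    {Om : Matrix (Fin q) (Fin q) ℝ} (hOm : Om.PosSemidef)
    (hlim : Tendsto (fun t => A t * blockMatrix d F β b t * (A t)ᵀ) atTop (𝓝 Om)) :
    TendstoInDistribution
      (fun t ω => WithLp.toLp 2 (A t *ᵥ (scaling d t *ᵥ leadParam d F β b y t ω)))
      atTop (id : EuclideanSpace ℝ (Fin q) → EuclideanSpace ℝ (Fin q)) (fun _ => P)
      (multivariateGaussian 0 Om) := by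
  have hT : ∀ t, AEMeasurable
      (fun ω => A t *ᵥ (scaling d t *ᵥ leadParam d F β b y t ω)) P := by
    intro t
    have hc : Continuous fun u : Param p (d.m t) => A t *ᵥ (scaling d t *ᵥ u) :=
      continuous_const.matrix_mulVec (continuous_const.matrix_mulVec continuous_id)
    exact hc.measurable.comp_aemeasurable (hy.aemeasurable_leadParam t)
  refine ⟨fun t => (PiLp.continuous_toLp 2 _).measurable.comp_aemeasurable (hT t),
    aemeasurable_id, ?_⟩
  refine ProbabilityMeasure.tendsto_iff_tendsto_charFun.2 fun v => ?_
  obtain ⟨a, ha0, ha⟩ := hA.exists_norm_row_le hreg.m_tendsto hm₀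
  have hσ : Tendsto (fun t => (v.ofLp ᵥ* A t) ⬝ᵥ (blockMatrix d F β b t *ᵥ (v.ofLp ᵥ* A t)))
      atTop (𝓝 (v.ofLp ⬝ᵥ (Om *ᵥ v.ofLp))) := by
    refine (tendsto_dotProduct_mulVec hlim (tendsto_const_nhds (x := v.ofLp))
      (tendsto_const_nhds (x := v.ofLp))).congr fun t => ?_
    rw [← mulVec_mulVec, ← mulVec_mulVec, mulVec_transpose, dotProduct_mulVec]
  have hα : ∀ᶠ t in atTop, ‖v.ofLp ᵥ* A t‖ ≤ ∑ r, |v r| * a := by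
    filter_upwards [ha] with t ht
    refine (pi_norm_le_iff_of_nonneg (by positivity)).2 fun s => ?_
    change |∑ r, v r * A t r s| ≤ _
    refine (Finset.abs_sum_le_sum_abs _ _).trans (Finset.sum_le_sum fun r _ => ?_)
    rw [abs_mul]
    gcongr
    exact (norm_le_pi_norm (A t r) s).trans (ht r)
  have hz : ∀ t, m₀ < d.m t → ∀ i : Fin (d.m t), m₀ ≤ i →
      Param.random (v.ofLp ᵥ* A t) i = 0 := by
    intro t hmt i hi
    ext k
    change ∑ r, v r * A t r (k, some i) = 0
    refine Finset.sum_eq_zero fun r _ => ?_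
    have : A t r (k, some i) = 0 := congrFun (row_random_eq_zero (hm₀ t hmt) r i hi) k
    exact mul_eq_zero_of_right _ this
  have hmain := tendsto_charFun_dotProduct_leadParam hreg hF h3 hst hy hα hz hσ
  have hgauss : charFun (multivariateGaussian 0 Om) v =
      Complex.exp (-((v.ofLp ⬝ᵥ (Om *ᵥ v.ofLp)) / 2 : ℝ)) := by
    rw [charFun_multivariateGaussian hOm]
    simp
  rw! [Measure.map_id]
  simp only [ProbabilityMeasure.coe_mk]
  rw [hgauss]
  refine hmain.congr fun t => ?_
  rw [charFun_map_toLp (hT t)]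
  simp_rw [dotProduct_mulVec]

theorem FiniteSelection.tendstoInMeasure_sub_leadParam (hA : FiniteSelection d A L)
    (hreg : d.Regime) (hF : CurvatureBounds F c₀)
    (h3 : Cond3 d F β b) (hst : ∀ᶠ t in atTop, StageBounds d F β b c₁ C₁ C₂ t)
    (hy : ResponseModel d F β b P y)
    (hm₀ : ∀ t, m₀ < d.m t → ∀ i, m₀ ≤ i → ∀ r k, entry (A t) r k (some i) = 0)
    {Ghat : ℕ → Ω → Matrix (Fin p) (Fin p) ℝ} {φhat : ℕ → Ω → ℝ} (h4 : Cond4 P Ghat φhat)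
    {θhat : ∀ t, Ω → Param p (d.m t)}
    (hθ : Tendsto (fun t => P {ω | ¬ IsPQLEstimate d F (fun i j => y t i j ω)
        (Ghat t ω) (φhat t ω) (θhat t ω)}) atTop (𝓝 0)) :
    TendstoInMeasure P (fun t ω => ‖WithLp.toLp 2 (A t *ᵥ (scaling d t *ᵥ
      (θhat t ω - target d β b t - leadParam d F β b y t ω)))‖) atTop (fun _ => 0) := by
  obtain ⟨Cb, hCb⟩ := h3.effects
  obtain ⟨a, ha0, ha⟩ := hA.exists_norm_row_le hreg.m_tendsto hm₀
  -- One bound for the centred effects of the finitely many selected clusters, independent of the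
  -- stage.
  obtain ⟨B, hB⟩ : ∃ B, B = ∑ i ∈ Finset.range m₀, ‖b i‖ + Cb := ⟨_, rfl⟩
  have hBi : ∀ i < m₀, ‖b i‖ + Cb ≤ B := fun i hi => by
    rw [hB]
    gcongr
    exact Finset.single_le_sum (f := fun i => ‖b i‖) (fun _ _ => norm_nonneg _)
      (Finset.mem_range.2 hi)
  refine tendstoInMeasure_of_errorBounds hreg hF h3 hst hy h4 hθ m₀ fun C hC δ hδ => ?_
  have hlim : Tendsto (fun t => (q : ℝ) *
      (p * (a * (C * Real.sqrt (C₂ * ((d.m t : ℝ) / d.nL t)))) + m₀ * (p * (a *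
        (Real.sqrt C₂ * (C * (1 + B) ^ 2 * (Real.sqrt (d.nL t))⁻¹ +
          C * (Real.sqrt (d.nL t))⁻¹ + Real.sqrt C * (Real.sqrt (d.m t))⁻¹))))))
      atTop (𝓝 0) := by
    have h1 := (((hreg.tendsto_sqrt_ratio C₂).const_mul C).const_mul a).const_mul (p : ℝ)
    have h2 := (((((hreg.tendsto_inv_sqrt_nL.const_mul (C * (1 + B) ^ 2)).add
      (hreg.tendsto_inv_sqrt_nL.const_mul C)).add
      (hreg.tendsto_inv_sqrt_m.const_mul (Real.sqrt C))).const_mul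
      (Real.sqrt C₂)).const_mul a).const_mul (p : ℝ)
    have := (h1.add (h2.const_mul (m₀ : ℝ))).const_mul (q : ℝ)
    simpa using this
  filter_upwards [hst, ha, hreg.m_tendsto.eventually_gt_atTop m₀,
    hlim.eventually_lt_const hδ] with t h hat hmt hlt ω e
  rw [abs_of_nonneg (norm_nonneg _)]
  refine lt_of_le_of_lt ((norm_toLp_le_sum _).trans ?_) hlt
  have hfix : (θhat t ω - target d β b t - leadParam d F β b y t ω : Param p (d.m t)).fixed =
      devMean d β b (θhat t ω) - leadMean d F β b y t ω := by
    ext k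
    simp only [Param.fixed, Pi.sub_apply (θhat t ω - target d β b t),
      sub_target_fixed h.one_le_m e.sum_random]
    rfl
  have hran : ∀ i, (θhat t ω - target d β b t - leadParam d F β b y t ω :
      Param p (d.m t)).random i = dev d β b (θhat t ω) i - lead d F β b y t i ω -
        devMean d β b (θhat t ω) := by
    intro i
    ext k
    simp only [Param.random, Pi.sub_apply (θhat t ω - target d β b t),
      sub_target_random h.one_le_m e.sum_random]
    exact sub_right_comm _ _ _
  have hrow : ∀ r, |(A t *ᵥ (scaling d t *ᵥ
      (θhat t ω - target d β b t - leadParam d F β b y t ω))) r| ≤ _ := fun r =>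
    abs_dotProduct_scaling_le (hat r) hmt (row_random_eq_zero (hm₀ t hmt) r)
      (hfix ▸ (e.sqrt_mul_norm_devMean_sub_le h).1)
      (fun i hi => (hran i).symm ▸ e.sqrt_mul_norm_dev_sub_le h hC hi
        ((norm_centred_le hCb h.one_le_m i).trans (hBi i hi)))
  refine (Finset.sum_le_sum fun r _ => hrow r).trans (le_of_eq ?_)
  rw [Finset.sum_const, Finset.card_univ, Fintype.card_fin, nsmul_eq_mul]

/-- Slutsky: the estimation error differs from the vector of leading terms by a remainder that
vanishes in probability after scaling and selection. -/
theorem FiniteSelection.tendstoInDistribution (hA : FiniteSelection d A L)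
    (hreg : d.Regime) (hF : CurvatureBounds F c₀)
    (h3 : Cond3 d F β b) (hst : ∀ᶠ t in atTop, StageBounds d F β b c₁ C₁ C₂ t)
    (hy : ResponseModel d F β b P y)
    (hm₀ : ∀ t, m₀ < d.m t → ∀ i, m₀ ≤ i → ∀ r k, entry (A t) r k (some i) = 0)
    {Ghat : ℕ → Ω → Matrix (Fin p) (Fin p) ℝ} {φhat : ℕ → Ω → ℝ} (h4 : Cond4 P Ghat φhat)
    {θhat : ∀ t, Ω → Param p (d.m t)} (hmeas : ∀ t, Measurable (θhat t))
    (hθ : Tendsto (fun t => P {ω | ¬ IsPQLEstimate d F (fun i j => y t i j ω)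
        (Ghat t ω) (φhat t ω) (θhat t ω)}) atTop (𝓝 0))
    {Om : Matrix (Fin q) (Fin q) ℝ} (hOm : Om.PosSemidef)
    (hlim : Tendsto (fun t => A t * blockMatrix d F β b t * (A t)ᵀ) atTop (𝓝 Om)) :
    TendstoInDistribution
      (fun t ω => WithLp.toLp 2 (A t *ᵥ (scaling d t *ᵥ (θhat t ω - target d β b t))))
      atTop (id : EuclideanSpace ℝ (Fin q) → EuclideanSpace ℝ (Fin q)) (fun _ => P)
      (multivariateGaussian 0 Om) := by
  refine tendstoInDistribution_of_tendstoInMeasure_sub _ _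
    (hA.tendstoInDistribution_leadParam hreg hF h3 hst hy hm₀ hOm hlim) ?_ fun t => ?_
  · have hsub := hA.tendstoInMeasure_sub_leadParam hreg hF h3 hst hy hm₀ h4 hθ
    rw [tendstoInMeasure_iff_norm] at hsub ⊢
    simpa [mulVec_sub] using hsub
  · have hc : Continuous fun u : Param p (d.m t) =>
        WithLp.toLp 2 (A t *ᵥ (scaling d t *ᵥ (u - target d β b t))) :=
      (PiLp.continuous_toLp 2 _).comp (continuous_const.matrix_mulVec
        (continuous_const.matrix_mulVec (continuous_id.sub continuous_const)))
    exact (hc.measurable.comp (hmeas t)).aemeasurable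

theorem posSemidef_limit {c : ℝ} (hc : 0 < c) (hK₀ : EigenvaluesWithin c K₀)
    (hK : ∀ i, EigenvaluesWithin c (K i)) (s : Finset ℕ) :
    (L none * K₀ * (L none)ᵀ + ∑ i ∈ s, L (some i) * K i * (L (some i))ᵀ).PosSemidef := by
  refine PosSemidef.add ?_ (posSemidef_sum _ fun i _ => ?_)
  · simpa only [conjTranspose_eq_transpose_of_trivial] using
      (hK₀.posDef hc).posSemidef.mul_mul_conjTranspose_same (L none)
  · simpa only [conjTranspose_eq_transpose_of_trivial] using
      ((hK i).posDef hc).posSemidef.mul_mul_conjTranspose_same (L (some i))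

end SelectionLaw

end PQL

end

/-! ### The theorem -/

theorem theorem1 {p : ℕ} (d : PQL.Design p) (F : PQL.ExpFamily) (β : Fin p → ℝ)
    (hreg : d.Regime) (hC1 : PQL.Cond1 F) :
    -- if the domain of `a` is the real line, `Cond3` holds for almost every realisation of the
    -- i.i.d. `N(0, G)` random effects
    (F.dom = Set.univ → ∀ G : Matrix (Fin p) (Fin p) ℝ, G.PosSemidef →
      ∀ᵐ b ∂(Measure.infinitePi fun _ : ℕ => multivariateGaussian (0 : EuclideanSpace ℝ (Fin p)) G),
        PQL.Cond3 d F β b) ∧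
    -- the conditional regime: `b` is the given sequence of true random effects, and `P` is the
    -- distribution of the data given `b`
    ∀ (b : ℕ → EuclideanSpace ℝ (Fin p)) (_ : PQL.Cond3 d F β b)
      (K₀ : Matrix (Fin p) (Fin p) ℝ) (K : ℕ → Matrix (Fin p) (Fin p) ℝ)
      (_ : PQL.Cond2 d F β b K₀ K)
      {Ω : Type*} [MeasurableSpace Ω] (P : Measure Ω) [IsProbabilityMeasure P]
      (y : ℕ → ℕ → ℕ → Ω → ℝ) (_ : PQL.ResponseModel d F β b P y)
      (Ghat : ℕ → Ω → Matrix (Fin p) (Fin p) ℝ) (φhat : ℕ → Ω → ℝ)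
      (_ : PQL.Cond4 P Ghat φhat) (_ : PQL.Cond5 d F β b P y Ghat φhat)
      (θhat : ∀ t, Ω → PQL.Param p (d.m t)) (_ : ∀ t, Measurable (θhat t))
      (_ : Tendsto (fun t => P {ω | ¬ PQL.IsPQLEstimate d F (fun i j => y t i j ω)
        (Ghat t ω) (φhat t ω) (θhat t ω)}) atTop (𝓝 0)),
      -- (a) consistency in maximum norm
      TendstoInMeasure P (fun t ω => ‖θhat t ω - PQL.target d β b t‖) atTop (fun _ => 0) ∧
      -- (b) asymptotic normality of finite selections
      ∀ (q : ℕ) (A : ∀ t, Matrix (Fin q) (Fin p × Option (Fin (d.m t))) ℝ)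
        (L : Option ℕ → Matrix (Fin q) (Fin p) ℝ) (_ : PQL.FiniteSelection d A L),
        ∃ Om : Matrix (Fin q) (Fin q) ℝ,
          Om.PosSemidef ∧
          Tendsto (fun t => A t * PQL.blockMatrix d F β b t * (A t)ᵀ) atTop (𝓝 Om) ∧
          Om = L none * K₀ * (L none)ᵀ + ∑ᶠ i : ℕ, L (some i) * K i * (L (some i))ᵀ ∧
          TendstoInDistribution
            (fun t ω => WithLp.toLp 2
              (A t *ᵥ (PQL.scaling d t *ᵥ (θhat t ω - PQL.target d β b t))))
            atTop (id : EuclideanSpace ℝ (Fin q) → EuclideanSpace ℝ (Fin q)) (fun _ => P)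
            (multivariateGaussian 0 Om) := by
  obtain ⟨c₀, hF⟩ := hC1.exists_curvatureBounds
  refine ⟨fun hdom G _ => PQL.ae_cond3_of_gaussian d F β hdom G, ?_⟩
  intro b h3 K₀ K h2 Ω _ P _ y hy Ghat φhat h4 _ θhat hmeas hθ
  obtain ⟨c₁, C₁, C₂, hst⟩ := PQL.eventually_stageBounds hreg h2 h3
  refine ⟨PQL.tendstoInMeasure_norm_sub_target hreg hF h3 hst hy h4 hθ, ?_⟩
  intro q A L hA
  obtain ⟨m₀, hm₀⟩ := hA.exists_entry_eq_zero
  obtain ⟨c, hc, -, hK, hK₀⟩ := h2.eigenvalues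
  have hOm := PQL.posSemidef_limit (L := L) hc hK₀ hK (Finset.range m₀)
  have hlim := hA.tendsto_mul_blockMatrix_mul hreg.m_tendsto h2 hm₀
  refine ⟨_, hOm, hlim, ?_,
    hA.tendstoInDistribution hreg hF h3 hst hy hm₀ h4 hmeas hθ hOm hlim⟩
  congr 1
  -- The limits of the blocks from `m₀` on are zero, so the infinite sum is the finite one that
  -- arose in the limit.
  refine (finsum_eq_sum_of_support_subset _ fun i hi => ?_).symm
  by_contra hi'
  refine hi ?_
  have hle : m₀ ≤ i := not_lt.1 fun h => hi' (Finset.mem_coe.2 (Finset.mem_range.2 h))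
  simp only [hA.limit_eq_zero hreg.m_tendsto hm₀ hle, Matrix.zero_mul]
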